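/- **Setting.** Let $a>0$, $b,c,\theta_1,\theta_2\in\mathbb R$, $0<h_m<h_M$, and $\mathcal H=L^2(0,1)$ (real-valued functions) with its usual inner product $\langle\cdot,\cdot\rangle$ and norm $\|\cdot\|$. On $H^2(0,1)$ put $\mathcal A f=af''+bf$, $\mathcal A_c f=\mathcal A f+cf$ and $\mathcal Bf=(\cos\theta_1 f(0)-\sin\theta_1 f'(0),\ \cos\theta_2 f(1)+\sin\theta_2 f'(1))\in\mathbb R^2$. Let $\mathcal A_0$, $\mathcal A_{c,0}$ be the restrictions of $\mathcal A$, $\mathcal A_c$ to $H^2(0,1)\cap\ker\mathcal B$, let $S(t)$ be the $C_0$-semigroup on $\mathcal H$ generated by $\mathcal A_0$, let $\lambda_1>\lambda_2>\cdots$ be the eigenvalues of $\mathcal A_{c,0}$, and let $e_n$ be a unit eigenvector of $\mathcal A_{c,0}$ for $\lambda_n$. Fix an integer $k\ge2$ with $\cos\theta_m+k\sin\theta_m\ne0$ for $m=1,2$, and for $u\in\mathbb R^2$ let $$[L_ku](x)=\frac{u_1(1-x)^k}{\cos\theta_1+k\sin\theta_1}+\frac{u_2x^k}{\cos\theta_2+k\sin\theta_2}.$$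 For $N_0\ge1$ let $A=\mathrm{diag}(\lambda_1,\dots,\lambda_{N_0})$ and $B=(b_{n,m})\in\mathbb R^{N_0\times2}$ with $b_{n,m}=-\lambda_n\langle L_kf_m,e_n\rangle+\langle\mathcal A_cL_kf_m,e_n\rangle$, where $(f_1,f_2)$ is the canonical basis of $\mathbb R^2$. Consider the delayed boundary control system $$\dot X(t)=\mathcal AX(t)+cX(t-h(t))+p(t),\qquad \mathcal BX(t)=u(t)\quad(t>0),\qquad X(\tau)=\Phi(\tau)\quad(\tau\in[-h_M,0]),$$ that is, $y_t=ay_{xx}+by+cy(t-h(t),\cdot)+d$ with $X(t)=y(t,\cdot)$, $p(t)=d(t,\cdot)$, $\Phi(\tau)=\phi(\tau,\cdot)$ and Robin boundary inputs $u=(u_1,u_2)$. For $K\in\mathbb R^{2\times N_0}$, a mild solution of this system in closed loop with $u=KY$, $Y(t)=(\langle X(t),e_1\rangle,\dots,\langle X(t),e_{N_0}\rangle)^\top$, is a function $X$ on $[-h_M,\infty)$, continuous on $[0,\infty)$ with values in $\mathcal H$, with $X=\Phi$ on $[-h_M,0]$, such that $u=KY$ is absolutely continuous on every compact interval of $[0,\infty)$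 and, for all $t\ge0$, $$X(t)=S(t)\{\Phi(0)-L_ku(0)\}+L_ku(t)+\int_0^tS(t-s)\{\mathcal AL_ku(s)-L_k\dot u(s)+cX(s-h(s))+p(s)\}\,ds.$$ **Theorem.** Let $N_0\ge1$ be such that $\lambda_{N_0+1}<-2\sqrt5\,|c|$, and let $K\in\mathbb R^{2\times N_0}$ be such that the eigenvalues $\mu_1,\dots,\mu_{N_0}\in\mathbb C$ of $A+BK$ are simple and satisfy $\operatorname{Re}\mu_n<-3|c|$ for all $1\le n\le N_0$. Then there exist constants $\kappa,C_0,C_1>0$ such that, for every $\Phi\in\mathcal C^0([-h_M,0];\mathcal H)$, every $p\in L^\infty_{\mathrm{loc}}(\mathbb R_+;\mathcal H)$ and every continuous $h:\mathbb R_+\to\mathbb R$ with $h_m\le h\le h_M$, the closed-loop system with $u=KY$ has a unique mild solution $X$, and for all $t\ge0$ $$\|X(t)\|\le C_0e^{-\kappa t}\sup_{\tau\in[-h_M,0]}\|\Phi(\tau)\|+C_1\operatorname*{ess\,sup}_{\tau\in[0,t]}e^{-\kappa(t-\tau)}\|p(\tau)\|,$$ $$\|u(t)\|\le C_0\|K\|e^{-\kappa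 t}\sup_{\tau\in[-h_M,0]}\|\Phi(\tau)\|+C_1\|K\|\operatorname*{ess\,sup}_{\tau\in[0,t]}e^{-\kappa(t-\tau)}\|p(\tau)\|,$$ where $\mathbb R^2$ carries the Euclidean norm and $\|K\|$ is the induced matrix norm. -/

import Mathlib

open MeasureTheory Set Filter Topology
open scoped Matrix.Norms.L2Operator

namespace DelayRD

noncomputable section

/-- Lebesgue measure on the open interval `(0,1)`. -/
abbrev unitMeasure : Measure ℝ := volume.restrict (Ioo (0 : ℝ) 1)

/-- The real Hilbert space `L²(0,1)`. -/
abbrev L2 : Type := Lp ℝ 2 unitMeasure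

theorem memLp_of_continuous {f : ℝ → ℝ} (hf : Continuous f) : MemLp f 2 unitMeasure := by
  obtain ⟨M, hM⟩ := (isCompact_Icc (a := (0 : ℝ)) (b := 1)).exists_bound_of_continuousOn
    hf.continuousOn
  refine MemLp.of_bound hf.aestronglyMeasurable M ?_
  filter_upwards [ae_restrict_mem measurableSet_Ioo] with x hx
  exact hM x (Ioo_subset_Icc_self hx)

/-- The class in `L²(0,1)` of a continuous function. -/
def ofContinuous (f : ℝ → ℝ) (hf : Continuous f) : L2 := (memLp_of_continuous hf).toLp f

/-- Coefficients of `y_t = a y_xx + b y + c y(t - h(t)) + d`, with the Robin conditions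
`cos θ₁ y(0) - sin θ₁ y_x(0) = u₁` and `cos θ₂ y(1) + sin θ₂ y_x(1) = u₂`. -/
structure Coeffs where
  a : ℝ
  b : ℝ
  c : ℝ
  θ₁ : ℝ
  θ₂ : ℝ
  a_pos : 0 < a

/-- `f ∈ H²(0,1)`, with continuously differentiable representative `v` on `[0,1]`, absolutely
continuous first derivative `w`, and second derivative `q ∈ L²(0,1)`. -/
def IsH2 (f : L2) (v w : ℝ → ℝ) (q : L2) : Prop :=
  f =ᵐ[unitMeasure] v ∧
  (∀ x ∈ Icc (0 : ℝ) 1, v x = v 0 + ∫ s in (0 : ℝ)..x, w s) ∧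
  (∀ x ∈ Icc (0 : ℝ) 1, w x = w 0 + ∫ s in (0 : ℝ)..x, q s)

/-- The graph of `f ↦ a f'' + r f` on `{f ∈ H²(0,1) | ℬ f = 0}`, where
`ℬ f = (cos θ₁ f(0) - sin θ₁ f'(0), cos θ₂ f(1) + sin θ₂ f'(1))`. It is the graph of `𝒜₀` for
`r = b` and the graph of `𝒜_{c,0} = 𝒜₀ + c I` for `r = b + c`. -/
def RobinGraph (P : Coeffs) (r : ℝ) (f g : L2) : Prop :=
  ∃ (v w : ℝ → ℝ) (q : L2), IsH2 f v w q ∧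
    Real.cos P.θ₁ * v 0 - Real.sin P.θ₁ * w 0 = 0 ∧
    Real.cos P.θ₂ * v 1 + Real.sin P.θ₂ * w 1 = 0 ∧
    g = P.a • q + r • f

/-- The set of eigenvalues of `𝒜_{c,0}`. -/
def eigenvalues (P : Coeffs) : Set ℝ :=
  {μ | ∃ f : L2, f ≠ 0 ∧ RobinGraph P (P.b + P.c) f (μ • f)}

/-- The eigenvalues of `𝒜_{c,0}` in strictly decreasing order: `lam P n` is `λ_{n+1}`. -/
def lam (P : Coeffs) : ℕ → ℝ
  | 0 => sSup (eigenvalues P)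
  | n + 1 => sSup {μ | μ ∈ eigenvalues P ∧ μ < lam P n}

/-- `f` is a unit eigenvector of `𝒜_{c,0}` for the eigenvalue `μ`. -/
def IsUnitEigenvector (P : Coeffs) (μ : ℝ) (f : L2) : Prop :=
  ‖f‖ = 1 ∧ RobinGraph P (P.b + P.c) f (μ • f)

/-- `k` is an admissible exponent of the lifting operator `L_k`. -/
def IsLiftExponent (P : Coeffs) (k : ℕ) : Prop :=
  2 ≤ k ∧ Real.cos P.θ₁ + k * Real.sin P.θ₁ ≠ 0 ∧ Real.cos P.θ₂ + k * Real.sin P.θ₂ ≠ 0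

/-- The function `x ↦ [L_k u](x)`. -/
def liftFun (P : Coeffs) (k : ℕ) (u : EuclideanSpace ℝ (Fin 2)) (x : ℝ) : ℝ :=
  u 0 * (1 - x) ^ k / (Real.cos P.θ₁ + k * Real.sin P.θ₁) +
    u 1 * x ^ k / (Real.cos P.θ₂ + k * Real.sin P.θ₂)

theorem contDiff_liftFun (P : Coeffs) (k : ℕ) (u : EuclideanSpace ℝ (Fin 2)) :
    ContDiff ℝ 2 (liftFun P k u) := by
  unfold liftFun
  fun_prop

/-- `L_k u` as an element of `L²(0,1)`. -/
def lift (P : Coeffs) (k : ℕ) (u : EuclideanSpace ℝ (Fin 2)) : L2 :=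
  ofContinuous (liftFun P k u) (contDiff_liftFun P k u).continuous

theorem continuous_opLiftFun (P : Coeffs) (r : ℝ) (k : ℕ) (u : EuclideanSpace ℝ (Fin 2)) :
    Continuous fun x => P.a * iteratedDeriv 2 (liftFun P k u) x + r * liftFun P k u x :=
  (continuous_const.mul ((contDiff_liftFun P k u).continuous_iteratedDeriv 2 le_rfl)).add
    (continuous_const.mul (contDiff_liftFun P k u).continuous)

/-- `a (L_k u)'' + r L_k u`: this is `𝒜 L_k u` for `r = b` and `𝒜_c L_k u` for `r = b + c`. -/
def opLift (P : Coeffs) (r : ℝ) (k : ℕ) (u : EuclideanSpace ℝ (Fin 2)) : L2 :=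
  ofContinuous (fun x => P.a * iteratedDeriv 2 (liftFun P k u) x + r * liftFun P k u x)
    (continuous_opLiftFun P r k u)

/-- A strongly continuous semigroup of bounded operators; only times `t ≥ 0` matter. -/
structure IsC0Semigroup (S : ℝ → L2 →L[ℝ] L2) : Prop where
  zero : S 0 = ContinuousLinearMap.id ℝ L2
  add : ∀ s t, 0 ≤ s → 0 ≤ t → S (s + t) = (S s).comp (S t)
  cont : ∀ f, ContinuousOn (fun t => S t f) (Ici 0)

/-- `S` is the `C₀`-semigroup whose infinitesimal generator is the operator with graph `G`. -/
def IsGeneratedBy (S : ℝ → L2 →L[ℝ] L2) (G : L2 → L2 → Prop) : Prop :=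
  IsC0Semigroup S ∧
    ∀ f g, G f g ↔ Tendsto (fun t : ℝ => t⁻¹ • (S t f - f)) (𝓝[>] 0) (𝓝 g)

/-- `X` is a mild solution of
`X'(t) = 𝒜 X(t) + c X(t - h(t)) + p(t)`, `ℬ X(t) = u(t)`, `X = Φ` on `[-h_M, 0]`,
for the locally absolutely continuous boundary input `u`; here `S` is the semigroup generated
by `𝒜₀`, which its generator determines. -/
def IsMildSolution (P : Coeffs) (k : ℕ) (hM : ℝ) (h : ℝ → ℝ) (Φ p : ℝ → L2)
    (u : ℝ → EuclideanSpace ℝ (Fin 2)) (X : ℝ → L2) : Prop :=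
  ContinuousOn X (Ici 0) ∧ EqOn X Φ (Icc (-hM) 0) ∧
  (∀ T, 0 ≤ T → AbsolutelyContinuousOnInterval u 0 T) ∧
  ∃ S : ℝ → L2 →L[ℝ] L2, IsGeneratedBy S (RobinGraph P P.b) ∧
    ∀ t, 0 ≤ t →
      X t = S t (Φ 0 - lift P k (u 0)) + lift P k (u t) +
        ∫ s in (0 : ℝ)..t, S (t - s)
          (opLift P P.b k (u s) - lift P k (deriv u s) + P.c • X (s - h s) + p s)

/-- `A = diag(λ₁, …, λ_{N₀})`. -/
def matA (P : Coeffs) (N₀ : ℕ) : Matrix (Fin N₀) (Fin N₀) ℝ :=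
  Matrix.diagonal fun i => lam P i

/-- `B = (b_{n,m})`, with `b_{n,m} = -λ_n ⟨L_k f_m, e_n⟩ + ⟨𝒜_c L_k f_m, e_n⟩` and `(f₁, f₂)` the
canonical basis of `ℝ²`. -/
def matB (P : Coeffs) (k : ℕ) {N₀ : ℕ} (e : Fin N₀ → L2) : Matrix (Fin N₀) (Fin 2) ℝ :=
  Matrix.of fun n m =>
    -lam P n * inner ℝ (lift P k (EuclideanSpace.single m 1)) (e n) +
      inner ℝ (opLift P (P.b + P.c) k (EuclideanSpace.single m 1)) (e n)

/-- The feedback `u = K Y`, with `Y(t) = (⟨X(t), e₁⟩, …, ⟨X(t), e_{N₀}⟩)`. -/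
def feedback {N₀ : ℕ} (e : Fin N₀ → L2) (K : Matrix (Fin 2) (Fin N₀) ℝ) (X : ℝ → L2) (t : ℝ) :
    EuclideanSpace ℝ (Fin 2) :=
  WithLp.toLp 2 (K.mulVec fun i => inner ℝ (X t) (e i))

/-- `ess sup_{τ ∈ [0,t]} e^{-κ(t-τ)} ‖p(τ)‖`. -/
def fadingEssSup (κ : ℝ) (p : ℝ → L2) (t : ℝ) : ℝ :=
  (eLpNorm (fun τ => Real.exp (-κ * (t - τ)) • p τ) ⊤ (volume.restrict (Icc 0 t))).toReal

/-- `sup_{τ ∈ [-h_M,0]} ‖Φ(τ)‖`. -/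
def supHistory (hM : ℝ) (Φ : ℝ → L2) : ℝ :=
  sSup ((fun τ => ‖Φ τ‖) '' Icc (-hM) 0)

end

end DelayRD

namespace DelayRD

noncomputable section

/-! ### Absolute continuity and primitives -/

/-! The operator `𝒜_{c,0}` is self-adjoint with compact resolvent, hence diagonal in an orthonormal
eigenbasis (`exists_eigenbasis`), and `𝒜₀` acts there with exponents `λ_n - c`. Whatever semigroup a
mild solution uses is therefore the diagonal one (`IsGeneratedBy.eq_diagSemigroup`). Testing the
mild formula against an eigenvector and integrating `L_k u'` by parts (`modal_duhamel`) gives `y_n'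
= (λ_n - c) y_n + c y_n(t - h) + (B u)_n + p_n`. With `u = K Y` the first `N₀` modes form a closed
delay system with matrix `A + B K - c I` (`output_eq_integral`).

Decay rests on one estimate, `delay_decay`. Suppose the undelayed part decays like `e^{-α t}` with
`α > |c|`. In the norm `sup e^{κ t} ‖z(t)‖` the delayed term then has gain `|c| e^{κ h_M} / (α -
κ)`, which is less than one for small `κ > 0`, however `h` varies below `h_M`. The estimate is used
twice.

For the controlled modes, the left eigenvectors of `A + B K` span because the eigenvalues are
simple, and they split the system into scalar complex equations with exponents `μ_n - c`
(`exists_output_bound`). This bounds `Y` and `u = K Y`; the system itself then bounds `u'` almost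
everywhere.

For the tail, the spectral projection onto eigenvalues at most `λ_{N₀+1}` is applied to the mild
formula with `u'` left in place (`tail_bound`), because the modal form contains `λ_n L_k u`, whose
coefficient is unbounded in `n`. Both applications need only `Re μ_n` and `λ_{N₀+1}` below `c -
|c|`. As `c - |c| ≥ -2|c|`, the hypotheses give this.

For existence, the lower bound `h ≥ h_m > 0` permits the method of steps. The finite-dimensional
system is solved for `Y`, the input `K Y` is fed into the open-loop problem, and the output of its
solution is shown to be `Y` again (`exists_closed_loop`). For uniqueness, the difference of two
solutions is a mild solution with zero data, and the a priori estimate `exists_state_bound` makes it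
vanish. -/

theorem absolutelyContinuousOnInterval_of_dist_le {E F : Type*} [PseudoMetricSpace E]
    [PseudoMetricSpace F] {f : ℝ → E} {g : ℝ → F} {a b C : ℝ}
    (hg : AbsolutelyContinuousOnInterval g a b)
    (hfg : ∀ x ∈ uIcc a b, ∀ y ∈ uIcc a b, dist (f x) (f y) ≤ C * dist (g x) (g y)) :
    AbsolutelyContinuousOnInterval f a b := by
  rw [absolutelyContinuousOnInterval_iff] at hg ⊢
  intro ε hε
  obtain ⟨δ, hδ, H⟩ := hg (ε / (|C| + 1)) (by positivity)
  refine ⟨δ, hδ, fun I hI hI' => ?_⟩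
  have h1 := H I hI hI'
  have hC : (0 : ℝ) < |C| + 1 := by positivity
  calc ∑ i ∈ Finset.range I.1, dist (f (I.2 i).1) (f (I.2 i).2)
      ≤ ∑ i ∈ Finset.range I.1, (|C| + 1) * dist (g (I.2 i).1) (g (I.2 i).2) := by
        refine Finset.sum_le_sum fun i hi => ?_
        have hm := hI.1 i hi
        refine (hfg _ hm.1 _ hm.2).trans ?_
        gcongr
        linarith [le_abs_self C]
    _ = (|C| + 1) * ∑ i ∈ Finset.range I.1, dist (g (I.2 i).1) (g (I.2 i).2) := by
        rw [Finset.mul_sum]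
    _ < (|C| + 1) * (ε / (|C| + 1)) := by gcongr
    _ = ε := by field_simp

variable {E F : Type*} [NormedAddCommGroup E] [NormedSpace ℝ E]
  [NormedAddCommGroup F] [NormedSpace ℝ F]

/-- Increments of a vector-valued primitive are dominated by those of the real primitive of the
norm, which transfers absolute continuity from the real case. -/
theorem norm_intervalIntegral_sub_le {φ : ℝ → E} {T x y : ℝ}
    (hφ : IntervalIntegrable φ volume 0 T) (hx : x ∈ uIcc 0 T) (hy : y ∈ uIcc 0 T) :
    ‖(∫ s in (0 : ℝ)..x, φ s) - ∫ s in (0 : ℝ)..y, φ s‖ ≤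
      |(∫ s in (0 : ℝ)..x, ‖φ s‖) - ∫ s in (0 : ℝ)..y, ‖φ s‖| := by
  have hsub : ∀ z ∈ uIcc 0 T, IntervalIntegrable φ volume 0 z := fun z hz =>
    hφ.mono_set (uIcc_subset_uIcc left_mem_uIcc hz)
  rw [intervalIntegral.integral_interval_sub_left (hsub x hx) (hsub y hy),
    intervalIntegral.integral_interval_sub_left (hsub x hx).norm (hsub y hy).norm]
  exact intervalIntegral.norm_integral_le_abs_integral_norm

/-- The product rule in integrated form, for a `C¹` family of operators acting on a primitive. -/
theorem clm_apply_primitive [CompleteSpace E] [CompleteSpace F] {G G' : ℝ → E →L[ℝ] F}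
    (hG : ∀ t, HasDerivAt G (G' t) t) (hG' : Continuous G') {φ : ℝ → E} {T : ℝ} (hT : 0 ≤ T)
    (hφ : IntervalIntegrable φ volume 0 T) (v₀ : E) :
    G T (v₀ + ∫ s in (0 : ℝ)..T, φ s) = G 0 v₀ +
      ∫ s in (0 : ℝ)..T, (G' s (v₀ + ∫ r in (0 : ℝ)..s, φ r) + G s (φ s)) := by
  set V : ℝ → E := fun t => v₀ + ∫ s in (0 : ℝ)..t, φ s with hV
  have hGc : Continuous G := continuous_iff_continuousAt.2 fun t => (hG t).continuousAt
  have hVc : ContinuousOn V (uIcc 0 T) :=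
    continuousOn_const.add (intervalIntegral.continuousOn_primitive_interval
      (by rw [uIcc_of_le hT]
          exact (intervalIntegrable_iff_integrableOn_Icc_of_le hT).1 hφ))
  have hGφ : IntervalIntegrable (fun s => G s (φ s)) volume 0 T := by
    obtain ⟨C, hC⟩ := (isCompact_uIcc (a := (0 : ℝ)) (b := T)).exists_bound_of_continuousOn
      hGc.continuousOn
    refine IntervalIntegrable.mono_fun' (g := fun s => C * ‖φ s‖) (hφ.norm.const_mul C) ?_ ?_
    · exact (isBoundedBilinearMap_apply (𝕜 := ℝ) (E := E) (F := F)).continuous.comp_aestronglyMeasurable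
        (hGc.aestronglyMeasurable.prodMk hφ.aestronglyMeasurable_restrict_uIoc)
    · filter_upwards [ae_restrict_mem measurableSet_uIoc] with s hs
      exact (G s).le_of_opNorm_le (hC s (uIoc_subset_uIcc hs)) _
  have hGV : ContinuousOn (fun s => G' s (V s)) (uIcc 0 T) := hG'.continuousOn.clm_apply hVc
  have hψ : IntervalIntegrable (fun s => G' s (V s) + G s (φ s)) volume 0 T :=
    hGV.intervalIntegrable.add hGφ
  set ψ : ℝ → F := fun s => G' s (V s) + G s (φ s) with hψdef
  -- The claim is that `D` is constant: it is absolutely continuous and its derivative vanishes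
  -- almost everywhere.
  set D : ℝ → F := fun t => G t (V t) - ∫ s in (0 : ℝ)..t, ψ s with hD
  obtain ⟨C1, hC1⟩ := (isCompact_uIcc (a := (0 : ℝ)) (b := T)).exists_bound_of_continuousOn
      hGc.continuousOn
  obtain ⟨C2, hC2⟩ := (isCompact_uIcc (a := (0 : ℝ)) (b := T)).exists_bound_of_continuousOn
      hG'.continuousOn
  obtain ⟨C3, hC3⟩ := (isCompact_uIcc (a := (0 : ℝ)) (b := T)).exists_bound_of_continuousOn hVc
  have h0 : (0 : ℝ) ∈ uIcc 0 T := left_mem_uIcc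
  have hC1' : 0 ≤ C1 := (norm_nonneg _).trans (hC1 0 h0)
  have hC2' : 0 ≤ C2 := (norm_nonneg _).trans (hC2 0 h0)
  have hC3' : 0 ≤ C3 := (norm_nonneg _).trans (hC3 0 h0)
  have hGlip : ∀ x ∈ uIcc 0 T, ∀ y ∈ uIcc 0 T, ‖G x - G y‖ ≤ C2 * |x - y| := by
    intro x hx y hy
    exact (convex_uIcc 0 T).norm_image_sub_le_of_norm_hasDerivWithin_le
      (fun z hz => (hG z).hasDerivWithinAt) (fun z hz => hC2 z hz) hy hx
  -- The splitting `G x (V x) - G y (V y) = G x (V x - V y) + (G x - G y) (V y)` bounds the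
  -- increments of `G V` by those of `C1 ∫ ‖φ‖ + C2 C3 t`, a real absolutely continuous function.
  have hAC1 : AbsolutelyContinuousOnInterval
      (fun t => C1 • (∫ s in (0 : ℝ)..t, ‖φ s‖) ) 0 T :=
    (hφ.norm.absolutelyContinuousOnInterval_intervalIntegral left_mem_uIcc).const_smul C1
  have hACid : AbsolutelyContinuousOnInterval (fun t : ℝ => (C2 * C3) • t) 0 T :=
    (LipschitzWith.id.lipschitzOnWith.absolutelyContinuousOnInterval).const_smul (C2 * C3)
  have hACψ : AbsolutelyContinuousOnInterval (fun t => ∫ s in (0 : ℝ)..t, ‖ψ s‖) 0 T :=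
    hψ.norm.absolutelyContinuousOnInterval_intervalIntegral left_mem_uIcc
  have hmono : ∀ (f : ℝ → ℝ), IntervalIntegrable f volume 0 T → (∀ s, 0 ≤ f s) →
      ∀ x ∈ uIcc 0 T, ∀ y ∈ uIcc 0 T, y ≤ x →
        0 ≤ (∫ s in (0 : ℝ)..x, f s) - ∫ s in (0 : ℝ)..y, f s := by
    intro f hf hf0 x hx y hy hyx
    rw [intervalIntegral.integral_interval_sub_left
      (hf.mono_set (uIcc_subset_uIcc left_mem_uIcc hx))
      (hf.mono_set (uIcc_subset_uIcc left_mem_uIcc hy))]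
    exact intervalIntegral.integral_nonneg hyx fun s _ => hf0 s
  have hACD : AbsolutelyContinuousOnInterval D 0 T := by
    refine AbsolutelyContinuousOnInterval.sub ?_ ?_
    · refine absolutelyContinuousOnInterval_of_dist_le (C := 1) (hAC1.add hACid) ?_
      have key : ∀ x ∈ uIcc 0 T, ∀ y ∈ uIcc 0 T, y ≤ x → dist (G x (V x)) (G y (V y)) ≤
          1 * dist (((fun t => C1 • (∫ s in (0 : ℝ)..t, ‖φ s‖)) + fun t : ℝ => (C2 * C3) • t) x)
          (((fun t => C1 • (∫ s in (0 : ℝ)..t, ‖φ s‖)) + fun t : ℝ => (C2 * C3) • t) y) := by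
        intro x hx y hy hyx
        have e1 : G x (V x) - G y (V y) = G x (V x - V y) + (G x - G y) (V y) := by
          simp
        have e2 : ‖V x - V y‖ ≤ (∫ s in (0 : ℝ)..x, ‖φ s‖) - ∫ s in (0 : ℝ)..y, ‖φ s‖ := by
          have := norm_intervalIntegral_sub_le hφ hx hy
          rw [abs_of_nonneg (hmono _ hφ.norm (fun s => norm_nonneg _) x hx y hy hyx)] at this
          simpa [hV] using this
        have e3 : ‖G x (V x - V y)‖ ≤
            C1 * ((∫ s in (0 : ℝ)..x, ‖φ s‖) - ∫ s in (0 : ℝ)..y, ‖φ s‖) :=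
          ((G x).le_opNorm _).trans (mul_le_mul (hC1 x hx) e2 (norm_nonneg _) hC1')
        have e4 : ‖(G x - G y) (V y)‖ ≤ C2 * |x - y| * C3 :=
          ((G x - G y).le_opNorm _).trans (mul_le_mul (hGlip x hx y hy) (hC3 y hy)
            (norm_nonneg _) (by positivity))
        rw [abs_of_nonneg (sub_nonneg.2 hyx)] at e4
        rw [dist_eq_norm, e1, Real.dist_eq, one_mul]
        refine (norm_add_le _ _).trans ((add_le_add e3 e4).trans (le_trans ?_ (le_abs_self _)))
        simp only [Pi.add_apply, smul_eq_mul]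
        apply le_of_eq; ring
      intro x hx y hy
      rcases le_total y x with h | h
      · exact key x hx y hy h
      · have := key y hy x hx h
        rw [dist_comm (G x _)]
        exact this.trans_eq (by rw [dist_comm])
    · refine absolutelyContinuousOnInterval_of_dist_le (C := 1) hACψ fun x hx y hy => ?_
      rw [one_mul, dist_eq_norm, Real.dist_eq]
      exact norm_intervalIntegral_sub_le hψ hx hy
  have hder : ∀ᵐ x, x ∈ uIcc 0 T → HasDerivAt D 0 x := by
    filter_upwards [hφ.ae_hasDerivAt_integral, hψ.ae_hasDerivAt_integral] with x h1 h2 hx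
    have hVd : HasDerivAt V (φ x) x := (h1 hx 0 h0).const_add v₀
    have := ((hG x).clm_apply hVd).sub (h2 hx 0 h0)
    rwa [sub_self] at this
  obtain ⟨c, hc⟩ := hACD.const_of_ae_hasDerivAt_zero hder
  have hd : D T = D 0 := (hc T right_mem_uIcc).trans (hc 0 h0).symm
  simp only [hD, intervalIntegral.integral_same, sub_zero] at hd
  rw [sub_eq_iff_eq_add] at hd
  rw [hd]
  simp [hV]

end

end DelayRD

namespace DelayRD

noncomputable section

section
variable {E F : Type*} [NormedAddCommGroup E] [NormedSpace ℝ E]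
  [NormedAddCommGroup F] [NormedSpace ℝ F]

theorem absolutelyContinuousOnInterval_of_eq_primitive {u φ : ℝ → E} {T : ℝ} (hT : 0 ≤ T)
    (hφ : IntervalIntegrable φ volume 0 T)
    (hu : ∀ t ∈ Icc 0 T, u t = u 0 + ∫ s in (0 : ℝ)..t, φ s) :
    AbsolutelyContinuousOnInterval u 0 T := by
  refine absolutelyContinuousOnInterval_of_dist_le (C := 1)
    (hφ.norm.absolutelyContinuousOnInterval_intervalIntegral left_mem_uIcc) fun x hx y hy => ?_
  rw [one_mul, dist_eq_norm, Real.dist_eq, hu x (by rwa [uIcc_of_le hT] at hx),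
    hu y (by rwa [uIcc_of_le hT] at hy), add_sub_add_left_eq_sub]
  exact norm_intervalIntegral_sub_le hφ hx hy

theorem ae_deriv_eq_of_eq_primitive [CompleteSpace E] {u φ : ℝ → E} {T : ℝ} (hT : 0 ≤ T)
    (hφ : IntervalIntegrable φ volume 0 T)
    (hu : ∀ t ∈ Icc 0 T, u t = u 0 + ∫ s in (0 : ℝ)..t, φ s) :
    ∀ᵐ s, s ∈ uIoc 0 T → deriv u s = φ s := by
  -- The endpoint is discarded because `u` is known to be a primitive only on `[0, T]`, hence not in
  -- a neighbourhood of `T`.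
  have hne : ∀ᵐ s : ℝ, s ≠ T := by simp [ae_iff, measure_singleton]
  filter_upwards [hφ.ae_hasDerivAt_integral, hne] with s hs hsT hmem
  rw [uIoc_of_le hT] at hmem
  have h1 := (hs (by rw [uIcc_of_le hT]; exact ⟨hmem.1.le, hmem.2⟩) 0 left_mem_uIcc).const_add (u 0)
  refine (h1.congr_of_eventuallyEq ?_).deriv
  filter_upwards [Ioo_mem_nhds hmem.1 (lt_of_le_of_ne hmem.2 hsT)] with t ht
  exact hu t ⟨ht.1.le, ht.2.le⟩

/-- Almost everywhere differentiability and the fundamental theorem of calculus are applied to each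
real coordinate and reassembled. -/
theorem absolutelyContinuousOnInterval_euclidean {ι : Type*} [Fintype ι]
    {u : ℝ → EuclideanSpace ℝ ι} {T : ℝ} (hT : 0 ≤ T)
    (hu : AbsolutelyContinuousOnInterval u 0 T) :
    IntervalIntegrable (deriv u) volume 0 T ∧
      (∀ᵐ s, s ∈ uIcc 0 T → DifferentiableAt ℝ u s) ∧
      ∀ t ∈ Icc 0 T, u t = u 0 + ∫ s in (0 : ℝ)..t, deriv u s := by
  have hc : ∀ i, AbsolutelyContinuousOnInterval (fun t => u t i) 0 T := fun i =>
    absolutelyContinuousOnInterval_of_dist_le (C := 1) hu fun x _ y _ => by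
      rw [one_mul, dist_eq_norm, dist_eq_norm]
      exact PiLp.norm_apply_le (u x - u y) i
  have hd : ∀ᵐ s, s ∈ uIcc 0 T → DifferentiableAt ℝ u s := by
    filter_upwards [ae_all_iff.2 fun i => (hc i).ae_differentiableAt] with s hs hmem
    exact differentiableAt_euclidean.2 fun i => hs i hmem
  have hdi : ∀ i, ∀ᵐ s, s ∈ uIcc 0 T → deriv (fun t => u t i) s = deriv u s i := by
    intro i
    filter_upwards [hd] with s hs hmem
    exact ((EuclideanSpace.proj (𝕜 := ℝ) i).hasFDerivAt.comp_hasDerivAt s (hs hmem).hasDerivAt).deriv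
  have hInt : IntervalIntegrable (deriv u) volume 0 T := by
    refine IntervalIntegrable.mono_fun' (g := fun s => ∑ i, ‖deriv (fun t => u t i) s‖) ?_
      (aestronglyMeasurable_deriv u _) ?_
    · simpa only [Finset.sum_fn] using
        IntervalIntegrable.sum Finset.univ fun i _ => (hc i).intervalIntegrable_deriv.norm
    · rw [EventuallyLE, ae_restrict_iff' measurableSet_uIoc]
      filter_upwards [ae_all_iff.2 hdi] with s hs hmem
      simp_rw [hs _ (uIoc_subset_uIcc hmem)]
      rw [EuclideanSpace.norm_eq]
      refine (Real.sqrt_le_sqrt (Finset.sum_sq_le_sq_sum_of_nonneg fun i _ => norm_nonneg _)).trans ?_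
      rw [Real.sqrt_sq (Finset.sum_nonneg fun i _ => norm_nonneg _)]
  refine ⟨hInt, hd, fun t ht => ?_⟩
  have hsub : uIcc 0 t ⊆ uIcc 0 T := by
    rw [uIcc_of_le ht.1, uIcc_of_le hT]; exact Icc_subset_Icc_right ht.2
  ext i
  have h1 := ((hc i).mono hsub).integral_deriv_eq_sub
  have h2 : (∫ s in (0 : ℝ)..t, deriv u s) i = ∫ s in (0 : ℝ)..t, deriv u s i :=
    ((EuclideanSpace.proj (𝕜 := ℝ) i).intervalIntegral_comp_comm (hInt.mono_set hsub)).symm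
  rw [PiLp.add_apply, h2, ← intervalIntegral.integral_congr_ae (f := deriv fun t => u t i), h1]
  · ring
  · filter_upwards [hdi i] with s hs hmem using hs (hsub (uIoc_subset_uIcc hmem))

/-! ### Convolutions with strongly continuous families -/

theorem exists_bound_of_strongly_continuous [CompleteSpace E] {U : ℝ → E →L[ℝ] F}
    (hU : ∀ x, Continuous fun t => U t x) (T : ℝ) :
    ∃ C, 0 ≤ C ∧ ∀ t ∈ Icc (-T) T, ‖U t‖ ≤ C := by
  obtain ⟨C, hC⟩ := banach_steinhaus (g := fun t : Icc (-T) T => U t) fun x => by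
    obtain ⟨C, hC⟩ := (isCompact_Icc (a := -T) (b := T)).exists_bound_of_continuousOn
      (hU x).continuousOn
    exact ⟨C, fun t => hC t t.2⟩
  exact ⟨max C 0, le_max_right _ _, fun t ht => (hC ⟨t, ht⟩).trans (le_max_left _ _)⟩

/-- Strong continuity and the local uniform bound together give joint continuity, which makes `s ↦ U
(t - s) (f s)` measurable for `f` merely integrable. -/
theorem continuous_uncurry_of_strongly_continuous [CompleteSpace E] {U : ℝ → E →L[ℝ] F}
    (hU : ∀ x, Continuous fun t => U t x) : Continuous fun q : ℝ × E => U q.1 q.2 := by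
  rw [continuous_iff_continuousAt]
  rintro ⟨t, x⟩
  obtain ⟨C, hC0, hC⟩ := exists_bound_of_strongly_continuous hU (|t| + 1)
  have h1 : Tendsto (fun q : ℝ × E => C * ‖q.2 - x‖ + ‖U q.1 x - U t x‖) (𝓝 (t, x)) (𝓝 0) := by
    have : Continuous fun q : ℝ × E => C * ‖q.2 - x‖ + ‖U q.1 x - U t x‖ := by
      have := (hU x).comp (continuous_fst (X := ℝ) (Y := E))
      simp only [Function.comp_def] at this
      fun_prop
    simpa using this.tendsto (t, x)
  refine tendsto_iff_norm_sub_tendsto_zero.2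
    (squeeze_zero' (Eventually.of_forall fun _ => norm_nonneg _) ?_ h1)
  have h2 : ∀ᶠ q : ℝ × E in 𝓝 (t, x), q.1 ∈ Icc (-(|t| + 1)) (|t| + 1) := by
    refine continuous_fst.continuousAt.eventually_mem (Icc_mem_nhds ?_ ?_)
    · have := neg_abs_le t; simp only; linarith
    · have := le_abs_self t; simp only; linarith
  filter_upwards [h2] with q hq
  calc ‖U q.1 q.2 - U t x‖ = ‖U q.1 (q.2 - x) + (U q.1 x - U t x)‖ := by
        rw [map_sub]; congr 1; abel
    _ ≤ ‖U q.1 (q.2 - x)‖ + ‖U q.1 x - U t x‖ := norm_add_le _ _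
    _ ≤ _ := by gcongr; exact (U q.1).le_of_opNorm_le (hC _ hq) _

theorem intervalIntegrable_convolution [CompleteSpace E] {U : ℝ → E →L[ℝ] F}
    (hU : ∀ x, Continuous fun t => U t x) {f : ℝ → E} {T : ℝ}
    (hf : IntervalIntegrable f volume 0 T) (t : ℝ) :
    IntervalIntegrable (fun s => U (t - s) (f s)) volume 0 T := by
  obtain ⟨C, hC0, hC⟩ := exists_bound_of_strongly_continuous hU (|t| + |T|)
  refine IntervalIntegrable.mono_fun' (g := fun s => C * ‖f s‖) (hf.norm.const_mul C) ?_ ?_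
  · exact (continuous_uncurry_of_strongly_continuous hU).comp_aestronglyMeasurable
      ((continuous_const.sub continuous_id).aestronglyMeasurable.prodMk
        hf.aestronglyMeasurable_restrict_uIoc)
  · filter_upwards [ae_restrict_mem measurableSet_uIoc] with s hs
    refine (U (t - s)).le_of_opNorm_le (hC _ ?_) _
    have h1 : |s| ≤ |T| := by
      have := uIoc_subset_uIcc hs
      simpa using abs_sub_left_of_mem_uIcc this
    rw [mem_Icc, ← abs_le]
    exact (abs_sub _ _).trans (by gcongr)

theorem continuousOn_convolution [CompleteSpace E] {U : ℝ → E →L[ℝ] F}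
    (hU : ∀ x, Continuous fun t => U t x) {f : ℝ → E}
    (hf : ∀ T, 0 ≤ T → IntervalIntegrable f volume 0 T) :
    ContinuousOn (fun t => ∫ s in (0 : ℝ)..t, U (t - s) (f s)) (Ici 0) := by
  intro t₀ ht₀
  set T := t₀ + 1 with hTdef
  have hT : 0 ≤ T := by have : 0 ≤ t₀ := ht₀; linarith
  obtain ⟨C, hC0, hC⟩ := exists_bound_of_strongly_continuous hU T
  -- Extension by zero beyond `s = t` fixes the interval of integration. For every `s ≠ t₀` the
  -- extended integrand is continuous in `t` at `t₀`, so dominated convergence applies.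
  set g : ℝ → ℝ → F := fun t s => if s ≤ t then U (t - s) (f s) else 0 with hg
  have hmeas : ∀ t, AEStronglyMeasurable (g t) (volume.restrict (uIoc 0 T)) := by
    intro t
    have h1 := (intervalIntegrable_convolution hU (hf T hT) t).aestronglyMeasurable_restrict_uIoc
    exact (AEStronglyMeasurable.indicator h1 (measurableSet_Iic (a := t)))
  have key : ContinuousWithinAt (fun t => ∫ s in (0 : ℝ)..T, g t s) (Ici 0) t₀ := by
    refine intervalIntegral.continuousWithinAt_of_dominated_interval
      (bound := fun s => C * ‖f s‖) (Eventually.of_forall hmeas) ?_ ((hf T hT).norm.const_mul C) ?_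
    · filter_upwards [self_mem_nhdsWithin,
        mem_nhdsWithin_of_mem_nhds (Iio_mem_nhds (show t₀ < T by linarith))] with t ht htT
      refine Eventually.of_forall fun s hs => ?_
      rw [uIoc_of_le hT] at hs
      simp only [hg]
      split_ifs with h
      · refine (U (t - s)).le_of_opNorm_le (hC _ ⟨?_, ?_⟩) _
        · linarith [hs.1, hs.2]
        · have : t < T := htT
          linarith [hs.1]
      · simpa using mul_nonneg hC0 (norm_nonneg _)
    · have hne : ∀ᵐ s : ℝ, s ≠ t₀ := by simp [ae_iff, measure_singleton]
      filter_upwards [hne] with s hs _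
      refine ContinuousAt.continuousWithinAt ?_
      rcases lt_or_gt_of_ne hs with h | h
      · have : (fun t => g t s) =ᶠ[𝓝 t₀] fun t => U (t - s) (f s) := by
          filter_upwards [Ioi_mem_nhds h] with t ht
          simp only [hg, if_pos (mem_Ioi.1 ht).le]
        exact ((hU (f s)).comp (continuous_id.sub continuous_const)).continuousAt.congr this.symm
      · have : (fun t => g t s) =ᶠ[𝓝 t₀] fun t => 0 := by
          filter_upwards [Iio_mem_nhds h] with t ht
          simp only [hg, if_neg (not_le_of_gt (mem_Iio.1 ht))]
        exact continuousAt_const.congr this.symm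
  refine key.congr_of_eventuallyEq ?_ ?_
  all_goals
    have main : ∀ t, 0 ≤ t → t ≤ T →
        ∫ s in (0 : ℝ)..t, U (t - s) (f s) = ∫ s in (0 : ℝ)..T, g t s := by
      intro t ht htT
      rw [intervalIntegral.integral_of_le ht, intervalIntegral.integral_of_le hT]
      have : g t = (Iic t).indicator fun s => U (t - s) (f s) := by
        ext s; simp [hg, indicator]
      rw [this, setIntegral_indicator measurableSet_Iic, Ioc_inter_Iic, min_eq_right htT]
  · filter_upwards [self_mem_nhdsWithin,
        mem_nhdsWithin_of_mem_nhds (Iio_mem_nhds (show t₀ < T by linarith))] with t ht htT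
    exact main t ht (le_of_lt htT)
  · exact main t₀ ht₀ (by linarith)

end

end

end DelayRD

namespace DelayRD

noncomputable section

section
variable {E : Type*} [NormedAddCommGroup E] [NormedSpace ℝ E]

/-! ### Volterra equations with a delay bounded away from zero -/

theorem continuousOn_delay {X : ℝ → E} {h : ℝ → ℝ} {hm hM : ℝ}
    (hX : ContinuousOn X (Ici (-hM))) (hh : ContinuousOn h (Ici 0))
    (hb : ∀ t, 0 ≤ t → hm ≤ h t ∧ h t ≤ hM) :
    ContinuousOn (fun s => X (s - h s)) (Ici 0) := by
  refine hX.comp (continuousOn_id.sub hh) fun s hs => ?_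
  have h0 : 0 ≤ s := hs
  have := (hb s h0).2
  simp only [mem_Ici]
  linarith

theorem intervalIntegrable_of_continuousOn_Ici {f : ℝ → E} (hf : ContinuousOn f (Ici 0)) {T : ℝ}
    (hT : 0 ≤ T) : IntervalIntegrable f volume 0 T :=
  (hf.mono (by rw [uIcc_of_le hT]; exact Icc_subset_Ici_self)).intervalIntegrable

/-- The right-hand side of the delayed Volterra equation with history `Φ`. -/
def volterraStep (U : ℝ → E →L[ℝ] E) (g Φ : ℝ → E) (h : ℝ → ℝ) (c : ℝ) (X : ℝ → E) (t : ℝ) : E :=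
  if t ≤ 0 then Φ t else g t + ∫ s in (0 : ℝ)..t, U (t - s) (c • X (s - h s))

theorem continuousOn_ite_history {Φ G : ℝ → E} {hM : ℝ} (hΦ : ContinuousOn Φ (Icc (-hM) 0))
    (hG : ContinuousOn G (Ici 0)) (h0 : G 0 = Φ 0) :
    ContinuousOn (fun t => if t ≤ 0 then Φ t else G t) (Ici (-hM)) := by
  refine ContinuousOn.if (fun a ha => ?_) (hΦ.mono ?_) (hG.mono ?_)
  · have h1 : frontier {a : ℝ | a ≤ 0} = {0} := by
      change frontier (Iic (0 : ℝ)) = {0}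
      exact frontier_Iic
    have : a = 0 := by have := ha.2; rwa [h1] at this
    rw [this, h0]
  · rintro x ⟨hx1, hx2⟩
    have : x ∈ Iic (0 : ℝ) := by
      have h3 : closure {a : ℝ | a ≤ 0} = Iic 0 := isClosed_Iic.closure_eq
      rwa [h3] at hx2
    exact ⟨hx1, this⟩
  · rintro x ⟨hx1, hx2⟩
    have h3 : closure {a : ℝ | ¬a ≤ 0} = Ici 0 := by
      have : {a : ℝ | ¬a ≤ 0} = Ioi 0 := by ext; simp
      rw [this, closure_Ioi]
    rwa [h3] at hx2

/-- Method of steps. As the delay is at least `hm`, the right-hand side at time `t` sees `X` only up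
to `t - hm`. The `n`-th Picard iterate is thus final up to time `n * hm`, and no contraction is
needed. -/
theorem exists_delay_volterra [CompleteSpace E] {U : ℝ → E →L[ℝ] E}
    (hU : ∀ x, Continuous fun t => U t x) {g Φ : ℝ → E} {h : ℝ → ℝ} {hm hM : ℝ} (c : ℝ)
    (hm_pos : 0 < hm) (hg : ContinuousOn g (Ici 0)) (hΦ : ContinuousOn Φ (Icc (-hM) 0))
    (hg0 : g 0 = Φ 0) (hh : ContinuousOn h (Ici 0)) (hb : ∀ t, 0 ≤ t → hm ≤ h t ∧ h t ≤ hM) :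
    ∃ X : ℝ → E, ContinuousOn X (Ici (-hM)) ∧ EqOn X Φ (Icc (-hM) 0) ∧
      ∀ t, 0 ≤ t → X t = g t + ∫ s in (0 : ℝ)..t, U (t - s) (c • X (s - h s)) := by
  set N := volterraStep U g Φ h c with hN
  have hNcont : ∀ X, ContinuousOn X (Ici (-hM)) → ContinuousOn (N X) (Ici (-hM)) := by
    intro X hX
    have h1 : ContinuousOn (fun t => ∫ s in (0 : ℝ)..t, U (t - s) (c • X (s - h s))) (Ici 0) :=
      continuousOn_convolution hU fun T hT => intervalIntegrable_of_continuousOn_Ici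
        (continuousOn_const.smul (continuousOn_delay hX hh hb)) hT
    exact continuousOn_ite_history hΦ (hg.add h1) (by simp [hg0])
  set Z : ℕ → ℝ → E := fun n => N^[n] (fun t => if t ≤ 0 then Φ t else Φ 0) with hZ
  have hZs : ∀ n, Z (n + 1) = N (Z n) := fun n => Function.iterate_succ_apply' _ _ _
  have hZc : ∀ n, ContinuousOn (Z n) (Ici (-hM)) := by
    intro n
    induction n with
    | zero => exact continuousOn_ite_history hΦ continuousOn_const rfl
    | succ n ih => rw [hZs]; exact hNcont _ ih
  have hZΦ : ∀ n t, t ≤ 0 → Z n t = Φ t := by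
    intro n t ht
    cases n with
    | zero => simp [hZ, ht]
    | succ n => rw [hZs]; simp [hN, volterraStep, ht]
  have hNcaus : ∀ (X X' : ℝ → E) (τ : ℝ), (∀ t ≤ τ, X t = X' t) →
      ∀ t ≤ τ + hm, N X t = N X' t := by
    intro X X' τ hXX' t ht
    simp only [hN, volterraStep]
    split_ifs with h0
    · rfl
    · congr 1
      refine intervalIntegral.integral_congr fun s hs => ?_
      rw [uIcc_of_le (not_le.1 h0).le] at hs
      rw [hXX' _ (by linarith [hs.2, (hb s hs.1).1])]
  have hZstep : ∀ n : ℕ, ∀ t ≤ n * hm, Z n t = Z (n + 1) t := by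
    intro n
    induction n with
    | zero => intro t ht; rw [hZΦ _ _ (by simpa using ht), hZΦ _ _ (by simpa using ht)]
    | succ n ih =>
      intro t ht
      rw [hZs (n + 1), hZs n]
      refine hNcaus _ _ (n * hm) (fun t ht => ?_) t (by push_cast at ht; linarith)
      rw [ih t ht, hZs]
  have hZstab : ∀ (n m : ℕ), n ≤ m → ∀ t ≤ n * hm, Z n t = Z m t := by
    intro n m hnm
    induction m, hnm using Nat.le_induction with
    | base => intro t _; rfl
    | succ m hnm ih =>
      intro t ht
      rw [ih t ht]
      refine hZstep m t (ht.trans ?_)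
      gcongr
  -- Every iterate of index at least `t / hm` already has its final value at `t`; for `t ≤ 0` index
  -- zero returns the history.
  set X : ℝ → E := fun t => Z ⌈t / hm⌉₊ t with hX
  have hXZ : ∀ (n : ℕ), ∀ t ≤ n * hm, X t = Z n t := by
    intro n t ht
    refine hZstab _ _ (Nat.ceil_le.2 ?_) t ?_
    · rwa [div_le_iff₀ hm_pos]
    · rw [← div_le_iff₀ hm_pos]; exact Nat.le_ceil _
  have hex : ∀ t : ℝ, ∃ n : ℕ, t < n * hm := fun t => by
    obtain ⟨n, hn⟩ := exists_nat_gt (t / hm)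
    exact ⟨n, by rwa [div_lt_iff₀ hm_pos] at hn⟩
  have hXΦ : ∀ t ≤ 0, X t = Φ t := fun t ht => hZΦ _ _ ht
  refine ⟨X, fun t ht => ?_, fun t ht => hXΦ t ht.2, fun t ht => ?_⟩
  · obtain ⟨n, hn⟩ := hex t
    refine (hZc n t ht).congr_of_eventuallyEq ?_ (hXZ n t hn.le)
    filter_upwards [mem_nhdsWithin_of_mem_nhds (Iio_mem_nhds hn)] with s hs
    exact hXZ n s (mem_Iio.1 hs).le
  · obtain ⟨n, hn⟩ := hex t
    rcases ht.eq_or_lt with rfl | ht'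
    · rw [hXΦ 0 le_rfl]; simp [hg0]
    rw [hXZ (n + 1) t (by push_cast; linarith), hZs]
    simp only [hN, volterraStep, if_neg (not_le.2 ht')]
    congr 1
    refine intervalIntegral.integral_congr fun s hs => ?_
    rw [uIcc_of_le ht] at hs
    rw [hXZ n _ (by linarith [hs.2, (hb s hs.1).1])]

/-- Vanishing up to `n * hm` kills the integrand up to `(n + 1) * hm`. No regularity of `d` or `U`
enters. -/
theorem eq_zero_of_delay_volterra {U : ℝ → E →L[ℝ] E} {d : ℝ → E} {h : ℝ → ℝ} {hm hM : ℝ} (c : ℝ)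
    (hm_pos : 0 < hm) (hb : ∀ t, 0 ≤ t → hm ≤ h t ∧ h t ≤ hM) (hd0 : ∀ t ∈ Icc (-hM) 0, d t = 0)
    (hd : ∀ t, 0 ≤ t → d t = ∫ s in (0 : ℝ)..t, U (t - s) (c • d (s - h s))) :
    ∀ t, -hM ≤ t → d t = 0 := by
  have key : ∀ n : ℕ, ∀ t, -hM ≤ t → t ≤ n * hm → d t = 0 := by
    intro n
    induction n with
    | zero => intro t h1 h2; exact hd0 t ⟨h1, by simpa using h2⟩
    | succ n ih =>
      intro t h1 h2
      rcases le_or_gt t 0 with h0 | h0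
      · exact hd0 t ⟨h1, h0⟩
      rw [hd t h0.le]
      refine intervalIntegral.integral_zero_ae (Eventually.of_forall fun s hs => ?_)
      rw [uIoc_of_le h0.le] at hs
      have h3 := hb s hs.1.le
      rw [ih (s - h s) (by linarith [hs.1]) (by push_cast at h2; linarith [hs.2])]
      simp
  intro t ht
  obtain ⟨n, hn⟩ := exists_nat_gt (t / hm)
  exact key n t ht (by rw [div_lt_iff₀ hm_pos] at hn; exact hn.le)

/-! ### Exponentially weighted bounds -/

/-- The convolution of `e^{-κ s}` with `e^{-α s}` is at most `e^{-κ t} / (α - κ)`, by the explicit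
primitive `F`. The factor `1 / (α - κ)` becomes the gain in the small-gain argument. -/
theorem norm_integral_le_exp_weight {g : ℝ → E} {t α κ G : ℝ} (ht : 0 ≤ t) (hκ : κ < α)
    (hG : 0 ≤ G)
    (hg : ∀ᵐ s, s ∈ Ioc 0 t → ‖g s‖ ≤ G * (Real.exp (-κ * s) * Real.exp (-α * (t - s)))) :
    Real.exp (κ * t) * ‖∫ s in (0 : ℝ)..t, g s‖ ≤ G / (α - κ) := by
  have hακ : 0 < α - κ := sub_pos.2 hκ
  set F : ℝ → ℝ := fun s => G * Real.exp (-α * t) * (α - κ)⁻¹ * Real.exp ((α - κ) * s) with hF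
  have hder : ∀ s, HasDerivAt F (G * (Real.exp (-κ * s) * Real.exp (-α * (t - s)))) s := by
    intro s
    have h1 : HasDerivAt (fun s => Real.exp ((α - κ) * s)) (Real.exp ((α - κ) * s) * (α - κ)) s := by
      simpa using ((hasDerivAt_id s).const_mul (α - κ)).exp
    refine (h1.const_mul (G * Real.exp (-α * t) * (α - κ)⁻¹)).congr_deriv ?_
    rw [← Real.exp_add]
    have : -κ * s + -α * (t - s) = -α * t + (α - κ) * s := by ring
    rw [this, Real.exp_add]
    field_simp
  have hcont : Continuous fun s => G * (Real.exp (-κ * s) * Real.exp (-α * (t - s))) := by fun_prop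
  have h2 := intervalIntegral.norm_integral_le_of_norm_le ht hg (hcont.intervalIntegrable 0 t)
  rw [intervalIntegral.integral_eq_sub_of_hasDerivAt (fun s _ => hder s)
    (hcont.intervalIntegrable 0 t)] at h2
  have h3 : F t - F 0 ≤ Real.exp (-κ * t) * (G / (α - κ)) := by
    have : F t = Real.exp (-κ * t) * (G / (α - κ)) := by
      simp only [hF]
      have : -κ * t = -α * t + (α - κ) * t := by ring
      rw [this, Real.exp_add]; field_simp
    have h0 : 0 ≤ F 0 := by simp only [hF]; positivity
    linarith
  calc Real.exp (κ * t) * ‖∫ s in (0 : ℝ)..t, g s‖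
      ≤ Real.exp (κ * t) * (Real.exp (-κ * t) * (G / (α - κ))) := by
        gcongr; exact h2.trans h3
    _ = G / (α - κ) := by rw [← mul_assoc, ← Real.exp_add]; simp

/-- A small-gain bound in the exponentially weighted supremum norm. -/
theorem exp_weight_small_gain {z : ℝ → E} {hM T κ N q : ℝ} (hM0 : 0 ≤ hM) (hT : 0 ≤ T)
    (hz : ContinuousOn z (Icc (-hM) T)) (hq0 : 0 ≤ q) (hq : q < 1)
    (hhist : ∀ t ∈ Icc (-hM) 0, Real.exp (κ * t) * ‖z t‖ ≤ N)
    (hgain : ∀ t ∈ Icc 0 T, ∀ m, 0 ≤ m → (∀ s ∈ Icc (-hM) t, Real.exp (κ * s) * ‖z s‖ ≤ m) →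
      Real.exp (κ * t) * ‖z t‖ ≤ N + q * m) :
    ∀ t ∈ Icc (-hM) T, Real.exp (κ * t) * ‖z t‖ ≤ N / (1 - q) := by
  have hcont : ContinuousOn (fun t => Real.exp (κ * t) * ‖z t‖) (Icc (-hM) T) := by
    exact (by fun_prop : Continuous fun t => Real.exp (κ * t)).continuousOn.mul hz.norm
  -- The maximum is finite by compactness, so it can be absorbed: at a maximum point `τ > 0` the
  -- gain inequality with `m` the maximum reads `m ≤ N + q m`.
  obtain ⟨τ, hτ, hmax⟩ := isCompact_Icc.exists_isMaxOn ⟨0, by constructor <;> linarith⟩ hcont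
  have h1q : 0 < 1 - q := by linarith
  have hm : Real.exp (κ * τ) * ‖z τ‖ ≤ N / (1 - q) := by
    rw [le_div_iff₀ h1q]
    have hnn : 0 ≤ Real.exp (κ * τ) * ‖z τ‖ := by positivity
    rcases le_or_gt τ 0 with h0 | h0
    · have := hhist τ ⟨hτ.1, h0⟩
      nlinarith
    · have := hgain τ ⟨h0.le, hτ.2⟩ _ hnn fun s hs => hmax ⟨hs.1, hs.2.trans hτ.2⟩
      linarith
  exact fun t ht => (hmax ht).trans hm

end

end

end DelayRD

namespace DelayRD

noncomputable section

/-! ### Operators on `L²(0,1)` -/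

instance : IsProbabilityMeasure unitMeasure := ⟨by simp⟩

theorem ofContinuous_ae {f : ℝ → ℝ} (hf : Continuous f) : ofContinuous f hf =ᵐ[unitMeasure] f :=
  MemLp.coeFn_toLp _

theorem ae_unitMeasure_iff {p : ℝ → Prop} : (∀ᵐ x ∂unitMeasure, p x) ↔ ∀ᵐ x, x ∈ uIoc 0 1 → p x := by
  rw [uIoc_of_le zero_le_one, unitMeasure, restrict_Ioo_eq_restrict_Ioc,
    ae_restrict_iff' measurableSet_Ioc]

theorem intervalIntegrable_L2 (g : L2) {x : ℝ} (hx : x ∈ Icc (0 : ℝ) 1) :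
    IntervalIntegrable g volume 0 x := by
  have h1 : Integrable g unitMeasure := (Lp.memLp g).integrable (by norm_num)
  have h2 : IntervalIntegrable g volume 0 1 := by
    rw [intervalIntegrable_iff_integrableOn_Ioo_of_le zero_le_one]; exact h1
  exact h2.mono_set (by rw [uIcc_of_le hx.1, uIcc_of_le zero_le_one]; exact Icc_subset_Icc_right hx.2)

theorem integral_unitMeasure (f : ℝ → ℝ) : ∫ x, f x ∂unitMeasure = ∫ x in (0 : ℝ)..1, f x := by
  rw [intervalIntegral.integral_of_le zero_le_one, unitMeasure, restrict_Ioo_eq_restrict_Ioc]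

theorem inner_L2_eq (f g : L2) : inner ℝ f g = ∫ x in (0 : ℝ)..1, f x * g x := by
  rw [L2.inner_def, integral_unitMeasure]
  simp [mul_comm]

theorem norm_L2_le_of_ae_bound {f : L2} {C : ℝ} (hC : 0 ≤ C) (hf : ∀ᵐ x ∂unitMeasure, ‖f x‖ ≤ C) :
    ‖f‖ ≤ C := by
  have := Lp.norm_le_of_ae_bound (p := 2) hC hf
  simpa [measureUnivNNReal] using this

theorem memLp_continuous_mul {m : ℝ → ℝ} (hm : Continuous m) (g : L2) :
    MemLp (fun x => m x * g x) 2 unitMeasure := by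
  obtain ⟨C, hC⟩ := (isCompact_Icc (a := (0 : ℝ)) (b := 1)).exists_bound_of_continuousOn
    hm.continuousOn
  refine (Lp.memLp g).of_le_mul (c := C) (hm.aestronglyMeasurable.mul (Lp.aestronglyMeasurable g)) ?_
  filter_upwards [ae_restrict_mem measurableSet_Ioo] with x hx
  rw [norm_mul]
  gcongr
  exact hC x (Ioo_subset_Icc_self hx)

/-- Multiplication by a continuous function. -/
def mulOp (m : ℝ → ℝ) (hm : Continuous m) : L2 →L[ℝ] L2 :=
  have hC := (isCompact_Icc (a := (0 : ℝ)) (b := 1)).exists_bound_of_continuousOn hm.continuousOn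
  have hmem := memLp_continuous_mul hm
  LinearMap.mkContinuous
    { toFun := fun g => (hmem g).toLp
      map_add' := fun f g => by
        apply Lp.ext
        filter_upwards [(hmem (f + g)).coeFn_toLp, (hmem f).coeFn_toLp, (hmem g).coeFn_toLp,
          Lp.coeFn_add f g, Lp.coeFn_add (hmem f).toLp (hmem g).toLp] with x h1 h2 h3 h4 h5
        rw [h1, h5, Pi.add_apply, h2, h3, h4, Pi.add_apply]; ring
      map_smul' := fun s f => by
        apply Lp.ext
        filter_upwards [(hmem (s • f)).coeFn_toLp, (hmem f).coeFn_toLp,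
          Lp.coeFn_smul s f, Lp.coeFn_smul s (hmem f).toLp] with x h1 h2 h3 h4
        rw [h1, RingHom.id_apply, h4, Pi.smul_apply, h2, h3, Pi.smul_apply, smul_eq_mul,
          smul_eq_mul]; ring }
    hC.choose fun g => Lp.norm_le_mul_norm_of_ae_le_mul (by
      filter_upwards [(hmem g).coeFn_toLp, ae_restrict_mem measurableSet_Ioo] with x h1 hx
      simp only [LinearMap.coe_mk, AddHom.coe_mk, h1]
      rw [norm_mul]
      gcongr
      exact hC.choose_spec x (Ioo_subset_Icc_self hx))

theorem mulOp_ae {m : ℝ → ℝ} (hm : Continuous m) (g : L2) :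
    mulOp m hm g =ᵐ[unitMeasure] fun x => m x * g x :=
  (memLp_continuous_mul hm g).coeFn_toLp

theorem mulOp_symm {m : ℝ → ℝ} (hm : Continuous m) (f g : L2) :
    inner ℝ (mulOp m hm f) g = inner ℝ f (mulOp m hm g) := by
  rw [L2.inner_def, L2.inner_def]
  refine integral_congr_ae ?_
  filter_upwards [mulOp_ae hm f, mulOp_ae hm g] with x h1 h2
  simp only [h1, h2, RCLike.inner_apply, conj_trivial]
  ring

/-- The operator `g ↦ (x ↦ ⟨k x, g⟩)`. -/
def kernelOp (k : ℝ → L2) (hk : Continuous k) : L2 →L[ℝ] L2 :=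
  have hC := (isCompact_Icc (a := (0 : ℝ)) (b := 1)).exists_bound_of_continuousOn hk.continuousOn
  have hc : ∀ g : L2, Continuous fun x => inner ℝ (k x) g := fun g => hk.inner continuous_const
  LinearMap.mkContinuous
    { toFun := fun g => ofContinuous (fun x => inner ℝ (k x) g) (hc g)
      map_add' := fun f g => by
        apply Lp.ext
        filter_upwards [ofContinuous_ae (hc (f + g)), ofContinuous_ae (hc f), ofContinuous_ae (hc g),
          Lp.coeFn_add (ofContinuous _ (hc f)) (ofContinuous _ (hc g))] with x h1 h2 h3 h4
        rw [h1, h4, Pi.add_apply, h2, h3, inner_add_right]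
      map_smul' := fun s f => by
        apply Lp.ext
        filter_upwards [ofContinuous_ae (hc (s • f)), ofContinuous_ae (hc f),
          Lp.coeFn_smul s (ofContinuous _ (hc f))] with x h1 h2 h3
        rw [h1, RingHom.id_apply, h3, Pi.smul_apply, h2, inner_smul_right, smul_eq_mul] }
    hC.choose fun g => norm_L2_le_of_ae_bound
      (mul_nonneg ((norm_nonneg _).trans (hC.choose_spec 0 ⟨le_rfl, zero_le_one⟩)) (norm_nonneg g)) (by
        filter_upwards [ofContinuous_ae (hc g), ae_restrict_mem measurableSet_Ioo] with x h1 hx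
        simp only [LinearMap.coe_mk, AddHom.coe_mk, h1]
        refine (norm_inner_le_norm _ _).trans ?_
        gcongr
        exact hC.choose_spec x (Ioo_subset_Icc_self hx))

theorem kernelOp_ae {k : ℝ → L2} (hk : Continuous k) (g : L2) :
    kernelOp k hk g =ᵐ[unitMeasure] fun x => inner ℝ (k x) g :=
  ofContinuous_ae (hk.inner continuous_const)

theorem isCompactOperator_rankOne (u w : L2) :
    IsCompactOperator fun g : L2 => (inner ℝ u g : ℝ) • w := by
  have h1 : IsCompactOperator (innerSL ℝ u : L2 →L[ℝ] ℝ) :=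
    ⟨Metric.closedBall 0 1, isCompact_closedBall 0 1,
      (innerSL ℝ u).continuous.continuousAt.preimage_mem_nhds
        (by simpa using Metric.closedBall_mem_nhds (0 : ℝ) one_pos)⟩
  exact h1.clm_comp (ContinuousLinearMap.toSpanSingleton ℝ w)

/-- The Bernstein approximations of the continuous `L²`-valued curve `k` converge uniformly. Each
gives a finite-rank operator, so the kernel operator is a norm limit of compact operators. -/
theorem isCompactOperator_kernelOp {k : ℝ → L2} (hk : Continuous k) :
    IsCompactOperator (kernelOp k hk) := by
  set κ : C(unitInterval, L2) := ⟨fun x => k x, hk.comp continuous_subtype_val⟩ with hκ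
  set b : ℕ → ℕ → ℝ → ℝ := fun n j x => (n.choose j : ℝ) * x ^ j * (1 - x) ^ (n - j) with hb
  have hbc : ∀ n j, Continuous (b n j) := fun n j => by simp only [hb]; fun_prop
  set A : ℕ → L2 →L[ℝ] L2 := fun n => ∑ j : Fin (n + 1),
    (innerSL ℝ (κ (bernstein.z j))).smulRight (ofContinuous (b n j) (hbc n j)) with hA
  have hAc : ∀ n, IsCompactOperator (A n) := by
    intro n
    have : ∀ s : Finset (Fin (n + 1)), IsCompactOperator (∑ j ∈ s,
        (innerSL ℝ (κ (bernstein.z j))).smulRight (ofContinuous (b n j) (hbc n j)) :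
          L2 →L[ℝ] L2) := by
      intro s
      induction s using Finset.induction_on with
      | empty => simpa using isCompactOperator_zero
      | insert j s hj ih =>
        rw [Finset.sum_insert hj]
        exact (isCompactOperator_rankOne _ _).add ih
    exact this _
  have hAae : ∀ n g, A n g =ᵐ[unitMeasure]
      fun x => ∑ j : Fin (n + 1), inner ℝ (κ (bernstein.z j)) g * b n j x := by
    intro n g
    have h1 : A n g = ∑ j : Fin (n + 1),
        (inner ℝ (κ (bernstein.z j)) g : ℝ) • ofContinuous (b n j) (hbc n j) := by
      simp [hA]
    have h2 : ∀ j : Fin (n + 1),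
        ((inner ℝ (κ (bernstein.z j)) g : ℝ) • ofContinuous (b n j) (hbc n j) : L2)
          =ᵐ[unitMeasure] fun x => inner ℝ (κ (bernstein.z j)) g * b n j x := by
      intro j
      filter_upwards [Lp.coeFn_smul (inner ℝ (κ (bernstein.z j)) g : ℝ)
        (ofContinuous (b n j) (hbc n j)), ofContinuous_ae (hbc n j)] with x h3 h4
      rw [h3, Pi.smul_apply, h4, smul_eq_mul]
    rw [h1]
    filter_upwards [Lp.coeFn_fun_finsetSum (Finset.univ : Finset (Fin (n + 1))) fun j =>
      ((inner ℝ (κ (bernstein.z j)) g : ℝ) • ofContinuous (b n j) (hbc n j) : L2),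
      ae_all_iff.2 h2] with x h3 h4
    rw [h3]
    exact Finset.sum_congr rfl fun j _ => h4 j
  have hlim : Tendsto A atTop (𝓝 (kernelOp k hk)) := by
    have hB := bernsteinApproximation_uniform κ
    rw [tendsto_iff_norm_sub_tendsto_zero] at hB ⊢
    refine squeeze_zero (fun _ => norm_nonneg _) (fun n => ?_) hB
    refine ContinuousLinearMap.opNorm_le_bound _ (norm_nonneg _) fun g => ?_
    refine norm_L2_le_of_ae_bound (by positivity) ?_
    rw [sub_apply]
    filter_upwards [Lp.coeFn_sub (A n g) (kernelOp k hk g), hAae n g, kernelOp_ae hk g,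
      ae_restrict_mem measurableSet_Ioo] with x h1 h2 h3 hx
    set y : unitInterval := ⟨x, Ioo_subset_Icc_self hx⟩
    have h4 : (∑ j : Fin (n + 1), inner ℝ (κ (bernstein.z j)) g * b n j x) - inner ℝ (k x) g =
        inner ℝ ((bernsteinApproximation n κ - κ) y) g := by
      rw [ContinuousMap.sub_apply, bernsteinApproximation.apply, inner_sub_left, sum_inner]
      congr 1
      refine Finset.sum_congr rfl fun j _ => ?_
      rw [inner_smul_left, bernstein_apply, mul_comm]
      rfl
    rw [h1, Pi.sub_apply, h2, h3, h4]
    refine (norm_inner_le_norm _ _).trans ?_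
    gcongr
    exact ContinuousMap.norm_coe_le_norm _ y
  exact isClosed_setOfPred_isCompactOperator.mem_of_tendsto hlim (Eventually.of_forall hAc)

/-- The indicator function of `(-∞, x]`. -/
def stepL2 (x : ℝ) : L2 := indicatorConstLp 2 (measurableSet_Iic (a := x)) (measure_ne_top _ _) 1

/-- The symmetric difference of two half-lines has measure at most `|y - x|`. The Volterra kernel
jumps as a function of two variables but is continuous as a curve in `L²`, which is all that
compactness requires. -/
theorem continuous_stepL2 : Continuous stepL2 := by
  refine continuous_indicatorConstLp_set (by norm_num) fun x => ?_
  have hle : ∀ y, unitMeasure (symmDiff (Iic y) (Iic x)) ≤ ENNReal.ofReal |y - x| := by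
    intro y
    have hsub : symmDiff (Iic y) (Iic x) ⊆ uIoc x y := by
      intro z hz
      rcases hz with ⟨h1, h2⟩ | ⟨h1, h2⟩
      · exact mem_uIoc.2 (Or.inl ⟨not_le.1 h2, h1⟩)
      · exact mem_uIoc.2 (Or.inr ⟨not_le.1 h2, h1⟩)
    refine (Measure.restrict_apply_le _ _).trans ((measure_mono hsub).trans ?_)
    rw [uIoc, Real.volume_Ioc, max_sub_min_eq_abs]
  refine tendsto_of_tendsto_of_tendsto_of_le_of_le tendsto_const_nhds (h := fun y => ENNReal.ofReal |y - x|)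
    ?_ (fun _ => zero_le) hle
  have : Continuous fun y => ENNReal.ofReal |y - x| := ENNReal.continuous_ofReal.comp (by fun_prop)
  simpa using this.tendsto x

theorem inner_stepL2 (g : L2) {x : ℝ} (hx : x ∈ Icc (0 : ℝ) 1) :
    inner ℝ (stepL2 x) g = ∫ s in (0 : ℝ)..x, g s := by
  rw [stepL2, L2.inner_indicatorConstLp_one, Measure.restrict_restrict measurableSet_Iic,
    intervalIntegral.integral_of_le hx.1]
  refine setIntegral_congr_set ?_
  have h1 : (Ioc (0 : ℝ) 1 ∩ Iic x : Set ℝ) = Ioc 0 x := by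
    rw [Ioc_inter_Iic, min_eq_right hx.2]
  rw [← h1, inter_comm]
  exact Ioo_ae_eq_Ioc.inter (ae_eq_refl _)

/-- The Volterra operator `g ↦ (x ↦ ∫₀ˣ g)`. -/
def volterra : L2 →L[ℝ] L2 := kernelOp stepL2 continuous_stepL2

theorem volterra_ae (g : L2) : volterra g =ᵐ[unitMeasure] fun x => ∫ s in (0 : ℝ)..x, g s := by
  filter_upwards [kernelOp_ae continuous_stepL2 g, ae_restrict_mem measurableSet_Ioo] with x h1 hx
  rw [volterra, h1, inner_stepL2 g (Ioo_subset_Icc_self hx)]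

/-- Integration by parts for the product of the two primitives, both zero at `0`. This identity is
the source of the symmetry of the Green operator. -/
theorem inner_volterra_add (f g : L2) :
    inner ℝ (volterra f) g + inner ℝ f (volterra g) =
      (∫ s in (0 : ℝ)..1, f s) * ∫ s in (0 : ℝ)..1, g s := by
  have h01 : (1 : ℝ) ∈ Icc (0 : ℝ) 1 := ⟨zero_le_one, le_rfl⟩
  have hf := intervalIntegrable_L2 f h01
  have hg := intervalIntegrable_L2 g h01
  have hFa := hf.absolutelyContinuousOnInterval_intervalIntegral (c := 0) left_mem_uIcc
  have hGa := hg.absolutelyContinuousOnInterval_intervalIntegral (c := 0) left_mem_uIcc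
  have key := hFa.integral_deriv_mul_eq_sub hGa
  simp only [intervalIntegral.integral_same, mul_zero, sub_zero] at key
  rw [← key, L2.inner_def, L2.inner_def, ← integral_add (L2.integrable_inner _ _)
    (L2.integrable_inner _ _), integral_unitMeasure]
  refine intervalIntegral.integral_congr_ae ?_
  filter_upwards [ae_unitMeasure_iff.1 (volterra_ae f), ae_unitMeasure_iff.1 (volterra_ae g),
    hf.ae_hasDerivAt_integral, hg.ae_hasDerivAt_integral] with x h1 h2 h3 h4 hx
  have hx' := uIoc_subset_uIcc hx
  rw [(h3 hx' 0 left_mem_uIcc).deriv, (h4 hx' 0 left_mem_uIcc).deriv]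
  simp only [h1 hx, h2 hx, RCLike.inner_apply, conj_trivial]
  ring

end

end DelayRD

namespace DelayRD

noncomputable section

/-- Stated over a general scalar field because the product rule serves both the real modal equations
and the complex coordinates along left eigenvectors. -/
theorem mul_primitive {𝕜 : Type*} [RCLike 𝕜] {m m' φ : ℝ → 𝕜} (hm : ∀ t, HasDerivAt m (m' t) t)
    (hm' : Continuous m') {T : ℝ} (hT : 0 ≤ T) (hφ : IntervalIntegrable φ volume 0 T) (v₀ : 𝕜) :
    m T * (v₀ + ∫ s in (0 : ℝ)..T, φ s) = m 0 * v₀ +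
      ∫ s in (0 : ℝ)..T, (m' s * (v₀ + ∫ r in (0 : ℝ)..s, φ r) + m s * φ s) := by
  have h := clm_apply_primitive (E := 𝕜) (F := 𝕜)
    (G := fun t => ContinuousLinearMap.mul ℝ 𝕜 (m t))
    (G' := fun t => ContinuousLinearMap.mul ℝ 𝕜 (m' t))
    (fun t => (ContinuousLinearMap.mul ℝ 𝕜).hasFDerivAt.comp_hasDerivAt t (hm t))
    ((ContinuousLinearMap.mul ℝ 𝕜).continuous.comp hm') hT hφ v₀
  simpa using h

/-! ### Second order boundary value problems -/

theorem continuousOn_primitive_unit {φ : ℝ → ℝ} (hφ : IntervalIntegrable φ volume 0 1) :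
    ContinuousOn (fun x => ∫ s in (0 : ℝ)..x, φ s) (Icc 0 1) := by
  have := intervalIntegral.continuousOn_primitive_interval (μ := volume) (f := φ) (a := 0) (b := 1)
    (by rw [uIcc_of_le zero_le_one]
        exact (intervalIntegrable_iff_integrableOn_Icc_of_le zero_le_one).1 hφ)
  rwa [uIcc_of_le zero_le_one] at this

theorem one_mem_unit : (1 : ℝ) ∈ Icc (0 : ℝ) 1 := ⟨zero_le_one, le_rfl⟩

theorem zero_mem_unit : (0 : ℝ) ∈ Icc (0 : ℝ) 1 := ⟨le_rfl, zero_le_one⟩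

theorem IsH2.continuousOn_deriv {f q : L2} {v w : ℝ → ℝ} (h : IsH2 f v w q) :
    ContinuousOn w (Icc 0 1) :=
  (continuousOn_const.add (continuousOn_primitive_unit
    (intervalIntegrable_L2 q one_mem_unit))).congr h.2.2

theorem IsH2.continuousOn {f q : L2} {v w : ℝ → ℝ} (h : IsH2 f v w q) :
    ContinuousOn v (Icc 0 1) :=
  (continuousOn_const.add (continuousOn_primitive_unit (ContinuousOn.intervalIntegrable
    (by rw [uIcc_of_le zero_le_one]; exact h.continuousOn_deriv)))).congr h.2.1

theorem eqOn_unit_of_ae_eq {f g : ℝ → ℝ} (h : f =ᵐ[unitMeasure] g) (hf : ContinuousOn f (Icc 0 1))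
    (hg : ContinuousOn g (Icc 0 1)) : EqOn f g (Icc 0 1) := by
  refine Measure.eqOn_Icc_of_ae_eq volume zero_ne_one ?_ hf hg
  rwa [← restrict_Ioo_eq_restrict_Icc]

theorem ae_eq_zero_of_primitive_eq_zero {φ : ℝ → ℝ} (hφ : IntervalIntegrable φ volume 0 1)
    (h : ∀ x ∈ Icc (0 : ℝ) 1, ∫ s in (0 : ℝ)..x, φ s = 0) : φ =ᵐ[unitMeasure] 0 := by
  have := ae_deriv_eq_of_eq_primitive (u := fun _ => (0 : ℝ)) zero_le_one hφ
    fun t ht => by rw [h t ht, add_zero]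
  refine ae_unitMeasure_iff.2 ?_
  filter_upwards [this] with x hx hm
  rw [← hx hm]; simp

/-- The continuous representative is determined by the class, and then each derivative by its
primitive. Through `RobinGraph.eq_zero` this makes the Robin graph single-valued. -/
theorem IsH2.eq_zero {f q : L2} {v w : ℝ → ℝ} (h : IsH2 f v w q) (hf : f = 0) : q = 0 := by
  have hv : EqOn v (fun _ => 0) (Icc 0 1) := by
    refine eqOn_unit_of_ae_eq ?_ h.continuousOn continuousOn_const
    filter_upwards [h.1, Lp.coeFn_zero ℝ 2 unitMeasure] with x h1 h2
    rw [← h1, hf, h2]; rfl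
  have hwi : IntervalIntegrable w volume 0 1 := ContinuousOn.intervalIntegrable
    (by rw [uIcc_of_le zero_le_one]; exact h.continuousOn_deriv)
  have hw : EqOn w (fun _ => 0) (Icc 0 1) := by
    refine eqOn_unit_of_ae_eq (ae_eq_zero_of_primitive_eq_zero hwi fun x hx => ?_)
      h.continuousOn_deriv continuousOn_const
    have := h.2.1 x hx
    rw [hv hx, hv zero_mem_unit] at this
    simpa using this.symm
  apply Lp.ext
  refine (ae_eq_zero_of_primitive_eq_zero (intervalIntegrable_L2 q one_mem_unit) fun x hx => ?_).trans
    (Lp.coeFn_zero ℝ 2 unitMeasure).symm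
  have := h.2.2 x hx
  rw [hw hx, hw zero_mem_unit] at this
  simpa using this.symm

theorem IsH2.lin {f₁ q₁ f₂ q₂ : L2} {v₁ w₁ v₂ w₂ : ℝ → ℝ} (h₁ : IsH2 f₁ v₁ w₁ q₁)
    (h₂ : IsH2 f₂ v₂ w₂ q₂) (α β : ℝ) :
    IsH2 (α • f₁ + β • f₂) (fun x => α * v₁ x + β * v₂ x) (fun x => α * w₁ x + β * w₂ x)
      (α • q₁ + β • q₂) := by
  have hsub : ∀ x ∈ Icc (0 : ℝ) 1, uIcc 0 x ⊆ Icc 0 1 := fun x hx => by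
    rw [uIcc_of_le hx.1]; exact Icc_subset_Icc_right hx.2
  have hae : ∀ a b : L2, (α • a + β • b : L2) =ᵐ[unitMeasure] fun x => α * a x + β * b x := by
    intro a b
    filter_upwards [Lp.coeFn_add (α • a) (β • b), Lp.coeFn_smul α a, Lp.coeFn_smul β b]
      with x h1 h2 h3
    rw [h1, Pi.add_apply, h2, h3]; rfl
  refine ⟨?_, fun x hx => ?_, fun x hx => ?_⟩
  · filter_upwards [hae f₁ f₂, h₁.1, h₂.1] with x h1 h2 h3
    rw [h1, h2, h3]
  · have i1 : IntervalIntegrable w₁ volume 0 x :=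
      (h₁.continuousOn_deriv.mono (hsub x hx)).intervalIntegrable
    have i2 : IntervalIntegrable w₂ volume 0 x :=
      (h₂.continuousOn_deriv.mono (hsub x hx)).intervalIntegrable
    rw [intervalIntegral.integral_add (i1.const_mul α) (i2.const_mul β),
      intervalIntegral.integral_const_mul, intervalIntegral.integral_const_mul]
    linear_combination α * h₁.2.1 x hx + β * h₂.2.1 x hx
  · have i1 := intervalIntegrable_L2 q₁ hx
    have i2 := intervalIntegrable_L2 q₂ hx
    have : ∫ s in (0 : ℝ)..x, (α • q₁ + β • q₂ : L2) s = ∫ s in (0 : ℝ)..x, (α * q₁ s + β * q₂ s) := by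
      refine intervalIntegral.integral_congr_ae ?_
      filter_upwards [ae_unitMeasure_iff.1 (hae q₁ q₂)] with s hs hm
      refine hs ?_
      rw [uIoc_of_le hx.1] at hm
      rw [uIoc_of_le zero_le_one]
      exact ⟨hm.1, hm.2.trans hx.2⟩
    rw [this, intervalIntegral.integral_add (i1.const_mul α) (i2.const_mul β),
      intervalIntegral.integral_const_mul, intervalIntegral.integral_const_mul]
    linear_combination α * h₁.2.2 x hx + β * h₂.2.2 x hx

theorem RobinGraph.lin {P : Coeffs} {r : ℝ} {f₁ g₁ f₂ g₂ : L2} (h₁ : RobinGraph P r f₁ g₁)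
    (h₂ : RobinGraph P r f₂ g₂) (α β : ℝ) :
    RobinGraph P r (α • f₁ + β • f₂) (α • g₁ + β • g₂) := by
  obtain ⟨v₁, w₁, q₁, hH₁, hl₁, hr₁, rfl⟩ := h₁
  obtain ⟨v₂, w₂, q₂, hH₂, hl₂, hr₂, rfl⟩ := h₂
  refine ⟨_, _, _, hH₁.lin hH₂ α β, ?_, ?_, ?_⟩
  · linear_combination α * hl₁ + β * hl₂
  · linear_combination α * hr₁ + β * hr₂
  · module

theorem RobinGraph.sub {P : Coeffs} {r : ℝ} {f₁ g₁ f₂ g₂ : L2} (h₁ : RobinGraph P r f₁ g₁)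
    (h₂ : RobinGraph P r f₂ g₂) : RobinGraph P r (f₁ - f₂) (g₁ - g₂) := by
  have := h₁.lin h₂ 1 (-1)
  simpa [sub_eq_add_neg] using this

theorem RobinGraph.eq_zero {P : Coeffs} {r : ℝ} {g : L2} (h : RobinGraph P r 0 g) : g = 0 := by
  obtain ⟨v, w, q, hH, -, -, rfl⟩ := h
  simp [hH.eq_zero rfl]

theorem robinGraph_shift {P : Coeffs} {r s : ℝ} {f g : L2} :
    RobinGraph P (r + s) f g ↔ RobinGraph P r f (g - s • f) := by
  constructor
  · rintro ⟨v, w, q, h1, h2, h3, rfl⟩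
    exact ⟨v, w, q, h1, h2, h3, by module⟩
  · rintro ⟨v, w, q, h1, h2, h3, h4⟩
    refine ⟨v, w, q, h1, h2, h3, ?_⟩
    rw [sub_eq_iff_eq_add] at h4
    rw [h4]; module

/-- Uniqueness for `v' = w`, `w' = ρ v` with zero initial data. -/
theorem pair_eq_zero {ρ : ℝ} {v w : ℝ → ℝ} (hv : ContinuousOn v (Icc 0 1))
    (hw : ContinuousOn w (Icc 0 1)) (hvw : ∀ x ∈ Icc (0 : ℝ) 1, v x = ∫ s in (0 : ℝ)..x, w s)
    (hwv : ∀ x ∈ Icc (0 : ℝ) 1, w x = ∫ s in (0 : ℝ)..x, ρ * v s) :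
    ∀ x ∈ Icc (0 : ℝ) 1, v x = 0 ∧ w x = 0 := by
  -- Continuous extensions to the line make the primitives differentiable at every point, as the
  -- Gronwall inequality below requires.
  have hext : ∀ f : ℝ → ℝ, ContinuousOn f (Icc 0 1) → ∃ F : ℝ → ℝ, Continuous F ∧ EqOn F f (Icc 0 1) := by
    intro f hf
    refine ⟨IccExtend zero_le_one (domRestrict (Icc 0 1) f), ?_, fun x hx => ?_⟩
    · exact (continuousOn_iff_continuous_domRestrict.1 hf).Icc_extend'
    · rw [IccExtend_of_mem _ _ hx]; rfl
  obtain ⟨v', hv'c, hv'⟩ := hext v hv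
  obtain ⟨w', hw'c, hw'⟩ := hext w hw
  set V : ℝ → ℝ := fun x => ∫ s in (0 : ℝ)..x, w' s with hV
  set W : ℝ → ℝ := fun x => ∫ s in (0 : ℝ)..x, ρ * v' s with hW
  have hVd : ∀ x, HasDerivAt V (w' x) x := fun x =>
    intervalIntegral.integral_hasDerivAt_right (hw'c.intervalIntegrable _ _)
      hw'c.stronglyMeasurable.stronglyMeasurableAtFilter hw'c.continuousAt
  have hρc : Continuous fun s => ρ * v' s := continuous_const.mul hv'c
  have hWd : ∀ x, HasDerivAt W (ρ * v' x) x := fun x =>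
    intervalIntegral.integral_hasDerivAt_right (hρc.intervalIntegrable _ _)
      hρc.stronglyMeasurable.stronglyMeasurableAtFilter hρc.continuousAt
  have hsub : ∀ x ∈ Icc (0 : ℝ) 1, uIcc 0 x ⊆ Icc 0 1 := fun x hx => by
    rw [uIcc_of_le hx.1]; exact Icc_subset_Icc_right hx.2
  have hVv : ∀ x ∈ Icc (0 : ℝ) 1, V x = v x := fun x hx => by
    rw [hvw x hx]
    exact intervalIntegral.integral_congr fun s hs => hw' (hsub x hx hs)
  have hWw : ∀ x ∈ Icc (0 : ℝ) 1, W x = w x := fun x hx => by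
    rw [hwv x hx]
    exact intervalIntegral.integral_congr fun s hs => by
      simp only [hv' (hsub x hx hs)]
  have hg := norm_le_gronwallBound_of_norm_deriv_right_le (E := ℝ × ℝ) (f := fun x => (V x, W x))
    (f' := fun x => (w' x, ρ * v' x)) (δ := 0) (K := 1 + |ρ|) (ε := 0) (a := 0) (b := 1)
    (fun x _ => ((hVd x).continuousAt.prodMk (hWd x).continuousAt).continuousWithinAt)
    (fun x _ => ((hVd x).prodMk (hWd x)).hasDerivWithinAt)
    (by simp [hV, hW]) (fun x hx => by
      have hx' : x ∈ Icc (0 : ℝ) 1 := ⟨hx.1, hx.2.le⟩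
      rw [hw' hx', hv' hx', ← hWw x hx', ← hVv x hx', add_zero, Prod.norm_def, Prod.norm_def]
      have h1 : ‖V x‖ ≤ max ‖V x‖ ‖W x‖ := le_max_left _ _
      have h2 : ‖W x‖ ≤ max ‖V x‖ ‖W x‖ := le_max_right _ _
      have h3 := norm_nonneg (V x)
      refine max_le ?_ ?_
      · have : 0 ≤ |ρ| * max ‖V x‖ ‖W x‖ := by positivity
        simp only; linarith
      · simp only [norm_mul, Real.norm_eq_abs] at *
        have : |ρ| * |V x| ≤ |ρ| * max |V x| |W x| := by gcongr
        nlinarith [abs_nonneg (V x)])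
  intro x hx
  have := hg x hx
  simp only [gronwallBound_ε0, zero_mul] at this
  have h0 := norm_le_zero_iff.1 this
  rw [Prod.mk_eq_zero] at h0
  rw [← hVv x hx, ← hWw x hx]
  exact h0

/-- For an eigenfunction the second derivative is the multiple `(μ - r) / a` of `f` itself, so the
eigenvalue equation becomes a first-order linear system for `(v, w)`. -/
theorem RobinGraph.eigen_data {P : Coeffs} {r μ : ℝ} {f : L2} (h : RobinGraph P r f (μ • f)) :
    ∃ v w : ℝ → ℝ, f =ᵐ[unitMeasure] v ∧ ContinuousOn v (Icc 0 1) ∧ ContinuousOn w (Icc 0 1) ∧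
      (∀ x ∈ Icc (0 : ℝ) 1, v x = v 0 + ∫ s in (0 : ℝ)..x, w s) ∧
      (∀ x ∈ Icc (0 : ℝ) 1, w x = w 0 + ∫ s in (0 : ℝ)..x, (μ - r) / P.a * v s) ∧
      Real.cos P.θ₁ * v 0 - Real.sin P.θ₁ * w 0 = 0 ∧
      Real.cos P.θ₂ * v 1 + Real.sin P.θ₂ * w 1 = 0 := by
  obtain ⟨v, w, q, hH, hl, hr, hq⟩ := h
  refine ⟨v, w, hH.1, hH.continuousOn, hH.continuousOn_deriv, hH.2.1, fun x hx => ?_, hl, hr⟩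
  rw [hH.2.2 x hx]
  congr 1
  have ha := P.a_pos
  have hq' : q = ((μ - r) / P.a) • f := by
    have h1 : P.a • q = (μ - r) • f := by
      rw [sub_smul, hq]; abel
    rw [div_eq_inv_mul, mul_smul, ← h1, smul_smul, inv_mul_cancel₀ ha.ne', one_smul]
  refine intervalIntegral.integral_congr_ae ?_
  have h2 : q =ᵐ[unitMeasure] fun s => (μ - r) / P.a * v s := by
    rw [hq']
    filter_upwards [Lp.coeFn_smul ((μ - r) / P.a) f, hH.1] with s h1 h2
    rw [h1, Pi.smul_apply, h2, smul_eq_mul]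
  filter_upwards [ae_unitMeasure_iff.1 h2] with s hs hm
  refine hs ?_
  rw [uIoc_of_le hx.1] at hm
  rw [uIoc_of_le zero_le_one]
  exact ⟨hm.1, hm.2.trans hx.2⟩

theorem eq_zero_of_ae_eq_zero_on {f : L2} {v : ℝ → ℝ} (h : f =ᵐ[unitMeasure] v)
    (hv : ∀ x ∈ Icc (0 : ℝ) 1, v x = 0) : f = 0 := by
  apply Lp.ext
  filter_upwards [h, Lp.coeFn_zero ℝ 2 unitMeasure, ae_restrict_mem measurableSet_Ioo] with x h1 h2 hx
  rw [h1, h2, hv x (Ioo_subset_Icc_self hx)]; rfl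

/-- The eigenvalues are simple. -/
theorem RobinGraph.simple {P : Coeffs} {r μ : ℝ} {f g : L2} (hf : RobinGraph P r f (μ • f))
    (hg : RobinGraph P r g (μ • g)) (hf0 : f ≠ 0) : ∃ s : ℝ, g = s • f := by
  have key : ∀ d : L2, ∀ v w : ℝ → ℝ, d =ᵐ[unitMeasure] v → ContinuousOn v (Icc 0 1) →
      ContinuousOn w (Icc 0 1) → (∀ x ∈ Icc (0 : ℝ) 1, v x = ∫ s in (0 : ℝ)..x, w s) →
      (∀ x ∈ Icc (0 : ℝ) 1, w x = ∫ s in (0 : ℝ)..x, (μ - r) / P.a * v s) → d = 0 :=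
    fun d v w h1 h2 h3 h4 h5 => eq_zero_of_ae_eq_zero_on h1
      fun x hx => (pair_eq_zero h2 h3 h4 h5 x hx).1
  have hone := Real.sin_sq_add_cos_sq P.θ₁
  -- The left boundary condition says that the Cauchy data at `0` are a multiple of `(sin θ₁, cos
  -- θ₁)`. Eigenfunctions for one eigenvalue thus form at most a line.
  have hpar : ∀ v w : ℝ, Real.cos P.θ₁ * v - Real.sin P.θ₁ * w = 0 →
      v = (Real.sin P.θ₁ * v + Real.cos P.θ₁ * w) * Real.sin P.θ₁ ∧
      w = (Real.sin P.θ₁ * v + Real.cos P.θ₁ * w) * Real.cos P.θ₁ := by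
    intro v w h
    constructor
    · linear_combination (-v) * hone + Real.cos P.θ₁ * h
    · linear_combination (-w) * hone - Real.sin P.θ₁ * h
  have hzero : ∀ d : L2, RobinGraph P r d (μ • d) → (∃ v w : ℝ → ℝ, d =ᵐ[unitMeasure] v ∧
      ContinuousOn v (Icc 0 1) ∧ ContinuousOn w (Icc 0 1) ∧
      (∀ x ∈ Icc (0 : ℝ) 1, v x = v 0 + ∫ s in (0 : ℝ)..x, w s) ∧
      (∀ x ∈ Icc (0 : ℝ) 1, w x = w 0 + ∫ s in (0 : ℝ)..x, (μ - r) / P.a * v s) ∧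
      v 0 = 0 ∧ w 0 = 0) → d = 0 := by
    rintro d - ⟨v, w, h1, h2, h3, h4, h5, h6, h7⟩
    exact key d v w h1 h2 h3 (fun x hx => by rw [h4 x hx, h6, zero_add])
      (fun x hx => by rw [h5 x hx, h7, zero_add])
  obtain ⟨v₁, w₁, a1, b1, c1, d1, e1, l1, -⟩ := hf.eigen_data
  obtain ⟨v₂, w₂, a2, b2, c2, d2, e2, l2, -⟩ := hg.eigen_data
  set t₁ := Real.sin P.θ₁ * v₁ 0 + Real.cos P.θ₁ * w₁ 0 with ht₁
  set t₂ := Real.sin P.θ₁ * v₂ 0 + Real.cos P.θ₁ * w₂ 0 with ht₂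
  have p1 := hpar _ _ l1
  have p2 := hpar _ _ l2
  rw [← ht₁] at p1
  rw [← ht₂] at p2
  have ht₁0 : t₁ ≠ 0 := by
    intro h0
    refine hf0 (hzero f hf ⟨v₁, w₁, a1, b1, c1, d1, e1, ?_, ?_⟩)
    · rw [p1.1, h0, zero_mul]
    · rw [p1.2, h0, zero_mul]
  refine ⟨t₂ / t₁, ?_⟩
  have hsub : ∀ x ∈ Icc (0 : ℝ) 1, uIcc 0 x ⊆ Icc 0 1 := fun x hx => by
    rw [uIcc_of_le hx.1]; exact Icc_subset_Icc_right hx.2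
  have hcomb : g - (t₂ / t₁) • f = 0 := by
    refine key _ (fun x => v₂ x - t₂ / t₁ * v₁ x) (fun x => w₂ x - t₂ / t₁ * w₁ x) ?_
      (b2.sub (continuousOn_const.mul b1)) (c2.sub (continuousOn_const.mul c1)) ?_ ?_
    · filter_upwards [Lp.coeFn_sub g ((t₂ / t₁) • f), Lp.coeFn_smul (t₂ / t₁) f, a1, a2]
        with x h1 h2 h3 h4
      rw [h1, Pi.sub_apply, h2, Pi.smul_apply, h3, h4, smul_eq_mul]
    · intro x hx
      have i1 := (c1.mono (hsub x hx)).intervalIntegrable (μ := volume)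
      have i2 := (c2.mono (hsub x hx)).intervalIntegrable (μ := volume)
      rw [intervalIntegral.integral_sub i2 (i1.const_mul _), intervalIntegral.integral_const_mul,
        d1 x hx, d2 x hx, p1.1, p2.1]
      field_simp
      ring
    · intro x hx
      have i1 := (b1.mono (hsub x hx)).intervalIntegrable (μ := volume)
      have i2 := (b2.mono (hsub x hx)).intervalIntegrable (μ := volume)
      have e : ∀ s, (μ - r) / P.a * (v₂ s - t₂ / t₁ * v₁ s) =
          (μ - r) / P.a * v₂ s - t₂ / t₁ * ((μ - r) / P.a * v₁ s) := fun s => by ring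
      simp_rw [e]
      rw [intervalIntegral.integral_sub (i2.const_mul _) ((i1.const_mul _).const_mul _),
        intervalIntegral.integral_const_mul (t₂ / t₁), e1 x hx, e2 x hx, p1.2, p2.2]
      field_simp
      ring
  exact sub_eq_zero.1 hcomb

end

end DelayRD

namespace DelayRD

noncomputable section

/-! ### The resolvent of the Robin operator -/

theorem integral_mulOp_eq_inner {m : ℝ → ℝ} (hm : Continuous m) (g : L2) :
    ∫ s in (0 : ℝ)..1, mulOp m hm g s = inner ℝ (ofContinuous m hm) g := by
  rw [inner_L2_eq]
  refine intervalIntegral.integral_congr_ae ?_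
  filter_upwards [ae_unitMeasure_iff.1 (mulOp_ae hm g), ae_unitMeasure_iff.1 (ofContinuous_ae hm)]
    with x h1 h2 hx
  rw [h1 hx, h2 hx]

/-- Green's operator `R g (x) = (a D)⁻¹ (ψ(x) ∫₀ˣ φ g + φ(x) ∫ₓ¹ ψ g)`, where `φ` meets the left
condition, `ψ` the right one, and `D` is their constant Wronskian. Writing `∫ₓ¹` as `∫₀¹ - ∫₀ˣ`
expresses `R` through multiplications, `volterra` and a rank-one term, whence compactness. -/
theorem exists_resolvent_of_solutions (P : Coeffs) (r ρ D : ℝ) {φ φ' ψ ψ' : ℝ → ℝ}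
    (hφ : ∀ x, HasDerivAt φ (φ' x) x) (hφ' : ∀ x, HasDerivAt φ' (ρ * φ x) x)
    (hψ : ∀ x, HasDerivAt ψ (ψ' x) x) (hψ' : ∀ x, HasDerivAt ψ' (ρ * ψ x) x)
    (hD : D ≠ 0) (hW : ∀ x, φ' x * ψ x - φ x * ψ' x = D)
    (hl : Real.cos P.θ₁ * φ 0 - Real.sin P.θ₁ * φ' 0 = 0)
    (hr : Real.cos P.θ₂ * ψ 1 + Real.sin P.θ₂ * ψ' 1 = 0) :
    ∃ R : L2 →L[ℝ] L2, IsCompactOperator R ∧ (R : L2 →ₗ[ℝ] L2).IsSymmetric ∧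
      ∀ g, RobinGraph P r (R g) ((r + P.a * ρ) • R g - g) := by
  have cφ : Continuous φ := continuous_iff_continuousAt.2 fun x => (hφ x).continuousAt
  have cψ : Continuous ψ := continuous_iff_continuousAt.2 fun x => (hψ x).continuousAt
  have cφ' : Continuous φ' := continuous_iff_continuousAt.2 fun x => (hφ' x).continuousAt
  have cψ' : Continuous ψ' := continuous_iff_continuousAt.2 fun x => (hψ' x).continuousAt
  have ha := P.a_pos
  set κ : ℝ := (P.a * D)⁻¹ with hκ
  set Mφ := mulOp φ cφ
  set Mψ := mulOp ψ cψ
  set R : L2 →L[ℝ] L2 := κ • (Mψ ∘L volterra ∘L Mφ - Mφ ∘L volterra ∘L Mψ +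
    (innerSL ℝ (ofContinuous ψ cψ)).smulRight (ofContinuous φ cφ)) with hR
  have hRapp : ∀ g, R g = κ • (Mψ (volterra (Mφ g)) - Mφ (volterra (Mψ g)) +
      (inner ℝ (ofContinuous ψ cψ) g : ℝ) • ofContinuous φ cφ) := fun g => by simp [hR]
  have hV : IsCompactOperator volterra := isCompactOperator_kernelOp _
  refine ⟨R, ?_, ?_, fun g => ?_⟩
  · have h1 : IsCompactOperator (Mψ ∘L volterra ∘L Mφ) := (hV.comp_clm Mφ).clm_comp Mψ
    have h2 : IsCompactOperator (Mφ ∘L volterra ∘L Mψ) := (hV.comp_clm Mψ).clm_comp Mφ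
    exact ((h1.sub h2).add (isCompactOperator_rankOne _ _)).smul κ
  · intro f g
    -- The products of integrals produced by the two integrations by parts cancel the asymmetry of
    -- the rank-one term.
    have e1 := inner_volterra_add (Mφ f) (Mψ g)
    have e2 := inner_volterra_add (Mψ f) (Mφ g)
    rw [integral_mulOp_eq_inner, integral_mulOp_eq_inner] at e1 e2
    simp only [ContinuousLinearMap.coe_coe, hRapp, inner_smul_left, inner_smul_right,
      inner_add_left, inner_add_right, inner_sub_left, inner_sub_right, conj_trivial]
    rw [mulOp_symm cψ, mulOp_symm cφ, ← mulOp_symm cψ f, ← mulOp_symm cφ f,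
      real_inner_comm (ofContinuous φ cφ) f]
    rw [real_inner_comm] at e1 e2
    simp only [real_inner_comm] at e1 e2 ⊢
    linear_combination κ * (e1 - e2)
  · set A := Mφ g with hA
    set B := Mψ g with hB
    set J : ℝ := ∫ s in (0 : ℝ)..1, B s with hJ
    have hJ' : inner ℝ (ofContinuous ψ cψ) g = J := (integral_mulOp_eq_inner cψ g).symm
    set I₁ : ℝ → ℝ := fun x => ∫ s in (0 : ℝ)..x, A s with hI₁
    set I₂ : ℝ → ℝ := fun x => ∫ s in (0 : ℝ)..x, B s with hI₂
    have hAae : A =ᵐ[unitMeasure] fun x => φ x * g x := mulOp_ae cφ g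
    have hBae : B =ᵐ[unitMeasure] fun x => ψ x * g x := mulOp_ae cψ g
    set v : ℝ → ℝ := fun x => κ * (ψ x * I₁ x + φ x * (J - I₂ x)) with hv
    set w : ℝ → ℝ := fun x => κ * (ψ' x * I₁ x + φ' x * (J - I₂ x)) with hw
    have hRv : R g =ᵐ[unitMeasure] v := by
      rw [hRapp, hJ']
      filter_upwards [Lp.coeFn_smul κ (Mψ (volterra A) - Mφ (volterra B) + J • ofContinuous φ cφ),
        Lp.coeFn_add (Mψ (volterra A) - Mφ (volterra B)) (J • ofContinuous φ cφ),
        Lp.coeFn_sub (Mψ (volterra A)) (Mφ (volterra B)), Lp.coeFn_smul J (ofContinuous φ cφ),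
        ofContinuous_ae cφ, mulOp_ae cψ (volterra A), mulOp_ae cφ (volterra B), volterra_ae A,
        volterra_ae B] with x h1 h2 h3 h4 h5 h6 h7 h8 h9
      rw [h1, Pi.smul_apply, h2, Pi.add_apply, h3, Pi.sub_apply, h4, Pi.smul_apply, h5, h6, h7, h8,
        h9, smul_eq_mul, smul_eq_mul]
      simp only [hv, hI₁, hI₂]
      ring
    have hsub : ∀ x ∈ Icc (0 : ℝ) 1, uIcc 0 x ⊆ Icc 0 1 := fun x hx => by
      rw [uIcc_of_le hx.1]; exact Icc_subset_Icc_right hx.2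
    have hI₁c : ContinuousOn I₁ (Icc 0 1) :=
      continuousOn_primitive_unit (intervalIntegrable_L2 A one_mem_unit)
    have hI₂c : ContinuousOn I₂ (Icc 0 1) :=
      continuousOn_primitive_unit (intervalIntegrable_L2 B one_mem_unit)
    -- the integrated product rule for `m I₁ + n (J - I₂)`
    have hprod : ∀ (m m' n n' : ℝ → ℝ), (∀ x, HasDerivAt m (m' x) x) → (∀ x, HasDerivAt n (n' x) x) →
        Continuous m' → Continuous n' → ∀ x ∈ Icc (0 : ℝ) 1,
        m x * I₁ x + n x * (J - I₂ x) = n 0 * J +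
          ∫ s in (0 : ℝ)..x, (m' s * I₁ s + n' s * (J - I₂ s) + (m s * φ s - n s * ψ s) * g s) := by
      intro m m' n n' hm hn hm' hn' x hx
      have cm : Continuous m := continuous_iff_continuousAt.2 fun x => (hm x).continuousAt
      have cn : Continuous n := continuous_iff_continuousAt.2 fun x => (hn x).continuousAt
      have iA := intervalIntegrable_L2 A hx
      have iB := intervalIntegrable_L2 B hx
      have p1 := mul_primitive hm hm' hx.1 iA 0
      have p2 := mul_primitive hn hn' hx.1 iB.neg J
      simp only [Pi.neg_apply, intervalIntegral.integral_neg, zero_add, mul_zero, mul_neg] at p1 p2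
      have c1 : IntervalIntegrable (fun s => m' s * I₁ s + m s * A s) volume 0 x :=
        (((hm'.continuousOn.mul (hI₁c.mono (hsub x hx))).intervalIntegrable).add
          (iA.continuousOn_mul cm.continuousOn))
      have c2 : IntervalIntegrable (fun s => n' s * (J + -I₂ s) + -(n s * B s)) volume 0 x :=
        ((hn'.continuousOn.mul (continuousOn_const.add
          (hI₂c.mono (hsub x hx)).neg)).intervalIntegrable).add
          (iB.continuousOn_mul cn.continuousOn).neg
      have e : m x * I₁ x + n x * (J - I₂ x) = n 0 * J +
          ((∫ s in (0 : ℝ)..x, (m' s * I₁ s + m s * A s)) +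
            ∫ s in (0 : ℝ)..x, (n' s * (J + -I₂ s) + -(n s * B s))) := by
        rw [← p1]
        linear_combination p2
      rw [e, ← intervalIntegral.integral_add c1 c2]
      congr 1
      refine intervalIntegral.integral_congr_ae ?_
      filter_upwards [ae_unitMeasure_iff.1 hAae, ae_unitMeasure_iff.1 hBae] with s h1 h2 hs
      have hs' : s ∈ uIoc (0 : ℝ) 1 := by
        rw [uIoc_of_le hx.1] at hs
        rw [uIoc_of_le zero_le_one]
        exact ⟨hs.1, hs.2.trans hx.2⟩
      rw [h1 hs', h2 hs']
      ring
    have hv0 : v 0 = κ * (φ 0 * J) := by simp [hv, hI₁, hI₂]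
    have hw0 : w 0 = κ * (φ' 0 * J) := by simp [hw, hI₁, hI₂]
    refine ⟨v, w, ρ • R g - P.a⁻¹ • g, ⟨hRv, fun x hx => ?_, fun x hx => ?_⟩, ?_, ?_, ?_⟩
    · rw [hv0]
      simp only [hv, hw]
      rw [intervalIntegral.integral_const_mul, hprod ψ ψ' φ φ' hψ hφ cψ' cφ' x hx, mul_add]
      have e : ∀ s, ψ' s * I₁ s + φ' s * (J - I₂ s) + (ψ s * φ s - φ s * ψ s) * g s =
          ψ' s * I₁ s + φ' s * (J - I₂ s) := fun s => by ring
      simp_rw [e]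
    · rw [hw0]
      simp only [hw]
      rw [hprod ψ' _ φ' _ hψ' hφ' (continuous_const.mul cψ) (continuous_const.mul cφ) x hx, mul_add]
      congr 1
      rw [← intervalIntegral.integral_const_mul]
      refine intervalIntegral.integral_congr_ae ?_
      have hq : (ρ • R g - P.a⁻¹ • g : L2) =ᵐ[unitMeasure] fun s => ρ * v s - P.a⁻¹ * g s := by
        filter_upwards [Lp.coeFn_sub (ρ • R g) (P.a⁻¹ • g), Lp.coeFn_smul ρ (R g),
          Lp.coeFn_smul P.a⁻¹ g, hRv] with s h1 h2 h3 h4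
        rw [h1, Pi.sub_apply, h2, h3, Pi.smul_apply, Pi.smul_apply, h4, smul_eq_mul, smul_eq_mul]
      filter_upwards [ae_unitMeasure_iff.1 hq] with s h1 hs
      have hs' : s ∈ uIoc (0 : ℝ) 1 := by
        rw [uIoc_of_le hx.1] at hs
        rw [uIoc_of_le zero_le_one]
        exact ⟨hs.1, hs.2.trans hx.2⟩
      rw [h1 hs']
      simp only [hv]
      have hκD : κ * D = P.a⁻¹ := by rw [hκ]; field_simp
      linear_combination (-(κ * g s)) * hW s - g s * hκD
    · rw [hv0, hw0]
      linear_combination κ * J * hl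
    · have hI21 : J - I₂ 1 = 0 := by simp [hI₂, hJ]
      simp only [hv, hw, hI21]
      linear_combination κ * I₁ 1 * hr
    · have : P.a * P.a⁻¹ = 1 := mul_inv_cancel₀ ha.ne'
      rw [smul_sub, smul_smul, smul_smul, this]
      module

/-- Up to a factor `ω` this is the characteristic function of the Robin problem. For large `ω` the
first nonzero coefficient among `A`, `B`, `C` dominates. They cannot all vanish, since `(A - C)² +
B² = 1` is the Pythagorean identity for the sum of the two angles. -/
theorem sinh_cosh_comb_ne_zero (s₁ c₁ s₂ c₂ : ℝ) (h₁ : s₁ ^ 2 + c₁ ^ 2 = 1) (h₂ : s₂ ^ 2 + c₂ ^ 2 = 1) :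
    ∃ ω₀ : ℝ, 0 < ω₀ ∧ ∀ ω, ω₀ ≤ ω →
      Real.sinh ω * (ω ^ 2 * (s₁ * s₂) + c₁ * c₂) + ω * Real.cosh ω * (s₁ * c₂ + c₁ * s₂) ≠ 0 := by
  set A := s₁ * s₂ with hA
  set B := s₁ * c₂ + c₁ * s₂ with hB
  set C := c₁ * c₂ with hC
  have hsc : ∀ ω : ℝ, 1 ≤ ω → 0 < Real.sinh ω ∧ Real.cosh ω ≤ 2 * Real.sinh ω := by
    intro ω hω
    refine ⟨Real.sinh_pos_iff.2 (by linarith), ?_⟩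
    rw [Real.sinh_eq, Real.cosh_eq]
    have e1 : 2 ≤ Real.exp ω := by linarith [Real.add_one_le_exp ω]
    have e2 : Real.exp (-ω) ≤ 1 / 2 := by
      rw [Real.exp_neg, ← one_div]
      exact one_div_le_one_div_of_le two_pos e1
    linarith
  by_cases hA0 : A = 0
  · by_cases hB0 : B = 0
    · refine ⟨1, one_pos, fun ω hω => ?_⟩
      have hC0 : C ≠ 0 := by
        intro h
        have : A ^ 2 + B ^ 2 + C ^ 2 - 2 * A * C = 1 := by
          simp only [hA, hB, hC]
          linear_combination h₁ * (s₂ ^ 2 + c₂ ^ 2) + h₂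
        rw [hA0, hB0, h] at this
        norm_num at this
      rw [hA0, hB0]
      simpa using ⟨by linarith, hC0⟩
    · refine ⟨|C| / |B| + 1, by positivity, fun ω hω h => ?_⟩
      have hBp : 0 < |B| := abs_pos.2 hB0
      have hω1 : |C| < ω * |B| := by
        rw [← div_lt_iff₀ hBp]; linarith
      have hω0 : 0 < ω := lt_of_lt_of_le (by positivity) hω
      rw [hA0, mul_zero, zero_add] at h
      have h3 : ω * Real.cosh ω * |B| = |Real.sinh ω| * |C| := by
        have : ω * Real.cosh ω * B = -(Real.sinh ω * C) := by linarith
        have := congrArg abs this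
        rwa [abs_neg, abs_mul, abs_mul, abs_mul, abs_of_pos hω0, abs_of_pos (Real.cosh_pos ω)] at this
      have h4 : |Real.sinh ω| ≤ Real.cosh ω := by
        rw [Real.abs_sinh]
        rw [abs_of_pos hω0]
        exact (Real.sinh_lt_cosh ω).le
      have h5 : |Real.sinh ω| * |C| ≤ Real.cosh ω * |C| := by gcongr
      nlinarith [Real.cosh_pos ω]
  · refine ⟨(2 * |B| + |C| + 1) / |A| + 1, by positivity, fun ω hω h => ?_⟩
    have hAp : 0 < |A| := abs_pos.2 hA0
    have hω1 : 1 ≤ ω := le_trans (by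
      have : 0 ≤ (2 * |B| + |C| + 1) / |A| := by positivity
      linarith) hω
    have hω2 : 2 * |B| + |C| + 1 ≤ ω * |A| := by
      rw [← div_le_iff₀ hAp]; linarith
    obtain ⟨hs, hc⟩ := hsc ω hω1
    have h3 : Real.sinh ω * |ω ^ 2 * A + C| = ω * Real.cosh ω * |B| := by
      have : Real.sinh ω * (ω ^ 2 * A + C) = -(ω * Real.cosh ω * B) := by linarith
      have := congrArg abs this
      rwa [abs_neg, abs_mul, abs_mul, abs_mul, abs_of_pos hs, abs_of_pos (by linarith : 0 < ω),
        abs_of_pos (Real.cosh_pos ω)] at this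
    have h4 : ω ^ 2 * |A| - |C| ≤ |ω ^ 2 * A + C| := by
      have := abs_sub_abs_le_abs_sub (ω ^ 2 * A) (-C)
      rwa [abs_neg, sub_neg_eq_add, abs_mul, abs_of_nonneg (sq_nonneg ω)] at this
    have h5 : ω * Real.cosh ω * |B| ≤ ω * (2 * Real.sinh ω) * |B| := by gcongr
    have h6 : |ω ^ 2 * A + C| ≤ 2 * ω * |B| := by
      have : Real.sinh ω * |ω ^ 2 * A + C| ≤ Real.sinh ω * (2 * ω * |B|) := by
        rw [h3]; linarith
      exact le_of_mul_le_mul_left this hs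
    nlinarith [abs_nonneg B, abs_nonneg C]

/-- Above some `σ` the Robin operator has no eigenvalues, and its resolvent at `σ` is compact and
symmetric. -/
theorem exists_resolvent (P : Coeffs) (r : ℝ) :
    ∃ (σ : ℝ) (R : L2 →L[ℝ] L2), IsCompactOperator R ∧ (R : L2 →ₗ[ℝ] L2).IsSymmetric ∧
      (∀ g, RobinGraph P r (R g) (σ • R g - g)) ∧
      ∀ μ f, σ ≤ μ → RobinGraph P r f (μ • f) → f = 0 := by
  have ha := P.a_pos
  set s₁ := Real.sin P.θ₁ with hs₁
  set c₁ := Real.cos P.θ₁ with hc₁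
  set s₂ := Real.sin P.θ₂ with hs₂
  set c₂ := Real.cos P.θ₂ with hc₂
  have h₁ : s₁ ^ 2 + c₁ ^ 2 = 1 := Real.sin_sq_add_cos_sq _
  have h₂ : s₂ ^ 2 + c₂ ^ 2 = 1 := Real.sin_sq_add_cos_sq _
  obtain ⟨ω₀, hω₀, hne⟩ := sinh_cosh_comb_ne_zero s₁ c₁ s₂ c₂ h₁ h₂
  -- `φ ω` solves `φ'' = ω² φ` with Cauchy data `(s₁, c₁)` at `0`; `ψ` below is the mirror image
  -- started at `1`. The parameter `ω` stays free because the same family excludes eigenvalues above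
  -- `σ`.
  set φ : ℝ → ℝ → ℝ := fun ω x => s₁ * Real.cosh (ω * x) + c₁ * (Real.sinh (ω * x) / ω) with hφ
  set φ' : ℝ → ℝ → ℝ := fun ω x => s₁ * (ω * Real.sinh (ω * x)) + c₁ * Real.cosh (ω * x) with hφ'
  have dcosh : ∀ ω x, HasDerivAt (fun x => Real.cosh (ω * x)) (Real.sinh (ω * x) * ω) x := by
    intro ω x
    simpa using ((hasDerivAt_id x).const_mul ω).cosh
  have dsinh : ∀ ω x, HasDerivAt (fun x => Real.sinh (ω * x)) (Real.cosh (ω * x) * ω) x := by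
    intro ω x
    simpa using ((hasDerivAt_id x).const_mul ω).sinh
  have dφ : ∀ ω, ω ≠ 0 → ∀ x, HasDerivAt (φ ω) (φ' ω x) x := by
    intro ω hω x
    refine (((dcosh ω x).const_mul s₁).add (((dsinh ω x).div_const ω).const_mul c₁)).congr_deriv ?_
    simp only [hφ']; field_simp
  have dφ' : ∀ ω, ω ≠ 0 → ∀ x, HasDerivAt (φ' ω) (ω ^ 2 * φ ω x) x := by
    intro ω hω x
    refine ((((dsinh ω x).const_mul ω).const_mul s₁).add ((dcosh ω x).const_mul c₁)).congr_deriv ?_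
    simp only [hφ]; field_simp
  have hDne : ∀ ω, ω₀ ≤ ω → c₂ * φ ω 1 + s₂ * φ' ω 1 ≠ 0 := by
    intro ω hω h
    have hω' : ω ≠ 0 := by linarith
    refine hne ω hω ?_
    simp only [hφ, hφ', mul_one] at h
    field_simp at h
    linear_combination h
  have hφ0 : ∀ ω, φ ω 0 = s₁ := fun ω => by simp [hφ]
  have hφ'0 : ∀ ω, φ' ω 0 = c₁ := fun ω => by simp [hφ']
  have hω₀' : ω₀ ≠ 0 := hω₀.ne'
  set ψ : ℝ → ℝ := fun x => s₂ * Real.cosh (ω₀ * (1 - x)) + c₂ * (Real.sinh (ω₀ * (1 - x)) / ω₀) with hψ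
  set ψ' : ℝ → ℝ := fun x => -(s₂ * (ω₀ * Real.sinh (ω₀ * (1 - x))) + c₂ * Real.cosh (ω₀ * (1 - x)))
    with hψ'
  have d1 : ∀ x : ℝ, HasDerivAt (fun x : ℝ => 1 - x) (-1) x := fun x => (hasDerivAt_id x).const_sub 1
  have dψ : ∀ x, HasDerivAt ψ (ψ' x) x := by
    intro x
    refine ((((dcosh ω₀ (1 - x)).comp x (d1 x)).const_mul s₂).add
      ((((dsinh ω₀ (1 - x)).comp x (d1 x)).div_const ω₀).const_mul c₂)).congr_deriv ?_
    simp only [hψ']; field_simp; ring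
  have dψ' : ∀ x, HasDerivAt ψ' (ω₀ ^ 2 * ψ x) x := by
    intro x
    refine (((((dsinh ω₀ (1 - x)).comp x (d1 x)).const_mul ω₀).const_mul s₂).add
      (((dcosh ω₀ (1 - x)).comp x (d1 x)).const_mul c₂)).neg.congr_deriv ?_
    simp only [hψ]; field_simp; ring
  have hψ1 : ψ 1 = s₂ := by simp [hψ]
  have hψ'1 : ψ' 1 = -c₂ := by simp [hψ']
  -- The Wronskian is constant, and at `1` it equals the characteristic function at `ω₀`, which is
  -- nonzero.
  set W : ℝ → ℝ := fun x => φ' ω₀ x * ψ x - φ ω₀ x * ψ' x with hWdef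
  have hWd : ∀ x, HasDerivAt W 0 x := by
    intro x
    refine (((dφ' ω₀ hω₀' x).mul (dψ x)).sub ((dφ ω₀ hω₀' x).mul (dψ' x))).congr_deriv ?_
    ring
  have hWc : ∀ x, W x = W 1 := fun x =>
    is_const_of_deriv_eq_zero (fun x => (hWd x).differentiableAt) (fun x => (hWd x).deriv) x 1
  have hW1 : W 1 = c₂ * φ ω₀ 1 + s₂ * φ' ω₀ 1 := by
    simp only [hWdef, hψ1, hψ'1]; ring
  obtain ⟨R, hRc, hRs, hRg⟩ := exists_resolvent_of_solutions P r (ω₀ ^ 2) (W 1) (dφ ω₀ hω₀')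
    (dφ' ω₀ hω₀') dψ dψ' (by rw [hW1]; exact hDne ω₀ le_rfl) hWc
    (by rw [hφ0, hφ'0]; ring) (by rw [hψ1, hψ'1]; ring)
  refine ⟨r + P.a * ω₀ ^ 2, R, hRc, hRs, hRg, fun μ f hμ hf => ?_⟩
  obtain ⟨v, w, hfv, cv, cw, hv, hw, hl, hr⟩ := hf.eigen_data
  set ω := √((μ - r) / P.a) with hω
  have hge : ω₀ ^ 2 ≤ (μ - r) / P.a := by
    rw [le_div_iff₀ ha]; linarith
  have hωω : ω₀ ≤ ω := by
    rw [hω]; exact Real.le_sqrt_of_sq_le hge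
  have hωsq : (μ - r) / P.a = ω ^ 2 := (Real.sq_sqrt ((sq_nonneg ω₀).trans hge)).symm
  have hω' : ω ≠ 0 := by linarith
  rw [hωsq] at hw
  -- An eigenfunction for `μ ≥ σ` must be `t φ_ω` with `ω ≥ ω₀`. The right boundary condition then
  -- makes `t` times a nonzero number vanish.
  set t := s₁ * v 0 + c₁ * w 0 with ht
  have pv : v 0 = t * s₁ := by rw [ht]; linear_combination (-v 0) * h₁ + c₁ * hl
  have pw : w 0 = t * c₁ := by rw [ht]; linear_combination (-w 0) * h₁ - s₁ * hl
  have cφ : Continuous (φ ω) := continuous_iff_continuousAt.2 fun x => (dφ ω hω' x).continuousAt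
  have cφ' : Continuous (φ' ω) := continuous_iff_continuousAt.2 fun x => (dφ' ω hω' x).continuousAt
  have hsub : ∀ x ∈ Icc (0 : ℝ) 1, uIcc 0 x ⊆ Icc 0 1 := fun x hx => by
    rw [uIcc_of_le hx.1]; exact Icc_subset_Icc_right hx.2
  have hzero := pair_eq_zero (ρ := ω ^ 2) (v := fun x => v x - t * φ ω x)
    (w := fun x => w x - t * φ' ω x) (cv.sub (continuous_const.mul cφ).continuousOn)
    (cw.sub (continuous_const.mul cφ').continuousOn)
    (fun x hx => by
      have i1 := (cw.mono (hsub x hx)).intervalIntegrable (μ := volume)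
      have i2 := cφ'.intervalIntegrable (μ := volume) 0 x
      rw [intervalIntegral.integral_sub i1 (i2.const_mul t), intervalIntegral.integral_const_mul,
        intervalIntegral.integral_eq_sub_of_hasDerivAt (fun y _ => dφ ω hω' y) i2, hφ0]
      linear_combination hv x hx + pv)
    (fun x hx => by
      have i1 := (cv.mono (hsub x hx)).intervalIntegrable (μ := volume)
      have i2 := (continuous_const.mul cφ).intervalIntegrable (μ := volume) (u := fun s => ω ^ 2 * φ ω s) 0 x
      have e : ∀ s, ω ^ 2 * (v s - t * φ ω s) = ω ^ 2 * v s - t * (ω ^ 2 * φ ω s) := fun s => by ring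
      simp_rw [e]
      rw [intervalIntegral.integral_sub (i1.const_mul _) (i2.const_mul t),
        intervalIntegral.integral_const_mul t,
        intervalIntegral.integral_eq_sub_of_hasDerivAt (fun y _ => dφ' ω hω' y) i2, hφ'0]
      linear_combination hw x hx + pw)
  have hz1 := hzero 1 one_mem_unit
  have ht0 : t = 0 := by
    have : t * (c₂ * φ ω 1 + s₂ * φ' ω 1) = 0 := by
      linear_combination hr - c₂ * hz1.1 - s₂ * hz1.2
    exact (mul_eq_zero.1 this).resolve_right (hDne ω hωω)
  refine eq_zero_of_ae_eq_zero_on hfv fun x hx => ?_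
  have := (hzero x hx).1
  rw [ht0] at this
  simpa using this

end

end DelayRD

namespace DelayRD

noncomputable section

/-! ### Eigenfunction expansion -/

section Basis

variable {ι : Type} (b : HilbertBasis ι ℝ L2)

theorem hasSum_coord_sq (x : L2) : HasSum (fun j => inner ℝ (b j) x ^ 2) (‖x‖ ^ 2) := by
  have := b.hasSum_inner_mul_inner x x
  rw [real_inner_self_eq_norm_sq] at this
  refine this.congr_fun fun j => ?_
  rw [real_inner_comm x, sq]

variable {b} in
theorem ext_coord {x y : L2} (h : ∀ j, inner ℝ (b j) x = inner ℝ (b j) y) : x = y := by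
  apply b.repr.injective
  ext j
  rw [b.repr_apply_apply, b.repr_apply_apply, h]

theorem norm_le_of_coord_le {x y : L2} {C : ℝ} (hC : 0 ≤ C)
    (h : ∀ j, |inner ℝ (b j) x| ≤ C * |inner ℝ (b j) y|) : ‖x‖ ≤ C * ‖y‖ := by
  have h1 : ‖x‖ ^ 2 ≤ C ^ 2 * ‖y‖ ^ 2 := by
    refine hasSum_le (fun j => ?_) (hasSum_coord_sq b x) ((hasSum_coord_sq b y).mul_left (C ^ 2))
    rw [← sq_abs, ← sq_abs (inner ℝ (b j) y), ← mul_pow]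
    exact pow_le_pow_left₀ (abs_nonneg _) (h j) 2
  rw [← mul_pow] at h1
  exact le_of_sq_le_sq h1 (by positivity)

theorem exists_diagonal {m : ι → ℝ} {C : ℝ} (hm : ∀ j, |m j| ≤ C) :
    ∃ T : L2 →L[ℝ] L2, ∀ f j, inner ℝ (b j) (T f) = m j * inner ℝ (b j) f := by
  have hmem : ∀ f : L2, Memℓp (fun j => m j * inner ℝ (b j) f) 2 := by
    intro f
    refine memℓp_gen ?_
    refine Summable.of_nonneg_of_le (fun j => by positivity) (fun j => ?_)
      ((hasSum_coord_sq b f).summable.mul_left (C ^ 2))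
    simp only [ENNReal.toReal_ofNat, Real.rpow_ofNat, norm_mul, Real.norm_eq_abs]
    rw [mul_pow, sq_abs (inner ℝ (b j) f)]
    gcongr
    exact hm j
  have hcoord : ∀ f j, inner ℝ (b j) (b.repr.symm ⟨_, hmem f⟩) = m j * inner ℝ (b j) f := by
    intro f j
    rw [← b.repr_apply_apply, LinearIsometryEquiv.apply_symm_apply]
  refine ⟨LinearMap.mkContinuous
    { toFun := fun f => b.repr.symm ⟨_, hmem f⟩
      map_add' := fun f g => ext_coord (b := b) fun j => by
        rw [inner_add_right, hcoord, hcoord, hcoord, inner_add_right, mul_add]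
      map_smul' := fun s f => ext_coord (b := b) fun j => by
        rw [RingHom.id_apply, inner_smul_right, hcoord, hcoord, inner_smul_right]; ring }
    |C| fun f => norm_le_of_coord_le b (abs_nonneg C) fun j => ?_, fun f j => hcoord f j⟩
  change |inner ℝ (b j) (b.repr.symm ⟨_, hmem f⟩)| ≤ _
  rw [hcoord, abs_mul]
  exact mul_le_mul_of_nonneg_right ((hm j).trans (le_abs_self C)) (abs_nonneg _)

open Classical in
/-- The operator that is diagonal in the basis `b`, with bounded entries `m`. -/
def diagOp (m : ι → ℝ) : L2 →L[ℝ] L2 :=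
  if h : ∃ T : L2 →L[ℝ] L2, ∀ f j, inner ℝ (b j) (T f) = m j * inner ℝ (b j) f then h.choose else 0

theorem inner_diagOp {m : ι → ℝ} {C : ℝ} (hm : ∀ j, |m j| ≤ C) (f : L2) (j : ι) :
    inner ℝ (b j) (diagOp b m f) = m j * inner ℝ (b j) f := by
  have h := exists_diagonal b hm
  rw [diagOp, dif_pos h]
  exact h.choose_spec f j

/-- The diagonal semigroup with exponents `ν`, extended by the identity to negative times. -/
def diagSemigroup (ν : ι → ℝ) (t : ℝ) : L2 →L[ℝ] L2 := diagOp b fun j => Real.exp (ν j * max t 0)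

variable {ν : ι → ℝ} {σ : ℝ}

theorem inner_diagSemigroup (hν : ∀ j, ν j ≤ σ) (t : ℝ) (f : L2) (j : ι) :
    inner ℝ (b j) (diagSemigroup b ν t f) = Real.exp (ν j * max t 0) * inner ℝ (b j) f :=
  inner_diagOp b (C := Real.exp (σ * max t 0)) (fun j => by
    rw [abs_of_pos (Real.exp_pos _)]
    gcongr
    exact hν j) f j

/-- Dominated convergence in the Parseval series: the exponents are bounded above, so the factors
are uniformly bounded on bounded times. Clipping time at `0` gives continuity on the whole line, as
the convolution lemmas require. -/
theorem continuous_diagSemigroup (hν : ∀ j, ν j ≤ σ) (f : L2) : Continuous fun t => diagSemigroup b ν t f := by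
  rw [continuous_iff_continuousAt]
  intro t₀
  refine tendsto_iff_norm_sub_tendsto_zero.2 ?_
  have hsq : Tendsto (fun t => ‖diagSemigroup b ν t f - diagSemigroup b ν t₀ f‖ ^ 2) (𝓝 t₀) (𝓝 0) := by
    have hcoord : ∀ t j, inner ℝ (b j) (diagSemigroup b ν t f - diagSemigroup b ν t₀ f) =
        (Real.exp (ν j * max t 0) - Real.exp (ν j * max t₀ 0)) * inner ℝ (b j) f := by
      intro t j
      rw [inner_sub_right, inner_diagSemigroup b hν, inner_diagSemigroup b hν, sub_mul]
    have heq : ∀ t, ‖diagSemigroup b ν t f - diagSemigroup b ν t₀ f‖ ^ 2 =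
        ∑' j, ((Real.exp (ν j * max t 0) - Real.exp (ν j * max t₀ 0)) * inner ℝ (b j) f) ^ 2 := by
      intro t
      rw [← (hasSum_coord_sq b _).tsum_eq]
      exact tsum_congr fun j => by rw [hcoord]
    simp_rw [heq]
    set M := Real.exp (|σ| * (|t₀| + 1)) with hM
    have hexp : ∀ j t, max t 0 ≤ |t₀| + 1 → Real.exp (ν j * max t 0) ≤ M := by
      intro j t ht
      refine Real.exp_le_exp.2 ?_
      calc ν j * max t 0 ≤ |σ| * max t 0 := by
            gcongr; exact (hν j).trans (le_abs_self σ)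
        _ ≤ |σ| * (|t₀| + 1) := by gcongr
    have ht₀ : max t₀ 0 ≤ |t₀| + 1 :=
      max_le (by linarith [le_abs_self t₀]) (by positivity)
    have h00 : ∑' _ : ι, (0 : ℝ) = 0 := tsum_zero
    refine Eq.subst (motive := fun x => Tendsto _ _ (𝓝 x)) h00 ?_
    refine tendsto_tsum_of_dominated_convergence
      (bound := fun j => M ^ 2 * inner ℝ (b j) f ^ 2)
      ((hasSum_coord_sq b f).summable.mul_left _) (fun j => ?_) ?_
    · have : Continuous fun t : ℝ =>
          ((Real.exp (ν j * max t 0) - Real.exp (ν j * max t₀ 0)) * inner ℝ (b j) f) ^ 2 := by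
        fun_prop
      simpa using this.tendsto t₀
    · filter_upwards [Iio_mem_nhds (show t₀ < |t₀| + 1 by linarith [le_abs_self t₀])] with t ht j
      rw [Real.norm_of_nonneg (sq_nonneg _), mul_pow]
      gcongr ?_ * _
      rw [sq_le_sq, abs_of_pos (Real.exp_pos _ : 0 < M)]
      have h1 := hexp j t (max_le (mem_Iio.1 ht).le (by positivity))
      have h2 := hexp j t₀ ht₀
      have h3 := Real.exp_pos (ν j * max t 0)
      have h4 := Real.exp_pos (ν j * max t₀ 0)
      rw [abs_le]
      constructor <;> linarith
  have := hsq.sqrt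
  simpa using this

theorem isC0Semigroup_diagSemigroup (hν : ∀ j, ν j ≤ σ) : IsC0Semigroup (diagSemigroup b ν) where
  zero := by
    ext1 f
    refine ext_coord (b := b) fun j => ?_
    rw [inner_diagSemigroup b hν]
    simp
  add s t hs ht := by
    ext1 f
    refine ext_coord (b := b) fun j => ?_
    rw [ContinuousLinearMap.comp_apply, inner_diagSemigroup b hν, inner_diagSemigroup b hν,
      inner_diagSemigroup b hν, max_eq_left hs, max_eq_left ht, max_eq_left (add_nonneg hs ht),
      mul_add, Real.exp_add, mul_assoc]
  cont f := (continuous_diagSemigroup b hν f).continuousOn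

theorem hasDerivAt_exp_const_mul (ν t : ℝ) :
    HasDerivAt (fun t => Real.exp (ν * t)) (ν * Real.exp (ν * t)) t := by
  simpa [mul_comm] using ((hasDerivAt_id t).const_mul ν).exp

/-- For `f` in the domain, comparing coordinates gives `S(t) f - f = ∫₀ᵗ S(s) g`, which is
differentiated at `0`. Conversely, convergence of the quotient gives convergence of each coordinate,
whose limit is explicit. -/
theorem isGeneratedBy_diagSemigroup (hν : ∀ j, ν j ≤ σ) {G : L2 → L2 → Prop}
    (hG : ∀ f g, G f g ↔ ∀ j, inner ℝ (b j) g = ν j * inner ℝ (b j) f) :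
    IsGeneratedBy (diagSemigroup b ν) G := by
  refine ⟨isC0Semigroup_diagSemigroup b hν, fun f g => ?_⟩
  rw [hG]
  constructor
  · intro h
    have hInt : ∀ t, 0 ≤ t → diagSemigroup b ν t f - f = ∫ s in (0 : ℝ)..t, diagSemigroup b ν s g := by
      intro t ht
      refine ext_coord (b := b) fun j => ?_
      have e1 : inner ℝ (b j) (∫ s in (0 : ℝ)..t, diagSemigroup b ν s g) =
          ∫ s in (0 : ℝ)..t, inner ℝ (b j) (diagSemigroup b ν s g) :=
        ((innerSL ℝ (b j)).intervalIntegral_comp_comm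
          ((continuous_diagSemigroup b hν g).intervalIntegrable _ _)).symm
      rw [e1, inner_sub_right, inner_diagSemigroup b hν, max_eq_left ht]
      have e2 : ∫ s in (0 : ℝ)..t, inner ℝ (b j) (diagSemigroup b ν s g) =
          ∫ s in (0 : ℝ)..t, (ν j * Real.exp (ν j * s)) * inner ℝ (b j) f := by
        refine intervalIntegral.integral_congr fun s hs => ?_
        rw [uIcc_of_le ht] at hs
        rw [inner_diagSemigroup b hν, max_eq_left hs.1, h j]
        ring
      rw [e2, intervalIntegral.integral_mul_const, intervalIntegral.integral_eq_sub_of_hasDerivAt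
        (fun s _ => hasDerivAt_exp_const_mul (ν j) s) (Continuous.intervalIntegrable (by fun_prop) _ _)]
      simp
      ring
    have hd : HasDerivAt (fun t => ∫ s in (0 : ℝ)..t, diagSemigroup b ν s g)
        (diagSemigroup b ν 0 g) 0 :=
      intervalIntegral.integral_hasDerivAt_right
        ((continuous_diagSemigroup b hν g).intervalIntegrable _ _)
        (continuous_diagSemigroup b hν g).stronglyMeasurable.stronglyMeasurableAtFilter
        (continuous_diagSemigroup b hν g).continuousAt
    rw [(isC0Semigroup_diagSemigroup b hν).zero, ContinuousLinearMap.id_apply] at hd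
    have hs := (hasDerivAt_iff_tendsto_slope_zero.1 hd).mono_left
      (nhdsWithin_mono 0 (fun x (hx : 0 < x) => hx.ne'))
    refine hs.congr' ?_
    filter_upwards [self_mem_nhdsWithin] with t ht
    rw [hInt t (le_of_lt ht)]
    simp
  · intro h j
    have h1 : Tendsto (fun t : ℝ => inner ℝ (b j) (t⁻¹ • (diagSemigroup b ν t f - f))) (𝓝[>] 0)
        (𝓝 (inner ℝ (b j) g)) := ((innerSL ℝ (b j)).continuous.tendsto g).comp h
    have h2 : Tendsto (fun t : ℝ => inner ℝ (b j) (t⁻¹ • (diagSemigroup b ν t f - f))) (𝓝[>] 0)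
        (𝓝 (ν j * inner ℝ (b j) f)) := by
      have hd := (hasDerivAt_exp_const_mul (ν j) 0).mul_const (inner ℝ (b j) f)
      have hs := (hasDerivAt_iff_tendsto_slope_zero.1 hd).mono_left
        (nhdsWithin_mono 0 (fun x (hx : 0 < x) => hx.ne'))
      simp only [mul_zero, Real.exp_zero, mul_one, zero_add, one_mul] at hs
      refine hs.congr' ?_
      filter_upwards [self_mem_nhdsWithin] with t ht
      rw [inner_smul_right, inner_sub_right, inner_diagSemigroup b hν, max_eq_left (le_of_lt ht)]
      rfl
    exact tendsto_nhds_unique h1 h2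

/-- A semigroup acts exponentially on the eigenvectors of its generator. -/
theorem IsGeneratedBy.apply_eigenvector {S : ℝ → L2 →L[ℝ] L2} {G : L2 → L2 → Prop}
    (hS : IsGeneratedBy S G) {f : L2} {μ : ℝ} (hf : G f (μ • f)) {t : ℝ} (ht : 0 ≤ t) :
    S t f = Real.exp (μ * t) • f := by
  obtain ⟨hC, hgen⟩ := hS
  have h0 := (hgen f (μ • f)).1 hf
  have hder : ∀ x, 0 ≤ x → HasDerivWithinAt (fun t => S t f) (μ • S x f) (Ici x) x := by
    intro x hx
    rw [← hasDerivWithinAt_Ioi_iff_Ici, hasDerivWithinAt_iff_tendsto_slope' (by simp)]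
    have hshift : Tendsto (fun y : ℝ => y - x) (𝓝[>] x) (𝓝[>] 0) := by
      refine tendsto_nhdsWithin_iff.2 ⟨?_, ?_⟩
      · have : Continuous fun y : ℝ => y - x := by fun_prop
        simpa using (this.tendsto x).mono_left nhdsWithin_le_nhds
      · filter_upwards [self_mem_nhdsWithin] with y hy
        exact sub_pos.2 (mem_Ioi.1 hy)
    have h1 := ((S x).continuous.tendsto _).comp (h0.comp hshift)
    rw [map_smul] at h1
    refine h1.congr' ?_
    filter_upwards [self_mem_nhdsWithin] with y hy
    have hy' : 0 ≤ y - x := (sub_pos.2 (mem_Ioi.1 hy)).le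
    have h2 : S y f = S x (S (y - x) f) := by
      have := hC.add x (y - x) hx hy'
      rw [add_sub_cancel] at this
      rw [this]; rfl
    simp only [Function.comp_apply, slope, vsub_eq_sub, h2, map_smul, map_sub]
  -- The generator provides only right derivatives, hence the one-sided criterion for constancy of
  -- `e^{-μ s} S(s) f`.
  have hconst := constant_of_has_deriv_right_zero (f := fun s => Real.exp (-μ * s) • S s f)
    (a := 0) (b := t)
    (((by fun_prop : Continuous fun s => Real.exp (-μ * s)).continuousOn).smul
      ((hC.cont f).mono Icc_subset_Ici_self))
    (fun x hx => by
      have := (hasDerivAt_exp_const_mul (-μ) x).hasDerivWithinAt.smul (hder x hx.1)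
      refine this.congr_deriv ?_
      module)
    t ⟨ht, le_rfl⟩
  simp only [mul_zero, Real.exp_zero, one_smul, hC.zero, ContinuousLinearMap.id_apply] at hconst
  have := congrArg (Real.exp (μ * t) • ·) hconst
  simpa [smul_smul, ← Real.exp_add] using this

/-- The two semigroups agree on eigenvectors, whose span is dense. This replaces the unspecified
semigroup in `IsMildSolution` by an explicit one. -/
theorem IsGeneratedBy.eq_diagSemigroup (hν : ∀ j, ν j ≤ σ) {S : ℝ → L2 →L[ℝ] L2} {G : L2 → L2 → Prop}
    (hG : ∀ f g, G f g ↔ ∀ j, inner ℝ (b j) g = ν j * inner ℝ (b j) f)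
    (hb : ∀ j, G (b j) (ν j • b j)) (hS : IsGeneratedBy S G) {t : ℝ} (ht : 0 ≤ t) :
    S t = diagSemigroup b ν t := by
  have hdense : Dense (Submodule.span ℝ (range b) : Set L2) :=
    Submodule.dense_iff_topologicalClosure_eq_top.2 b.dense_span
  refine ContinuousLinearMap.ext_on hdense ?_
  rintro _ ⟨j, rfl⟩
  rw [hS.apply_eigenvector (hb j) ht,
    (isGeneratedBy_diagSemigroup b hν hG).apply_eigenvector (hb j) ht]

end Basis

/-- The Robin operator is diagonal in an orthonormal basis, with eigenvalues bounded above. -/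
theorem exists_eigenbasis (P : Coeffs) (r : ℝ) :
    ∃ (ι : Type) (b : HilbertBasis ι ℝ L2) (ev : ι → ℝ) (σ : ℝ),
      (∀ j, RobinGraph P r (b j) (ev j • b j)) ∧ (∀ j, ev j ≤ σ) ∧
      ∀ f g, RobinGraph P r f g ↔ ∀ j, inner ℝ (b j) g = ev j * inner ℝ (b j) f := by
  obtain ⟨σ, R, hRc, hRs, hRg, hσ⟩ := exists_resolvent P r
  have hinj : ∀ g, R g = 0 → g = 0 := by
    intro g hg
    have := hRg g
    rw [hg, smul_zero, zero_sub] at this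
    exact neg_eq_zero.1 this.eq_zero
  have heig : ∀ (κ : ℝ) (f : L2), R f = κ • f → f ≠ 0 →
      κ ≠ 0 ∧ RobinGraph P r f ((σ - κ⁻¹) • f) := by
    intro κ f hf hf0
    have hκ : κ ≠ 0 := by
      rintro rfl
      exact hf0 (hinj f (by rw [hf, zero_smul]))
    refine ⟨hκ, ?_⟩
    have h1 : R (κ⁻¹ • f) = f := by
      rw [map_smul, hf, smul_smul, inv_mul_cancel₀ hκ, one_smul]
    have h2 := hRg (κ⁻¹ • f)
    rwa [h1, ← sub_smul] at h2
  -- The basis can be indexed by the eigenvalues of `R` because each eigenspace is a line.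
  -- Completeness is the spectral theorem for compact symmetric operators.
  set ι := {κ : ℝ // ∃ f : L2, R f = κ • f ∧ ‖f‖ = 1} with hι
  choose e he1 he2 using fun κ : ι => κ.2
  have hne : ∀ κ, e κ ≠ 0 := fun κ h => by simpa [h] using he2 κ
  have horth : Orthonormal ℝ e := by
    refine ⟨he2, fun κ κ' hne' => ?_⟩
    have h1 : inner ℝ (R (e κ)) (e κ') = inner ℝ (e κ) (R (e κ')) := hRs _ _
    rw [he1, he1, inner_smul_left, inner_smul_right, conj_trivial] at h1
    have h2 : (κ.1 - κ'.1) * inner ℝ (e κ) (e κ') = 0 := by linarith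
    exact (mul_eq_zero.1 h2).resolve_left (sub_ne_zero.2 fun h => hne' (Subtype.ext h))
  have hbot : (Submodule.span ℝ (range e))ᗮ = ⊥ := by
    rw [eq_bot_iff, ← ContinuousLinearMap.orthogonalComplement_iSup_eigenspaces_eq_bot hRc hRs]
    intro x hx
    rw [← Submodule.iInf_orthogonal, Submodule.mem_iInf]
    intro κ
    rw [Submodule.mem_orthogonal]
    intro f hf
    rcases eq_or_ne f 0 with rfl | hf0
    · simp
    have hRf : R f = κ • f := Module.End.mem_eigenspace_iff.1 hf
    have hn : ‖f‖ ≠ 0 := norm_ne_zero_iff.2 hf0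
    set κ' : ι := ⟨κ, ‖f‖⁻¹ • f, by rw [map_smul, hRf, smul_comm], by
      rw [norm_smul, norm_inv, norm_norm, inv_mul_cancel₀ hn]⟩ with hκ'
    obtain ⟨s, hs⟩ := RobinGraph.simple (heig κ (e κ') (he1 κ') (hne κ')).2 (heig κ f hRf hf0).2 (hne κ')
    rw [hs, inner_smul_left,
      (Submodule.mem_orthogonal _ _).1 hx _ (Submodule.subset_span ⟨κ', rfl⟩), mul_zero]
  set b : HilbertBasis ι ℝ L2 := HilbertBasis.mkOfOrthogonalEqBot horth hbot with hb
  have hbe : ∀ κ, b κ = e κ := fun κ => by rw [hb, HilbertBasis.coe_mkOfOrthogonalEqBot]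
  have hbg : ∀ κ, RobinGraph P r (b κ) ((σ - κ.1⁻¹) • b κ) := fun κ => by
    rw [hbe]; exact (heig κ _ (he1 κ) (hne κ)).2
  have hκ0 : ∀ κ : ι, κ.1 ≠ 0 := fun κ => (heig κ _ (he1 κ) (hne κ)).1
  have hcoord : ∀ (κ : ι) (g : L2), inner ℝ (b κ) (R g) = κ.1 * inner ℝ (b κ) g := by
    intro κ g
    have h1 : inner ℝ (R (e κ)) g = inner ℝ (e κ) (R g) := hRs _ _
    rw [hbe, ← h1, he1, inner_smul_left, conj_trivial]
  refine ⟨ι, b, fun κ => σ - κ.1⁻¹, σ, hbg, fun κ => ?_, fun f g => ⟨fun h κ => ?_, fun h => ?_⟩⟩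
  · by_contra hlt
    exact hne κ (by rw [← hbe]; exact hσ _ _ (not_le.1 hlt).le (hbg κ))
  -- The difference of the two sides satisfies the eigenvalue equation at `σ`, where only zero does.
  · have h1 : f = R (σ • f - g) := by
      refine sub_eq_zero.1 (hσ σ _ le_rfl ?_)
      convert! h.sub (hRg (σ • f - g)) using 1
      module
    have h2 := hcoord κ (σ • f - g)
    rw [← h1, inner_sub_right, inner_smul_right] at h2
    have := hκ0 κ
    field_simp
    linear_combination h2
  · have h1 : R (σ • f - g) = f := by
      refine ext_coord (b := b) fun κ => ?_
      have := hκ0 κ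
      rw [hcoord, inner_sub_right, inner_smul_right, h κ]
      field_simp
      ring
    have h2 := hRg (σ • f - g)
    rw [h1] at h2
    simpa using h2

end

end DelayRD

namespace DelayRD

noncomputable section

/-! ### Lifting, output and gain as bounded operators -/

theorem ofContinuous_lin {f g h : ℝ → ℝ} (hf : Continuous f) (hg : Continuous g) (hh : Continuous h)
    (α β : ℝ) (H : ∀ x, h x = α * f x + β * g x) :
    ofContinuous h hh = α • ofContinuous f hf + β • ofContinuous g hg := by
  apply Lp.ext
  filter_upwards [ofContinuous_ae hf, ofContinuous_ae hg, ofContinuous_ae hh,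
    Lp.coeFn_add (α • ofContinuous f hf) (β • ofContinuous g hg),
    Lp.coeFn_smul α (ofContinuous f hf), Lp.coeFn_smul β (ofContinuous g hg)] with x h1 h2 h3 h4 h5 h6
  rw [h3, h4, Pi.add_apply, h5, h6, Pi.smul_apply, Pi.smul_apply, h1, h2, H]
  rfl

theorem liftFun_lin (P : Coeffs) (k : ℕ) (α β : ℝ) (u v : EuclideanSpace ℝ (Fin 2)) (x : ℝ) :
    liftFun P k (α • u + β • v) x = α * liftFun P k u x + β * liftFun P k v x := by
  simp only [liftFun, PiLp.add_apply, PiLp.smul_apply, smul_eq_mul]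
  ring

theorem iteratedDeriv_liftFun_lin (P : Coeffs) (k : ℕ) (α β : ℝ) (u v : EuclideanSpace ℝ (Fin 2))
    (x : ℝ) : iteratedDeriv 2 (liftFun P k (α • u + β • v)) x =
      α * iteratedDeriv 2 (liftFun P k u) x + β * iteratedDeriv 2 (liftFun P k v) x := by
  have hu := (contDiff_liftFun P k u).contDiffAt (x := x)
  have hv := (contDiff_liftFun P k v).contDiffAt (x := x)
  have : liftFun P k (α • u + β • v) = (fun y => α * liftFun P k u y) + fun y => β * liftFun P k v y := by
    ext y; exact liftFun_lin P k α β u v y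
  rw [this, iteratedDeriv_add (contDiffAt_const.mul hu) (contDiffAt_const.mul hv),
    iteratedDeriv_const_mul α hu, iteratedDeriv_const_mul β hv]

theorem lift_lin (P : Coeffs) (k : ℕ) (α β : ℝ) (u v : EuclideanSpace ℝ (Fin 2)) :
    lift P k (α • u + β • v) = α • lift P k u + β • lift P k v :=
  ofContinuous_lin _ _ _ α β (liftFun_lin P k α β u v)

theorem opLift_lin (P : Coeffs) (r : ℝ) (k : ℕ) (α β : ℝ) (u v : EuclideanSpace ℝ (Fin 2)) :
    opLift P r k (α • u + β • v) = α • opLift P r k u + β • opLift P r k v :=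
  ofContinuous_lin _ _ _ α β fun x => by
    rw [liftFun_lin, iteratedDeriv_liftFun_lin]; ring

theorem opLift_shift (P : Coeffs) (r s : ℝ) (k : ℕ) (u : EuclideanSpace ℝ (Fin 2)) :
    opLift P (r + s) k u = opLift P r k u + s • lift P k u := by
  have := ofContinuous_lin (continuous_opLiftFun P r k u) (contDiff_liftFun P k u).continuous
    (continuous_opLiftFun P (r + s) k u) 1 s fun x => by ring
  rwa [one_smul] at this

/-- The lifting operator as a bounded operator. -/
def liftL (P : Coeffs) (k : ℕ) : EuclideanSpace ℝ (Fin 2) →L[ℝ] L2 :=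
  LinearMap.toContinuousLinearMap
    { toFun := lift P k
      map_add' := fun u v => by simpa using lift_lin P k 1 1 u v
      map_smul' := fun α u => by simpa using lift_lin P k α 0 u 0 }

/-- `u ↦ a (L_k u)'' + r L_k u` as a bounded operator. -/
def opLiftL (P : Coeffs) (r : ℝ) (k : ℕ) : EuclideanSpace ℝ (Fin 2) →L[ℝ] L2 :=
  LinearMap.toContinuousLinearMap
    { toFun := opLift P r k
      map_add' := fun u v => by simpa using opLift_lin P r k 1 1 u v
      map_smul' := fun α u => by simpa using opLift_lin P r k α 0 u 0 }

/-- `f ↦ (⟨f, e₁⟩, …, ⟨f, e_{N₀}⟩)`. -/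
def outputL {N₀ : ℕ} (e : Fin N₀ → L2) : L2 →L[ℝ] EuclideanSpace ℝ (Fin N₀) :=
  (EuclideanSpace.equiv (Fin N₀) ℝ).symm.toContinuousLinearMap ∘L
    ContinuousLinearMap.pi fun i => innerSL ℝ (e i)

theorem outputL_apply {N₀ : ℕ} (e : Fin N₀ → L2) (f : L2) (i : Fin N₀) :
    outputL e f i = inner ℝ f (e i) := by
  rw [real_inner_comm]; rfl

/-- A real matrix as a bounded operator between Euclidean spaces. -/
def matL {m n : ℕ} (K : Matrix (Fin m) (Fin n) ℝ) :
    EuclideanSpace ℝ (Fin n) →L[ℝ] EuclideanSpace ℝ (Fin m) :=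
  LinearMap.toContinuousLinearMap (Matrix.toEuclideanLin K)

theorem matL_apply {m n : ℕ} (K : Matrix (Fin m) (Fin n) ℝ) (y : EuclideanSpace ℝ (Fin n)) (i : Fin m) :
    matL K y i = ∑ j, K i j * y j := by
  simp [matL, Matrix.toEuclideanLin, Matrix.mulVec, dotProduct]

theorem norm_matL_apply_le {m n : ℕ} (K : Matrix (Fin m) (Fin n) ℝ) (y : EuclideanSpace ℝ (Fin n)) :
    ‖matL K y‖ ≤ ‖K‖ * ‖y‖ := Matrix.l2_opNorm_mulVec K y

theorem feedback_eq {N₀ : ℕ} (e : Fin N₀ → L2) (K : Matrix (Fin 2) (Fin N₀) ℝ) (X : ℝ → L2) (t : ℝ) :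
    feedback e K X t = matL K (outputL e (X t)) := by
  ext i
  rw [matL_apply]
  simp only [outputL_apply]
  rfl

/-! ### Scalar linear equations -/

section Scalar
variable {𝕜 : Type*} [RCLike 𝕜] {ν : 𝕜} {ε δ : ℝ → 𝕜}

/-- From the integral equation to the variation of constants formula; `δ` is `t ↦ exp (-ν t)`. -/
theorem duhamel_of_integral (hδ : ∀ t, HasDerivAt δ (-ν * δ t) t) (hδ0 : δ 0 = 1) {y f : ℝ → 𝕜} {y₀ : 𝕜}
    (hy : ContinuousOn y (Ici 0)) (hf : ∀ T, 0 ≤ T → IntervalIntegrable f volume 0 T)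
    (h : ∀ t, 0 ≤ t → y t = y₀ + ∫ s in (0 : ℝ)..t, (ν * y s + f s)) {t : ℝ} (ht : 0 ≤ t) :
    δ t * y t = y₀ + ∫ s in (0 : ℝ)..t, δ s * f s := by
  have hc : Continuous δ := continuous_iff_continuousAt.2 fun t => (hδ t).continuousAt
  have hi : IntervalIntegrable (fun s => ν * y s + f s) volume 0 t :=
    (intervalIntegrable_of_continuousOn_Ici (continuousOn_const.mul hy) ht).add (hf t ht)
  rw [h t ht, mul_primitive hδ (continuous_const.mul hc) ht hi, hδ0, one_mul]
  congr 1
  refine intervalIntegral.integral_congr fun s hs => ?_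
  rw [uIcc_of_le ht] at hs
  simp only [← h s hs.1]
  ring

/-- From the variation of constants formula to the integral equation. -/
theorem integral_of_duhamel (hε : ∀ t, HasDerivAt ε (ν * ε t) t) (hε0 : ε 0 = 1)
    (hδc : Continuous δ) (hεδ : ∀ t, ε t * δ t = 1) {y f : ℝ → 𝕜} {y₀ : 𝕜}
    (hf : ∀ T, 0 ≤ T → IntervalIntegrable f volume 0 T)
    (h : ∀ t, 0 ≤ t → δ t * y t = y₀ + ∫ s in (0 : ℝ)..t, δ s * f s) {t : ℝ} (ht : 0 ≤ t) :
    y t = y₀ + ∫ s in (0 : ℝ)..t, (ν * y s + f s) := by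
  have hc : Continuous ε := continuous_iff_continuousAt.2 fun t => (hε t).continuousAt
  have hi : IntervalIntegrable (fun s => δ s * f s) volume 0 t :=
    (hf t ht).continuousOn_mul hδc.continuousOn
  have h1 := mul_primitive hε (continuous_const.mul hc) ht hi y₀
  rw [← h t ht, hε0, one_mul, ← mul_assoc, hεδ, one_mul] at h1
  rw [h1]
  congr 1
  refine intervalIntegral.integral_congr fun s hs => ?_
  rw [uIcc_of_le ht] at hs
  simp only [← h s hs.1]
  linear_combination (ν * y s + f s) * hεδ s

end Scalar

end

end DelayRD

namespace DelayRD

noncomputable section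

/-! ### Modal equations of mild solutions -/

/-- `𝒜_{c,0}` is diagonal in the Hilbert basis `b`, with eigenvalues `ev` bounded by `σ`. -/
structure IsEigenbasis (P : Coeffs) {ι : Type} (b : HilbertBasis ι ℝ L2) (ev : ι → ℝ) (σ : ℝ) :
    Prop where
  graph : ∀ j, RobinGraph P (P.b + P.c) (b j) (ev j • b j)
  le : ∀ j, ev j ≤ σ
  graph_iff : ∀ f g, RobinGraph P (P.b + P.c) f g ↔
    ∀ j, inner ℝ (b j) g = ev j * inner ℝ (b j) f

/-- The semigroup generated by `𝒜₀`. -/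
def heat (P : Coeffs) {ι : Type} (b : HilbertBasis ι ℝ L2) (ev : ι → ℝ) : ℝ → L2 →L[ℝ] L2 :=
  diagSemigroup b fun j => ev j - P.c

section
variable {P : Coeffs} {ι : Type} {b : HilbertBasis ι ℝ L2} {ev : ι → ℝ} {σ : ℝ}

theorem IsEigenbasis.exponent_le (hB : IsEigenbasis P b ev σ) (j : ι) : ev j - P.c ≤ σ - P.c := by
  linarith [hB.le j]

theorem IsEigenbasis.graph_iff' (hB : IsEigenbasis P b ev σ) (f g : L2) :
    RobinGraph P P.b f g ↔ ∀ j, inner ℝ (b j) g = (ev j - P.c) * inner ℝ (b j) f := by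
  have h1 : RobinGraph P P.b f g ↔ RobinGraph P (P.b + P.c) f (g + P.c • f) := by
    rw [robinGraph_shift, add_sub_cancel_right]
  rw [h1, hB.graph_iff]
  refine forall_congr' fun j => ?_
  rw [inner_add_right, inner_smul_right]
  constructor <;> intro h <;> linarith

theorem IsEigenbasis.isGeneratedBy (hB : IsEigenbasis P b ev σ) :
    IsGeneratedBy (heat P b ev) (RobinGraph P P.b) :=
  isGeneratedBy_diagSemigroup b hB.exponent_le hB.graph_iff'

theorem IsEigenbasis.continuous_heat (hB : IsEigenbasis P b ev σ) (f : L2) :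
    Continuous fun t => heat P b ev t f := continuous_diagSemigroup b hB.exponent_le f

theorem IsEigenbasis.inner_heat (hB : IsEigenbasis P b ev σ) {t : ℝ} (ht : 0 ≤ t) (f : L2) (j : ι) :
    inner ℝ (b j) (heat P b ev t f) = Real.exp ((ev j - P.c) * t) * inner ℝ (b j) f := by
  rw [heat, inner_diagSemigroup b hB.exponent_le, max_eq_left ht]

theorem IsEigenbasis.eq_heat (hB : IsEigenbasis P b ev σ) {S : ℝ → L2 →L[ℝ] L2}
    (hS : IsGeneratedBy S (RobinGraph P P.b)) {t : ℝ} (ht : 0 ≤ t) : S t = heat P b ev t := by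
  refine hS.eq_diagSemigroup b hB.exponent_le hB.graph_iff' (fun j => ?_) ht
  rw [hB.graph_iff']
  intro i
  rw [inner_smul_right]
  by_cases h : i = j
  · rw [h]
  · rw [b.orthonormal.2 h]; simp

/-- The given `e` need not belong to the basis: its coordinates vanish wherever `ev j ≠ μ`, so all
surviving Parseval terms carry the same exponential. -/
theorem IsEigenbasis.inner_heat_eigenvector (hB : IsEigenbasis P b ev σ) {μ : ℝ} {e : L2}
    (he : RobinGraph P (P.b + P.c) e (μ • e)) {t : ℝ} (ht : 0 ≤ t) (f : L2) :
    inner ℝ (heat P b ev t f) e = Real.exp ((μ - P.c) * t) * inner ℝ f e := by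
  rw [← b.tsum_inner_mul_inner (heat P b ev t f) e, ← b.tsum_inner_mul_inner f e, ← tsum_mul_left]
  refine tsum_congr fun j => ?_
  have h1 := (hB.graph_iff _ _).1 he j
  rw [inner_smul_right] at h1
  rw [real_inner_comm (b j) (heat P b ev t f), hB.inner_heat ht, real_inner_comm (b j) f]
  have h2 : (μ - ev j) * inner ℝ (b j) e = 0 := by linarith
  rcases mul_eq_zero.1 h2 with h3 | h3
  · rw [show ev j = μ by linarith]; ring
  · rw [h3]; ring

/-- Standing assumptions on the history, the disturbance and the delay. -/
structure IsAdmissible (hm hM : ℝ) (Φ p : ℝ → L2) (h : ℝ → ℝ) : Prop where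
  hm_pos : 0 < hm
  hmM : hm < hM
  history : ContinuousOn Φ (Icc (-hM) 0)
  dist : ∀ T : ℝ, 0 ≤ T → MemLp p ⊤ (volume.restrict (Icc 0 T))
  delay : ContinuousOn h (Ici 0)
  delay_bd : ∀ t, 0 ≤ t → hm ≤ h t ∧ h t ≤ hM

theorem IsAdmissible.hM_pos {hm hM : ℝ} {Φ p : ℝ → L2} {h : ℝ → ℝ}
    (hA : IsAdmissible hm hM Φ p h) : 0 < hM := hA.hm_pos.trans hA.hmM

theorem IsAdmissible.intervalIntegrable {hm hM : ℝ} {Φ p : ℝ → L2} {h : ℝ → ℝ}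
    (hA : IsAdmissible hm hM Φ p h) {T : ℝ} (hT : 0 ≤ T) : IntervalIntegrable p volume 0 T := by
  rw [intervalIntegrable_iff_integrableOn_Icc_of_le hT]
  exact (hA.dist T hT).integrable le_top

theorem IsMildSolution.continuousOn {k : ℕ} {hm hM : ℝ} {h : ℝ → ℝ} {Φ p : ℝ → L2}
    {u : ℝ → EuclideanSpace ℝ (Fin 2)} {X : ℝ → L2} (hA : IsAdmissible hm hM Φ p h)
    (hX : IsMildSolution P k hM h Φ p u X) : ContinuousOn X (Ici (-hM)) := by
  have h0 : X 0 = Φ 0 := hX.2.1 ⟨by linarith [hA.hM_pos], le_rfl⟩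
  refine (continuousOn_ite_history hA.history hX.1 h0).congr fun t ht => ?_
  by_cases h1 : t ≤ 0
  · simp only [if_pos h1]; exact hX.2.1 ⟨ht, h1⟩
  · simp only [if_neg h1]

/-- The forcing term of the variation of constants formula. -/
def forcing (P : Coeffs) (k : ℕ) (h : ℝ → ℝ) (p : ℝ → L2) (u : ℝ → EuclideanSpace ℝ (Fin 2))
    (X : ℝ → L2) (s : ℝ) : L2 :=
  opLift P P.b k (u s) - lift P k (deriv u s) + P.c • X (s - h s) + p s

theorem intervalIntegrable_forcing {k : ℕ} {hm hM : ℝ} {h : ℝ → ℝ} {Φ p : ℝ → L2}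
    {u : ℝ → EuclideanSpace ℝ (Fin 2)} {X : ℝ → L2} (hA : IsAdmissible hm hM Φ p h)
    (hX : ContinuousOn X (Ici (-hM))) (hu : ∀ T, 0 ≤ T → AbsolutelyContinuousOnInterval u 0 T)
    {T : ℝ} (hT : 0 ≤ T) : IntervalIntegrable (forcing P k h p u X) volume 0 T := by
  have h1 : IntervalIntegrable (fun s => opLift P P.b k (u s)) volume 0 T :=
    ((opLiftL P P.b k).continuous.comp_continuousOn (hu T hT).continuousOn).intervalIntegrable
  have h2 : IntervalIntegrable (fun s => lift P k (deriv u s)) volume 0 T := by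
    have := (absolutelyContinuousOnInterval_euclidean hT (hu T hT)).1
    exact ⟨(liftL P k).integrable_comp this.1, (liftL P k).integrable_comp this.2⟩
  have h3 : IntervalIntegrable (fun s => P.c • X (s - h s)) volume 0 T :=
    intervalIntegrable_of_continuousOn_Ici
      ((continuousOn_delay hX hA.delay hA.delay_bd).const_smul P.c) hT
  exact ((h1.sub h2).add h3).add (hA.intervalIntegrable hT)

theorem IsMildSolution.eq_heat (hB : IsEigenbasis P b ev σ) {k : ℕ} {hM : ℝ} {h : ℝ → ℝ}
    {Φ p : ℝ → L2} {u : ℝ → EuclideanSpace ℝ (Fin 2)} {X : ℝ → L2}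
    (hX : IsMildSolution P k hM h Φ p u X) {t : ℝ} (ht : 0 ≤ t) :
    X t = heat P b ev t (Φ 0 - lift P k (u 0)) + lift P k (u t) +
      ∫ s in (0 : ℝ)..t, heat P b ev (t - s) (forcing P k h p u X s) := by
  obtain ⟨-, -, -, S, hS, hXS⟩ := hX
  rw [hXS t ht, hB.eq_heat hS ht]
  congr 1
  refine intervalIntegral.integral_congr fun s hs => ?_
  rw [uIcc_of_le ht] at hs
  simp only [hB.eq_heat hS (sub_nonneg.2 hs.2)]
  rfl

/-- The forcing of the mode with eigenpair `(μ, e)`. -/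
def modalForcing (P : Coeffs) (k : ℕ) (h : ℝ → ℝ) (p : ℝ → L2) (μ : ℝ) (e : L2)
    (u : ℝ → EuclideanSpace ℝ (Fin 2)) (y : ℝ → ℝ) (s : ℝ) : ℝ :=
  inner ℝ (opLift P (P.b + P.c) k (u s) - μ • lift P k (u s)) e + P.c * y (s - h s) +
    inner ℝ (p s) e

theorem intervalIntegrable_modalForcing {k : ℕ} {hm hM : ℝ} {h : ℝ → ℝ} {Φ p : ℝ → L2}
    {u : ℝ → EuclideanSpace ℝ (Fin 2)} {y : ℝ → ℝ} (hA : IsAdmissible hm hM Φ p h)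
    (hy : ContinuousOn y (Ici (-hM))) (hu : ∀ T, 0 ≤ T → AbsolutelyContinuousOnInterval u 0 T)
    (μ : ℝ) (e : L2) {T : ℝ} (hT : 0 ≤ T) :
    IntervalIntegrable (modalForcing P k h p μ e u y) volume 0 T := by
  have hc := (hu T hT).continuousOn
  have h1 : IntervalIntegrable
      (fun s => inner ℝ (opLift P (P.b + P.c) k (u s) - μ • lift P k (u s)) e) volume 0 T := by
    have : ContinuousOn (fun s => opLift P (P.b + P.c) k (u s) - μ • lift P k (u s)) (uIcc 0 T) :=
      ((opLiftL P (P.b + P.c) k).continuous.comp_continuousOn hc).sub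
        (((liftL P k).continuous.comp_continuousOn hc).const_smul μ)
    exact (this.inner continuousOn_const).intervalIntegrable
  have h2 : IntervalIntegrable (fun s => P.c * y (s - h s)) volume 0 T :=
    intervalIntegrable_of_continuousOn_Ici
      (continuousOn_const.mul (continuousOn_delay hy hA.delay hA.delay_bd)) hT
  have h3 : IntervalIntegrable (fun s => inner ℝ (p s) e) volume 0 T := by
    have hp := hA.intervalIntegrable hT
    simp_rw [real_inner_comm e]
    exact ⟨(innerSL ℝ e).integrable_comp hp.1, (innerSL ℝ e).integrable_comp hp.2⟩
  exact (h1.add h2).add h3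

/-- The variation of constants formula for a mode, in which the derivative of the input has been
integrated by parts. -/
theorem modal_duhamel (hB : IsEigenbasis P b ev σ) {k : ℕ} {hm hM : ℝ} {h : ℝ → ℝ}
    {Φ p : ℝ → L2} {u : ℝ → EuclideanSpace ℝ (Fin 2)} {X : ℝ → L2} (hA : IsAdmissible hm hM Φ p h)
    (hXc : ContinuousOn X (Ici (-hM))) (hu : ∀ T, 0 ≤ T → AbsolutelyContinuousOnInterval u 0 T)
    {t : ℝ} (ht : 0 ≤ t)
    (hX : X t = heat P b ev t (Φ 0 - lift P k (u 0)) + lift P k (u t) +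
      ∫ s in (0 : ℝ)..t, heat P b ev (t - s) (forcing P k h p u X s))
    {μ : ℝ} {e : L2} (he : RobinGraph P (P.b + P.c) e (μ • e)) :
    Real.exp (-(μ - P.c) * t) * inner ℝ (X t) e = inner ℝ (Φ 0) e +
      ∫ s in (0 : ℝ)..t, Real.exp (-(μ - P.c) * s) *
        modalForcing P k h p μ e u (fun s => inner ℝ (X s) e) s := by
  set ν := μ - P.c with hν
  obtain ⟨hui, -, hueq⟩ := absolutelyContinuousOnInterval_euclidean ht (hu t ht)
  set l : ℝ → ℝ := fun s => inner ℝ (lift P k (u s)) e with hl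
  set l' : ℝ → ℝ := fun s => inner ℝ (lift P k (deriv u s)) e with hl'
  set Λ : EuclideanSpace ℝ (Fin 2) →L[ℝ] ℝ := innerSL ℝ e ∘L liftL P k with hΛ
  have hΛl : ∀ s, Λ (u s) = l s := fun s => real_inner_comm (lift P k (u s)) e
  have hΛl' : ∀ s, Λ (deriv u s) = l' s := fun s => real_inner_comm (lift P k (deriv u s)) e
  have hl'i : IntervalIntegrable l' volume 0 t := by
    have : l' = fun s => Λ (deriv u s) := funext fun s => (hΛl' s).symm
    rw [this]
    exact ⟨Λ.integrable_comp hui.1, Λ.integrable_comp hui.2⟩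
  have hleq : ∀ s ∈ Icc 0 t, l s = l 0 + ∫ r in (0 : ℝ)..s, l' r := by
    intro s hs
    have hsub : uIcc 0 s ⊆ uIcc 0 t := by
      rw [uIcc_of_le hs.1, uIcc_of_le ht]; exact Icc_subset_Icc_right hs.2
    rw [← hΛl, hueq s hs, map_add, hΛl, ← Λ.intervalIntegral_comp_comm (hui.mono_set hsub)]
    simp_rw [hΛl']
  have hδ : ∀ s, HasDerivAt (fun s => Real.exp (-ν * s)) (-ν * Real.exp (-ν * s)) s := fun s =>
    hasDerivAt_exp_const_mul (-ν) s
  -- This exchanges `L_k u'` for `-ν L_k u` and boundary terms; the latter cancel the lifting terms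
  -- of the mild formula.
  have ibp := mul_primitive hδ (by fun_prop) ht hl'i (l 0)
  rw [← hleq t ⟨ht, le_rfl⟩] at ibp
  simp only [mul_zero, Real.exp_zero, one_mul] at ibp
  have hFi := intervalIntegrable_forcing (P := P) (k := k) hA hXc hu ht
  have hconv := intervalIntegrable_convolution hB.continuous_heat hFi t
  have hinner : inner ℝ (∫ s in (0 : ℝ)..t, heat P b ev (t - s) (forcing P k h p u X s)) e =
      ∫ s in (0 : ℝ)..t, Real.exp (ν * (t - s)) * inner ℝ (forcing P k h p u X s) e := by
    have e1 := (innerSL ℝ e).intervalIntegral_comp_comm hconv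
    simp only [innerSL_apply_apply] at e1
    rw [real_inner_comm, ← e1]
    refine intervalIntegral.integral_congr fun s hs => ?_
    rw [uIcc_of_le ht] at hs
    rw [real_inner_comm, hB.inner_heat_eigenvector he (sub_nonneg.2 hs.2)]
  have hcombine : Real.exp (-ν * t) * inner ℝ (X t) e = inner ℝ (Φ 0) e - l 0 +
      Real.exp (-ν * t) * l t +
      ∫ s in (0 : ℝ)..t, Real.exp (-ν * s) * inner ℝ (forcing P k h p u X s) e := by
    rw [hX, inner_add_left, inner_add_left, hB.inner_heat_eigenvector he ht, inner_sub_left, hinner,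
      mul_add, mul_add, ← intervalIntegral.integral_const_mul, ← mul_assoc, ← Real.exp_add]
    have e1 : -ν * t + (μ - P.c) * t = 0 := by rw [hν]; ring
    rw [e1, Real.exp_zero, one_mul]
    congr 1
    refine intervalIntegral.integral_congr fun s _ => ?_
    rw [← mul_assoc, ← Real.exp_add]
    congr 2
    ring
  have hFe : IntervalIntegrable (fun s => Real.exp (-ν * s) * inner ℝ (forcing P k h p u X s) e)
      volume 0 t := by
    have : IntervalIntegrable (fun s => inner ℝ (forcing P k h p u X s) e) volume 0 t := by
      simp_rw [real_inner_comm e]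
      exact ⟨(innerSL ℝ e).integrable_comp hFi.1, (innerSL ℝ e).integrable_comp hFi.2⟩
    exact this.continuousOn_mul (by fun_prop)
  have hlc : ContinuousOn l (uIcc 0 t) :=
    ((liftL P k).continuous.comp_continuousOn (hu t ht).continuousOn).inner continuousOn_const
  have hGi : IntervalIntegrable (fun s => -ν * Real.exp (-ν * s) * l s + Real.exp (-ν * s) * l' s)
      volume 0 t :=
    ((by fun_prop : Continuous fun s => -ν * Real.exp (-ν * s)).continuousOn.mul
      hlc).intervalIntegrable.add (hl'i.continuousOn_mul (by fun_prop))
  have hibp : ∫ s in (0 : ℝ)..t, (-ν * Real.exp (-ν * s) * (l 0 + ∫ r in (0 : ℝ)..s, l' r) +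
      Real.exp (-ν * s) * l' s) =
      ∫ s in (0 : ℝ)..t, (-ν * Real.exp (-ν * s) * l s + Real.exp (-ν * s) * l' s) := by
    refine intervalIntegral.integral_congr fun s hs => ?_
    rw [uIcc_of_le ht] at hs
    simp only [← hleq s hs]
  rw [hibp] at ibp
  rw [hcombine, ibp]
  have hadd := intervalIntegral.integral_add hGi hFe
  -- Since `ν = μ - c`, the combination `𝒜 L_k u - ν L_k u` equals `𝒜_c L_k u - μ L_k u`, the form
  -- in which `B` is defined.
  have hfinal : ∫ s in (0 : ℝ)..t, Real.exp (-ν * s) *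
        modalForcing P k h p μ e u (fun s => inner ℝ (X s) e) s =
      ∫ s in (0 : ℝ)..t, ((-ν * Real.exp (-ν * s) * l s + Real.exp (-ν * s) * l' s) +
        Real.exp (-ν * s) * inner ℝ (forcing P k h p u X s) e) := by
    refine intervalIntegral.integral_congr fun s _ => ?_
    simp only [modalForcing, forcing, opLift_shift, inner_add_left, inner_sub_left, inner_smul_left,
      conj_trivial, hl, hl', hν]
    ring
  rw [hfinal, hadd]
  ring

end

end

end DelayRD

namespace DelayRD

noncomputable section

/-! ### Decay rates and left eigenvectors -/

/-- At `κ = 0` the inequality is the hypothesis, and strict inequalities persist by continuity. -/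
theorem exists_rate {α c hM : ℝ} (h : |c| < α) :
    ∃ κ : ℝ, 0 < κ ∧ |c| * Real.exp (κ * hM) < α - κ := by
  have hc : Continuous fun κ : ℝ => α - κ - |c| * Real.exp (κ * hM) := by fun_prop
  have h0 : ∀ᶠ κ in 𝓝 (0 : ℝ), 0 < α - κ - |c| * Real.exp (κ * hM) :=
    hc.continuousAt.eventually (lt_mem_nhds (by simpa using h))
  obtain ⟨κ, h1, h2⟩ := ((h0.filter_mono nhdsWithin_le_nhds).and
    (self_mem_nhdsWithin (a := (0 : ℝ)) (s := Ioi 0))).exists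
  exact ⟨κ, h2, by linarith⟩

/-- Exponential decay of solutions of linear equations with a small delayed term. -/
theorem delay_decay {E : Type*} [NormedAddCommGroup E] [NormedSpace ℝ E] {z : ℝ → E} {h : ℝ → ℝ}
    {hm hM T κ α c N H : ℝ} (hm_pos : 0 < hm) (hM0 : 0 ≤ hM) (hκ0 : 0 ≤ κ)
    (hq : |c| * Real.exp (κ * hM) < α - κ) (hb : ∀ t, 0 ≤ t → hm ≤ h t ∧ h t ≤ hM) (hT : 0 ≤ T)
    (hz : ContinuousOn z (Icc (-hM) T)) (hH : 0 ≤ H)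
    (hhist : ∀ t ∈ Icc (-hM) 0, Real.exp (κ * t) * ‖z t‖ ≤ N)
    (hrep : ∀ t ∈ Icc 0 T, ∃ (r : E) (g : ℝ → E), z t = r + ∫ s in (0 : ℝ)..t, g s ∧
      Real.exp (κ * t) * ‖r‖ ≤ N ∧ ∀ᵐ s, s ∈ Ioc 0 t →
        ‖g s‖ ≤ Real.exp (-α * (t - s)) * (|c| * ‖z (s - h s)‖ + H * Real.exp (-κ * s))) :
    ∀ t ∈ Icc (-hM) T, Real.exp (κ * t) * ‖z t‖ ≤
      (N + H / (α - κ)) / (1 - |c| * Real.exp (κ * hM) / (α - κ)) := by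
  have hακ : 0 < α - κ := lt_of_le_of_lt (by positivity) hq
  refine exp_weight_small_gain hM0 hT hz (by positivity) ((div_lt_one hακ).2 hq)
    (fun t ht => (hhist t ht).trans (le_add_of_nonneg_right (by positivity))) ?_
  intro t ht m hm0 hzm
  obtain ⟨r, g, hr, hrN, hg⟩ := hrep t ht
  have hInt : Real.exp (κ * t) * ‖∫ s in (0 : ℝ)..t, g s‖ ≤
      (|c| * Real.exp (κ * hM) * m + H) / (α - κ) := by
    refine norm_integral_le_exp_weight ht.1 (by linarith) (by positivity) ?_
    filter_upwards [hg] with s hs hst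
    refine (hs hst).trans ?_
    have hbs := hb s hst.1.le
    have h1 := hzm (s - h s) ⟨by linarith [hst.1], by linarith [hst.2]⟩
    -- Looking back by at most `hM` costs at most a factor `e^{κ hM}` in the weight.
    have h2 : ‖z (s - h s)‖ ≤ Real.exp (-κ * s) * Real.exp (κ * hM) * m := by
      have h3 : Real.exp (-κ * (s - h s)) ≤ Real.exp (-κ * s) * Real.exp (κ * hM) := by
        rw [← Real.exp_add, Real.exp_le_exp]; nlinarith
      calc ‖z (s - h s)‖ = Real.exp (-κ * (s - h s)) * (Real.exp (κ * (s - h s)) * ‖z (s - h s)‖) := by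
            rw [← mul_assoc, ← Real.exp_add]; simp
        _ ≤ Real.exp (-κ * s) * Real.exp (κ * hM) * m := by gcongr
    calc Real.exp (-α * (t - s)) * (|c| * ‖z (s - h s)‖ + H * Real.exp (-κ * s))
        ≤ Real.exp (-α * (t - s)) *
          (|c| * (Real.exp (-κ * s) * Real.exp (κ * hM) * m) + H * Real.exp (-κ * s)) := by gcongr
      _ = (|c| * Real.exp (κ * hM) * m + H) * (Real.exp (-κ * s) * Real.exp (-α * (t - s))) := by ring
  rw [hr]
  calc Real.exp (κ * t) * ‖r + ∫ s in (0 : ℝ)..t, g s‖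
      ≤ Real.exp (κ * t) * ‖r‖ + Real.exp (κ * t) * ‖∫ s in (0 : ℝ)..t, g s‖ := by
        rw [← mul_add]; gcongr; exact norm_add_le _ _
    _ ≤ N + (|c| * Real.exp (κ * hM) * m + H) / (α - κ) := add_le_add hrN hInt
    _ = N + H / (α - κ) + |c| * Real.exp (κ * hM) / (α - κ) * m := by ring

/-- A real matrix with simple complex eigenvalues is diagonalised by functionals that are jointly
bounded below. -/
theorem exists_left_eigenfunctionals {n : ℕ} (M : Matrix (Fin n) (Fin n) ℝ)
    (hs : (M.map (algebraMap ℝ ℂ)).charpoly.roots.Nodup) :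
    ∃ (J : Finset ℂ) (ζ : J → EuclideanSpace ℝ (Fin n) →L[ℝ] ℂ) (C : ℝ),
      (∀ j ∈ J, j ∈ (M.map (algebraMap ℝ ℂ)).charpoly.roots) ∧
      (∀ j y, ζ j (matL M y) = (j : ℂ) * ζ j y) ∧ 0 < C ∧
      ∀ y m, 0 ≤ m → (∀ j, ‖ζ j y‖ ≤ m) → ‖y‖ ≤ C * m := by
  classical
  set M' := M.map (algebraMap ℝ ℂ) with hM'
  set J := M'.charpoly.roots.toFinset with hJ
  have hmem : ∀ j ∈ J, j ∈ M'.charpoly.roots := fun j hj => Multiset.mem_toFinset.1 hj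
  have hcard : Fintype.card J = n := by
    rw [Fintype.card_coe, hJ, Multiset.toFinset_card_of_nodup hs,
      ← (IsAlgClosed.splits M'.charpoly).natDegree_eq_card_roots, Matrix.charpoly_natDegree_eq_dim,
      Fintype.card_fin]
  have hev : ∀ j : J, ∃ v : Fin n → ℂ,
      Module.End.HasEigenvector (Matrix.toLin' M'.transpose) (j : ℂ) v := by
    intro j
    have : Module.End.HasEigenvalue (Matrix.toLin' M'.transpose) (j : ℂ) := by
      rw [Module.End.hasEigenvalue_iff_isRoot_charpoly, Matrix.charpoly_toLin',
        Matrix.charpoly_transpose]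
      exact (Polynomial.mem_roots'.1 (hmem j j.2)).2
    exact this.exists_hasEigenvector
  choose v hv using hev
  have hli : LinearIndependent ℂ v := Module.End.eigenvectors_linearIndependent' _
    (fun j : J => (j : ℂ)) Subtype.val_injective v hv
  have hspan : Submodule.span ℂ (range v) = ⊤ :=
    hli.span_eq_top_of_card_eq_finrank' (by simp [hcard])
  set ofR : EuclideanSpace ℝ (Fin n) → Fin n → ℂ := fun y i => (y i : ℂ) with hofR
  set ζ₀ : J → EuclideanSpace ℝ (Fin n) →ₗ[ℝ] ℂ := fun j =>
    { toFun := fun y => v j ⬝ᵥ ofR y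
      map_add' := fun x y => by
        rw [← dotProduct_add]; congr 1; ext i; simp [hofR]
      map_smul' := fun a y => by
        rw [RingHom.id_apply, ← dotProduct_smul]; congr 1; ext i; simp [hofR] } with hζ₀
  -- The eigenvectors of the transpose belong to `n` distinct eigenvalues, so they span `ℂⁿ` and
  -- jointly separate points. An injective linear map on a finite-dimensional space is bounded
  -- below.
  have hinj : LinearMap.ker (LinearMap.pi ζ₀) = ⊥ := by
    rw [LinearMap.ker_eq_bot']
    intro y hy
    have h0 : ∀ w ∈ Submodule.span ℂ (range v), w ⬝ᵥ ofR y = 0 := by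
      intro w hw
      induction hw using Submodule.span_induction with
      | mem x hx => obtain ⟨j, rfl⟩ := hx; exact congrFun hy j
      | zero => simp
      | add a b _ _ ha hb => rw [add_dotProduct, ha, hb, add_zero]
      | smul a x _ hx => rw [smul_dotProduct, hx, smul_zero]
    ext i
    have := h0 (Pi.single i 1) (by rw [hspan]; trivial)
    rw [single_dotProduct, one_mul] at this
    exact Complex.ofReal_eq_zero.1 this
  obtain ⟨C, hC0, hC⟩ := (LinearMap.pi ζ₀).exists_antilipschitzWith hinj
  refine ⟨J, fun j => LinearMap.toContinuousLinearMap (ζ₀ j), C, hmem, fun j y => ?_, hC0,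
    fun y m hm hy => ?_⟩
  · have h1 : ofR (matL M y) = M'.mulVec (ofR y) := by
      ext i
      simp [hofR, matL_apply, hM', Matrix.mulVec, dotProduct]
    have h2 := (hv j).apply_eq_smul
    rw [Matrix.toLin'_apply, Matrix.mulVec_transpose] at h2
    change v j ⬝ᵥ ofR (matL M y) = (j : ℂ) * (v j ⬝ᵥ ofR y)
    rw [h1, Matrix.dotProduct_mulVec, h2, smul_dotProduct, smul_eq_mul]
  · have h1 := hC.le_mul_dist y 0
    rw [map_zero, dist_zero_right, dist_zero_right] at h1
    exact h1.trans (mul_le_mul_of_nonneg_left ((pi_norm_le_iff_of_nonneg hm).2 hy) C.2)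

end

end DelayRD

namespace DelayRD

noncomputable section

/-! ### The closed-loop equation of the controlled modes -/

/-- `A - c I + B K`. -/
def closedLoop (P : Coeffs) (k : ℕ) {N₀ : ℕ} (e : Fin N₀ → L2) (K : Matrix (Fin 2) (Fin N₀) ℝ) :
    EuclideanSpace ℝ (Fin N₀) →L[ℝ] EuclideanSpace ℝ (Fin N₀) :=
  matL (matA P N₀ + matB P k e * K) - P.c • ContinuousLinearMap.id ℝ _

/-- The right-hand side of the equation of the controlled modes. -/
def outputRate (P : Coeffs) (k : ℕ) {N₀ : ℕ} (e : Fin N₀ → L2) (K : Matrix (Fin 2) (Fin N₀) ℝ)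
    (h : ℝ → ℝ) (p : ℝ → L2) (Y : ℝ → EuclideanSpace ℝ (Fin N₀)) (s : ℝ) :
    EuclideanSpace ℝ (Fin N₀) :=
  closedLoop P k e K (Y s) + (P.c • Y (s - h s) + outputL e (p s))

section
variable {P : Coeffs} {k N₀ : ℕ} {e : Fin N₀ → L2} {K : Matrix (Fin 2) (Fin N₀) ℝ}
  {hm hM : ℝ} {Φ p : ℝ → L2} {h : ℝ → ℝ}

/-- Linearity in `u` extends the defining formula of the entries of `B` from the canonical basis,
which identifies the input term of the modal equation with `(B u)_n`. -/
theorem matL_matB_apply (u : EuclideanSpace ℝ (Fin 2)) (i : Fin N₀) :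
    matL (matB P k e) u i =
      inner ℝ (opLift P (P.b + P.c) k u - lam P i • lift P k u) (e i) := by
  set Λ : EuclideanSpace ℝ (Fin 2) →L[ℝ] ℝ :=
    innerSL ℝ (e i) ∘L (opLiftL P (P.b + P.c) k - lam P i • liftL P k) with hΛ
  have hΛu : ∀ v, Λ v = inner ℝ (opLift P (P.b + P.c) k v - lam P i • lift P k v) (e i) := fun v =>
    real_inner_comm (opLift P (P.b + P.c) k v - lam P i • lift P k v) (e i)
  have hu : u = ∑ m, u m • EuclideanSpace.single m (1 : ℝ) := by
    ext m; fin_cases m <;> simp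
  rw [← hΛu, matL_apply]
  conv_rhs => rw [hu]
  rw [map_sum]
  refine Finset.sum_congr rfl fun m _ => ?_
  rw [map_smul, hΛu, inner_sub_left, inner_smul_left, smul_eq_mul]
  simp only [matB, Matrix.of_apply, conj_trivial]
  ring

theorem closedLoop_apply (y : EuclideanSpace ℝ (Fin N₀)) (i : Fin N₀) :
    closedLoop P k e K y i = (lam P i - P.c) * y i +
      inner ℝ (opLift P (P.b + P.c) k (matL K y) - lam P i • lift P k (matL K y)) (e i) := by
  have h1 : matL (matA P N₀ + matB P k e * K) y i = lam P i * y i + matL (matB P k e) (matL K y) i := by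
    simp only [matL_apply, Matrix.add_apply, add_mul, Finset.sum_add_distrib]
    congr 1
    · simp [matA, Matrix.diagonal_apply]
    · simp only [Matrix.mul_apply, Finset.sum_mul, Finset.mul_sum]
      rw [Finset.sum_comm]
      exact Finset.sum_congr rfl fun _ _ => Finset.sum_congr rfl fun _ _ => by ring
  rw [← matL_matB_apply]
  simp only [closedLoop, sub_apply, smul_apply,
    ContinuousLinearMap.id_apply, PiLp.sub_apply, PiLp.smul_apply, smul_eq_mul, h1]
  ring

theorem intervalIntegrable_delayed_output (hA : IsAdmissible hm hM Φ p h)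
    {Y : ℝ → EuclideanSpace ℝ (Fin N₀)} (hY : ContinuousOn Y (Ici (-hM))) {T : ℝ} (hT : 0 ≤ T) :
    IntervalIntegrable (fun s => P.c • Y (s - h s) + outputL e (p s)) volume 0 T := by
  have hp := hA.intervalIntegrable hT
  exact (intervalIntegrable_of_continuousOn_Ici
    ((continuousOn_delay hY hA.delay hA.delay_bd).const_smul P.c) hT).add
    ⟨(outputL e).integrable_comp hp.1, (outputL e).integrable_comp hp.2⟩

theorem intervalIntegrable_outputRate (hA : IsAdmissible hm hM Φ p h)
    {Y : ℝ → EuclideanSpace ℝ (Fin N₀)} (hY : ContinuousOn Y (Ici (-hM))) {T : ℝ} (hT : 0 ≤ T) :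
    IntervalIntegrable (outputRate P k e K h p Y) volume 0 T :=
  (intervalIntegrable_of_continuousOn_Ici ((closedLoop P k e K).continuous.comp_continuousOn
    (hY.mono (Ici_subset_Ici.2 (by linarith [hA.hM_pos])))) hT).add
    (intervalIntegrable_delayed_output hA hY hT)

theorem outputRate_apply (Y : ℝ → EuclideanSpace ℝ (Fin N₀)) (s : ℝ) (i : Fin N₀) :
    outputRate P k e K h p Y s i = (lam P i - P.c) * Y s i +
      modalForcing P k h p (lam P i) (e i) (fun s => matL K (Y s)) (fun s => Y s i) s := by
  simp only [outputRate, modalForcing, PiLp.add_apply, PiLp.smul_apply, smul_eq_mul, closedLoop_apply,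
    outputL_apply]
  ring

/-- Each coordinate obeys `modal_duhamel`. Undoing the variation of constants and inserting `u = K
Y` turns the scalar formulas into one closed delay system. -/
theorem output_eq_integral {ι : Type} {b : HilbertBasis ι ℝ L2} {ev : ι → ℝ} {σ : ℝ}
    (hB : IsEigenbasis P b ev σ) (hA : IsAdmissible hm hM Φ p h)
    (he : ∀ i : Fin N₀, IsUnitEigenvector P (lam P i) (e i)) {X : ℝ → L2}
    (hX : IsMildSolution P k hM h Φ p (feedback e K X) X) {t : ℝ} (ht : 0 ≤ t) :
    outputL e (X t) = outputL e (Φ 0) +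
      ∫ s in (0 : ℝ)..t, outputRate P k e K h p (fun s => outputL e (X s)) s := by
  have hXc := IsMildSolution.continuousOn hA hX
  have hYc : ContinuousOn (fun s => outputL e (X s)) (Ici (-hM)) :=
    (outputL e).continuous.comp_continuousOn hXc
  ext i
  have hi := intervalIntegrable_outputRate (P := P) (k := k) (e := e) (K := K) hA hYc ht
  have h1 : ∫ s in (0 : ℝ)..t, outputRate P k e K h p (fun s => outputL e (X s)) s i =
      (∫ s in (0 : ℝ)..t, outputRate P k e K h p (fun s => outputL e (X s)) s) i :=
    (EuclideanSpace.proj i : EuclideanSpace ℝ (Fin N₀) →L[ℝ] ℝ).intervalIntegral_comp_comm hi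
  rw [PiLp.add_apply, ← h1, outputL_apply, outputL_apply]
  have hyc : ContinuousOn (fun s => inner ℝ (X s) (e i)) (Ici (-hM)) := hXc.inner continuousOn_const
  have h2 := integral_of_duhamel (𝕜 := ℝ) (ν := lam P i - P.c)
    (ε := fun t => Real.exp ((lam P i - P.c) * t)) (δ := fun t => Real.exp (-(lam P i - P.c) * t))
    (hasDerivAt_exp_const_mul _) (by simp) (by fun_prop)
    (fun t => by rw [← Real.exp_add, Real.exp_eq_one_iff]; ring)
    (fun T hT => intervalIntegrable_modalForcing (P := P) (k := k) hA hyc hX.2.2.1 (lam P i) (e i) hT)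
    (fun t ht => modal_duhamel hB hA hXc hX.2.2.1 ht (hX.eq_heat hB ht) (he i).2) ht
  rw [h2]
  congr 1
  refine intervalIntegral.integral_congr fun s _ => ?_
  simp only [outputRate_apply, outputL_apply]
  congr 2
  funext s
  exact feedback_eq e K X s

end

end

end DelayRD

namespace DelayRD

noncomputable section

/-! ### Decay of the controlled modes -/

theorem scalar_delay_decay {ν : ℂ} {z w : ℝ → ℂ} {h : ℝ → ℝ} {hm hM T κ α c N H : ℝ}
    (hm_pos : 0 < hm) (hM0 : 0 ≤ hM) (hκ0 : 0 ≤ κ) (hq : |c| * Real.exp (κ * hM) < α - κ)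
    (hh : ContinuousOn h (Ici 0)) (hb : ∀ t, 0 ≤ t → hm ≤ h t ∧ h t ≤ hM) (hν : ν.re ≤ -α)
    (hT : 0 ≤ T) (hz : ContinuousOn z (Ici (-hM)))
    (hw : ∀ T, 0 ≤ T → IntervalIntegrable w volume 0 T)
    (heq : ∀ t, 0 ≤ t → z t = z 0 + ∫ s in (0 : ℝ)..t, (ν * z s + (c • z (s - h s) + w s)))
    (hhist : ∀ t ∈ Icc (-hM) 0, ‖z t‖ ≤ N) (hH : 0 ≤ H)
    (hwH : ∀ᵐ s, s ∈ Ioc 0 T → Real.exp (κ * s) * ‖w s‖ ≤ H) :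
    ∀ t ∈ Icc (-hM) T, Real.exp (κ * t) * ‖z t‖ ≤
      (N + H / (α - κ)) / (1 - |c| * Real.exp (κ * hM) / (α - κ)) := by
  have hακ : 0 < α - κ := lt_of_le_of_lt (by positivity) hq
  have hexp : ∀ t : ℝ, 0 ≤ t → ‖Complex.exp (ν * t)‖ ≤ Real.exp (-α * t) := by
    intro t ht
    rw [Complex.norm_exp, Complex.re_mul_ofReal]
    exact Real.exp_le_exp.2 (mul_le_mul_of_nonneg_right hν ht)
  have hN0 : ‖z 0‖ ≤ N := hhist 0 ⟨by linarith, le_rfl⟩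
  refine delay_decay hm_pos hM0 hκ0 hq hb hT (hz.mono Icc_subset_Ici_self) hH ?_ ?_
  · intro t ht
    have h1 : Real.exp (κ * t) ≤ 1 := Real.exp_le_one_iff.2 (mul_nonpos_of_nonneg_of_nonpos hκ0 ht.2)
    calc Real.exp (κ * t) * ‖z t‖ ≤ 1 * ‖z t‖ := by gcongr
      _ ≤ N := by rw [one_mul]; exact hhist t ht
  · intro t ht
    have hfi : ∀ T, 0 ≤ T → IntervalIntegrable (fun s => c • z (s - h s) + w s) volume 0 T :=
      fun T hT => (intervalIntegrable_of_continuousOn_Ici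
        ((continuousOn_delay hz hh hb).const_smul c) hT).add (hw T hT)
    have hδ : ∀ t : ℝ, HasDerivAt (fun t : ℝ => Complex.exp (-ν * t)) (-ν * Complex.exp (-ν * t)) t := by
      intro t
      have h1 : HasDerivAt (fun t : ℝ => -ν * (t : ℂ)) (-ν) t := by
        simpa using (Complex.ofRealCLM.hasDerivAt (x := t)).const_mul (-ν)
      simpa [mul_comm] using h1.cexp
    have hd := duhamel_of_integral hδ (by simp) (hz.mono (Ici_subset_Ici.2 (by linarith))) hfi heq ht.1
    refine ⟨Complex.exp (ν * t) * z 0,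
      fun s => Complex.exp (ν * ((t - s : ℝ) : ℂ)) * (c • z (s - h s) + w s), ?_, ?_, ?_⟩
    · have h1 : z t = Complex.exp (ν * t) * (Complex.exp (-ν * t) * z t) := by
        rw [← mul_assoc, ← Complex.exp_add]; simp
      rw [h1, hd, mul_add, ← intervalIntegral.integral_const_mul]
      congr 1
      refine intervalIntegral.integral_congr fun s _ => ?_
      rw [← mul_assoc, ← Complex.exp_add]
      congr 2
      push_cast; ring
    · rw [norm_mul]
      calc Real.exp (κ * t) * (‖Complex.exp (ν * t)‖ * ‖z 0‖)
          ≤ Real.exp (κ * t) * (Real.exp (-α * t) * ‖z 0‖) := by gcongr; exact hexp t ht.1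
        _ = Real.exp (-((α - κ) * t)) * ‖z 0‖ := by
            rw [← mul_assoc, ← Real.exp_add]; congr 2; ring
        _ ≤ 1 * ‖z 0‖ := by
            gcongr
            exact Real.exp_le_one_iff.2 (neg_nonpos.2 (mul_nonneg hακ.le ht.1))
        _ ≤ N := by rw [one_mul]; exact hN0
    · filter_upwards [hwH] with s hs hst
      rw [norm_mul]
      have h1 := hs ⟨hst.1, hst.2.trans ht.2⟩
      have h2 : ‖w s‖ ≤ H * Real.exp (-κ * s) := by
        calc ‖w s‖ = Real.exp (κ * s) * ‖w s‖ * Real.exp (-κ * s) := by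
              rw [mul_right_comm, ← Real.exp_add]; simp
          _ ≤ _ := by gcongr
      refine mul_le_mul (hexp _ (by linarith [hst.2])) ?_ (norm_nonneg _) (Real.exp_nonneg _)
      refine (norm_add_le _ _).trans (add_le_add ?_ h2)
      rw [norm_smul, Real.norm_eq_abs]

/-- Bounds on the history and on the disturbance up to time `T`. -/
structure DataBound (κ hM T : ℝ) (Φ p : ℝ → L2) (F D : ℝ) : Prop where
  time : 0 ≤ T
  nonneg : 0 ≤ D
  hist : ∀ τ ∈ Icc (-hM) 0, ‖Φ τ‖ ≤ F
  dist : ∀ᵐ s, s ∈ Ioc 0 T → Real.exp (κ * s) * ‖p s‖ ≤ D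

theorem DataBound.hist_nonneg {κ hM T : ℝ} {Φ p : ℝ → L2} {F D : ℝ} (hD : DataBound κ hM T Φ p F D)
    (hM0 : 0 ≤ hM) : 0 ≤ F :=
  (norm_nonneg (Φ 0)).trans (hD.hist 0 ⟨by linarith, le_rfl⟩)

/-- A left eigenfunctional of `A + B K` reduces the system to a scalar equation with exponent `μ_j -
c`, of real part at most `-α`, so `scalar_delay_decay` applies; the joint lower bound recovers `Y`.
The constant is chosen before `Φ`, `p`, `h` and `T`. -/
theorem exists_output_bound {P : Coeffs} {k N₀ : ℕ} {e : Fin N₀ → L2}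
    {K : Matrix (Fin 2) (Fin N₀) ℝ} {hm hM : ℝ} {ι : Type} {b : HilbertBasis ι ℝ L2} {ev : ι → ℝ}
    {σ κ α : ℝ} (hB : IsEigenbasis P b ev σ)
    (he : ∀ i : Fin N₀, IsUnitEigenvector P (lam P i) (e i))
    (hsimple : ((matA P N₀ + matB P k e * K).map (algebraMap ℝ ℂ)).charpoly.roots.Nodup)
    (hstable : ∀ μ ∈ ((matA P N₀ + matB P k e * K).map (algebraMap ℝ ℂ)).charpoly.roots,
      μ.re ≤ P.c - α)
    (hκ0 : 0 ≤ κ) (hq : |P.c| * Real.exp (κ * hM) < α - κ) :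
    ∃ C, 0 ≤ C ∧ ∀ {Φ p : ℝ → L2} {h : ℝ → ℝ} {X : ℝ → L2} {T F D : ℝ},
      IsAdmissible hm hM Φ p h → IsMildSolution P k hM h Φ p (feedback e K X) X →
      DataBound κ hM T Φ p F D →
      ∀ t ∈ Icc (-hM) T, Real.exp (κ * t) * ‖outputL e (X t)‖ ≤ C * (F + D) := by
  obtain ⟨J, ζ, C, hJ, hζ, hC0, hC⟩ := exists_left_eigenfunctionals _ hsimple
  have hακ : 0 < α - κ := lt_of_le_of_lt (by positivity) hq
  have h1q : 0 < 1 - |P.c| * Real.exp (κ * hM) / (α - κ) := by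
    rw [sub_pos]; exact (div_lt_one hακ).2 hq
  set G : ℝ := (∑ j, ‖ζ j‖) * ‖outputL e‖ with hG
  have hG0 : 0 ≤ G := by positivity
  have hζG : ∀ j f, ‖ζ j (outputL e f)‖ ≤ G * ‖f‖ := by
    intro j f
    calc ‖ζ j (outputL e f)‖ ≤ ‖ζ j‖ * (‖outputL e‖ * ‖f‖) :=
          ((ζ j).le_opNorm _).trans (by gcongr; exact (outputL e).le_opNorm f)
      _ ≤ (∑ j, ‖ζ j‖) * (‖outputL e‖ * ‖f‖) := by
          gcongr
          exact Finset.single_le_sum (f := fun j => ‖ζ j‖) (fun _ _ => norm_nonneg _) (Finset.mem_univ j)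
      _ = G * ‖f‖ := by rw [hG, mul_assoc]
  refine ⟨C * (G * (1 + 1 / (α - κ)) / (1 - |P.c| * Real.exp (κ * hM) / (α - κ))),
    by positivity, ?_⟩
  intro Φ p h X T F D hA hX hD t ht
  have hM0 := hA.hM_pos.le
  have hF0 := hD.hist_nonneg hM0
  have hD0 := hD.nonneg
  have hXc := IsMildSolution.continuousOn hA hX
  have hYc : ContinuousOn (fun s => outputL e (X s)) (Ici (-hM)) :=
    (outputL e).continuous.comp_continuousOn hXc
  have h00 : X 0 = Φ 0 := hX.2.1 ⟨by linarith, le_rfl⟩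
  have key : ∀ j, Real.exp (κ * t) * ‖ζ j (outputL e (X t))‖ ≤
      (G * F + G * D / (α - κ)) / (1 - |P.c| * Real.exp (κ * hM) / (α - κ)) := by
    intro j
    refine scalar_delay_decay (ν := (j : ℂ) - P.c) (z := fun t => ζ j (outputL e (X t)))
      (w := fun s => ζ j (outputL e (p s))) hA.hm_pos hM0 hκ0 hq hA.delay hA.delay_bd
      ?_ hD.time ((ζ j).continuous.comp_continuousOn hYc) ?_ ?_ ?_ (by positivity) ?_ t ht
    · have := hstable j (hJ j j.2)
      simp only [Complex.sub_re, Complex.ofReal_re]; linarith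
    · intro T hT
      have hp := hA.intervalIntegrable hT
      exact ⟨((ζ j).comp (outputL e)).integrable_comp hp.1, ((ζ j).comp (outputL e)).integrable_comp hp.2⟩
    · intro t ht
      have hi := intervalIntegrable_outputRate (P := P) (k := k) (e := e) (K := K) hA hYc ht
      rw [output_eq_integral hB hA he hX ht, map_add, h00, ← (ζ j).intervalIntegral_comp_comm hi]
      congr 1
      refine intervalIntegral.integral_congr fun s _ => ?_
      simp only [outputRate, closedLoop, map_add, map_smul, sub_apply, smul_apply,
        ContinuousLinearMap.id_apply, map_sub, hζ, Complex.real_smul]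
      ring
    · intro t ht
      rw [hX.2.1 ht]
      exact (hζG j _).trans (by gcongr; exact hD.hist t ht)
    · filter_upwards [hD.dist] with s hs hst
      calc Real.exp (κ * s) * ‖ζ j (outputL e (p s))‖ ≤ Real.exp (κ * s) * (G * ‖p s‖) := by
            gcongr; exact hζG j _
        _ = G * (Real.exp (κ * s) * ‖p s‖) := by ring
        _ ≤ G * D := by gcongr; exact hs hst
  have h2 := hC (outputL e (X t)) (Real.exp (-κ * t) *
    ((G * F + G * D / (α - κ)) / (1 - |P.c| * Real.exp (κ * hM) / (α - κ)))) (by positivity) (by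
      intro j
      calc ‖ζ j (outputL e (X t))‖ = Real.exp (-κ * t) * (Real.exp (κ * t) * ‖ζ j (outputL e (X t))‖) := by
            rw [← mul_assoc, ← Real.exp_add]; simp
        _ ≤ _ := by gcongr; exact key j)
  calc Real.exp (κ * t) * ‖outputL e (X t)‖
      ≤ Real.exp (κ * t) * (C * (Real.exp (-κ * t) *
    ((G * F + G * D / (α - κ)) / (1 - |P.c| * Real.exp (κ * hM) / (α - κ))))) := by gcongr
    _ = Real.exp (κ * t) * Real.exp (-κ * t) *
      (C * ((G * F + G * D / (α - κ)) / (1 - |P.c| * Real.exp (κ * hM) / (α - κ)))) := by ring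
    _ = C * ((G * F + G * D / (α - κ)) / (1 - |P.c| * Real.exp (κ * hM) / (α - κ))) := by
      rw [← Real.exp_add]; simp
    _ ≤ C * ((G * (1 + 1 / (α - κ)) * (F + D)) / (1 - |P.c| * Real.exp (κ * hM) / (α - κ))) := by
      gcongr
      have : 0 ≤ G * D + G * F / (α - κ) := by positivity
      calc G * F + G * D / (α - κ) ≤ G * F + G * D / (α - κ) + (G * D + G * F / (α - κ)) := by linarith
        _ = G * (1 + 1 / (α - κ)) * (F + D) := by ring
    _ = _ := by ring

end

end DelayRD

namespace DelayRD

noncomputable section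

/-! ### Decay of the state -/

section
variable {P : Coeffs} {ι : Type} {b : HilbertBasis ι ℝ L2} {ev : ι → ℝ} {σ : ℝ}

theorem IsEigenbasis.bddAbove_eigenvalues (hB : IsEigenbasis P b ev σ) : BddAbove (eigenvalues P) := by
  refine ⟨σ, fun μ hμ => ?_⟩
  obtain ⟨f, hf0, hf⟩ := hμ
  obtain ⟨j, hj⟩ : ∃ j, inner ℝ (b j) f ≠ 0 := by
    by_contra! h
    exact hf0 (ext_coord (b := b) fun j => by rw [h j, inner_zero_right])
  have h1 := (hB.graph_iff _ _).1 hf j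
  rw [inner_smul_right] at h1
  rw [mul_right_cancel₀ hj h1]
  exact hB.le j

/-- Induction on `n`. Only boundedness above is used: whether the suprema defining `lam` are
attained is irrelevant. -/
theorem eq_lam_or_le_lam (hbdd : BddAbove (eigenvalues P)) {μ : ℝ} (hμ : μ ∈ eigenvalues P) (n : ℕ) :
    (∃ i < n, μ = lam P i) ∨ μ ≤ lam P n := by
  induction n with
  | zero => exact Or.inr (le_csSup hbdd hμ)
  | succ n ih =>
    rcases ih with ⟨i, hi, h⟩ | h
    · exact Or.inl ⟨i, by omega, h⟩
    · rcases h.eq_or_lt with h | h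
      · exact Or.inl ⟨n, by omega, h⟩
      · exact Or.inr (le_csSup (hbdd.mono fun _ h => h.1) ⟨hμ, h⟩)

open Classical in
/-- The spectral projection onto the modes with eigenvalue at most `ℓ`. -/
def tailProj (b : HilbertBasis ι ℝ L2) (ev : ι → ℝ) (ℓ : ℝ) : L2 →L[ℝ] L2 :=
  diagOp b fun j => if ev j ≤ ℓ then 1 else 0

open Classical in
theorem inner_tailProj (ℓ : ℝ) (f : L2) (j : ι) :
    inner ℝ (b j) (tailProj b ev ℓ f) = if ev j ≤ ℓ then inner ℝ (b j) f else 0 := by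
  rw [tailProj, inner_diagOp b (C := 1) (fun j => by split_ifs <;> simp), ite_mul, one_mul, zero_mul]

theorem norm_tailProj_le (ℓ : ℝ) (f : L2) : ‖tailProj b ev ℓ f‖ ≤ ‖f‖ := by
  refine (norm_le_of_coord_le b zero_le_one fun j => ?_).trans_eq (one_mul _)
  rw [inner_tailProj]
  split_ifs <;> simp

theorem IsEigenbasis.norm_tailProj_heat_le (hB : IsEigenbasis P b ev σ) {ℓ α t : ℝ}
    (hα : ℓ - P.c ≤ -α) (ht : 0 ≤ t) (f : L2) :
    ‖tailProj b ev ℓ (heat P b ev t f)‖ ≤ Real.exp (-α * t) * ‖tailProj b ev ℓ f‖ := by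
  refine norm_le_of_coord_le b (Real.exp_nonneg _) fun j => ?_
  rw [inner_tailProj, inner_tailProj, hB.inner_heat ht]
  split_ifs with h
  · rw [abs_mul, Real.abs_exp]
    gcongr
    linarith
  · simp

/-- Here `lam P N₀` is `λ_{N₀+1}`. A basis vector with larger eigenvalue is `± e i` for some `i`, by
simplicity, and orthogonality makes distinct vectors use distinct `i`. Parseval then compares with
the sum of squared outputs. -/
theorem IsEigenbasis.norm_sub_tailProj_le (hB : IsEigenbasis P b ev σ) {N₀ : ℕ} {e : Fin N₀ → L2}
    (he : ∀ i : Fin N₀, IsUnitEigenvector P (lam P i) (e i)) (f : L2) :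
    ‖f - tailProj b ev (lam P N₀) f‖ ≤ ‖outputL e f‖ := by
  have hex : ∀ j : {j // ¬ ev j ≤ lam P N₀}, ∃ (i : Fin N₀) (s : ℝ), b j = s • e i ∧ s ^ 2 = 1 := by
    rintro ⟨j, hj⟩
    have hb1 : ‖b j‖ = 1 := b.orthonormal.1 j
    have hbj : b j ≠ 0 := fun h0 => by rw [h0, norm_zero] at hb1; exact zero_ne_one hb1
    rcases eq_lam_or_le_lam hB.bddAbove_eigenvalues ⟨b j, hbj, hB.graph j⟩ N₀ with ⟨i, hi, h⟩ | h
    · have hei := he ⟨i, hi⟩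
      have he0 : e ⟨i, hi⟩ ≠ 0 := fun h0 => by
        have := hei.1
        rw [h0, norm_zero] at this; exact zero_ne_one this
      have hg := hB.graph j
      rw [h] at hg
      obtain ⟨s, hs⟩ := hei.2.simple hg he0
      refine ⟨⟨i, hi⟩, s, hs, ?_⟩
      rw [hs, norm_smul, hei.1, mul_one, Real.norm_eq_abs] at hb1
      rw [← sq_abs, hb1, one_pow]
    · exact absurd h hj
  choose g s hgs hs using hex
  have hinj : Function.Injective g := by
    intro j j' hjj
    by_contra hne
    have hne' : (j : ι) ≠ j' := fun h => hne (Subtype.ext h)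
    have h0 : inner ℝ (b j) (b j') = 0 := b.orthonormal.2 hne'
    rw [hgs j, hgs j', hjj, inner_smul_left, inner_smul_right, real_inner_self_eq_norm_sq,
      (he _).1] at h0
    have h1 := hs j
    have h2 := hs j'
    simp only [conj_trivial, one_pow, mul_one] at h0
    rcases mul_eq_zero.1 h0 with h3 | h3 <;> simp [h3] at h1 h2
  have hcoord : ∀ j, inner ℝ (b j) (f - tailProj b ev (lam P N₀) f) =
      if ev j ≤ lam P N₀ then 0 else inner ℝ (b j) f := by
    intro j
    rw [inner_sub_right, inner_tailProj]
    split_ifs <;> simp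
  have h1 := hasSum_coord_sq b (f - tailProj b ev (lam P N₀) f)
  have h2 : HasSum ((fun j => inner ℝ (b j) (f - tailProj b ev (lam P N₀) f) ^ 2) ∘
      ((↑) : {j // ¬ ev j ≤ lam P N₀} → ι)) (‖f - tailProj b ev (lam P N₀) f‖ ^ 2) := by
    refine (hasSum_subtype_iff_of_support_subset (s := {j | ¬ ev j ≤ lam P N₀}) fun j hj => ?_).2 h1
    intro hle
    simp only [Function.mem_support, hcoord] at hj
    simp [hle] at hj
  have h3 := hasSum_fintype fun i : Fin N₀ => ‖outputL e f i‖ ^ 2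
  rw [← EuclideanSpace.norm_sq_eq] at h3
  have h4 : ‖f - tailProj b ev (lam P N₀) f‖ ^ 2 ≤ ‖outputL e f‖ ^ 2 := by
    refine hasSum_le_inj g hinj (fun _ _ => sq_nonneg _) (fun j => ?_) h2 h3
    rw [Function.comp_apply, hcoord, if_neg j.2, outputL_apply, hgs j, inner_smul_left, mul_pow,
      conj_trivial, hs, one_mul, Real.norm_eq_abs, sq_abs, real_inner_comm]
  exact le_of_sq_le_sq h4 (norm_nonneg _)

theorem norm_le_exp_mul {E : Type*} [NormedAddCommGroup E] {x : E} {κ t m : ℝ}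
    (h : Real.exp (κ * t) * ‖x‖ ≤ m) : ‖x‖ ≤ m * Real.exp (-κ * t) := by
  calc ‖x‖ = Real.exp (κ * t) * ‖x‖ * Real.exp (-κ * t) := by
        rw [mul_right_comm, ← Real.exp_add]; simp
    _ ≤ _ := by gcongr

variable {k N₀ : ℕ} {e : Fin N₀ → L2} {K : Matrix (Fin 2) (Fin N₀) ℝ} {hm hM κ α : ℝ}

/-- The derivative of the feedback decays with the controlled modes. -/
theorem ae_norm_deriv_feedback_le (hB : IsEigenbasis P b ev σ)
    (he : ∀ i : Fin N₀, IsUnitEigenvector P (lam P i) (e i)) (hκ0 : 0 ≤ κ)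
    {Φ p : ℝ → L2} {h : ℝ → ℝ} {X : ℝ → L2} {T F D m : ℝ}
    (hA : IsAdmissible hm hM Φ p h) (hX : IsMildSolution P k hM h Φ p (feedback e K X) X)
    (hD : DataBound κ hM T Φ p F D)
    (hm : ∀ t ∈ Icc (-hM) T, Real.exp (κ * t) * ‖outputL e (X t)‖ ≤ m) :
    ∀ᵐ s, s ∈ Ioc 0 T → Real.exp (κ * s) * ‖deriv (feedback e K X) s‖ ≤
      ‖K‖ * ((‖closedLoop P k e K‖ + |P.c| * Real.exp (κ * hM)) * m + ‖outputL e‖ * D) := by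
  have hM0 := hA.hM_pos.le
  have hXc := IsMildSolution.continuousOn hA hX
  have hYc : ContinuousOn (fun s => outputL e (X s)) (Ici (-hM)) :=
    (outputL e).continuous.comp_continuousOn hXc
  have h00 : X 0 = Φ 0 := hX.2.1 ⟨by linarith, le_rfl⟩
  have hi := intervalIntegrable_outputRate (P := P) (k := k) (e := e) (K := K) hA hYc hD.time
  -- The feedback is a primitive of an explicit function of `Y` and `p`, so its derivative is
  -- estimated without differentiating the state.
  have hprim : ∀ t ∈ Icc 0 T, feedback e K X t = feedback e K X 0 + ∫ s in (0 : ℝ)..t,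
      matL K (outputRate P k e K h p (fun s => outputL e (X s)) s) := by
    intro t ht
    rw [feedback_eq, feedback_eq, output_eq_integral hB hA he hX ht.1, map_add, h00,
      (matL K).intervalIntegral_comp_comm (intervalIntegrable_outputRate hA hYc ht.1)]
  have hder := ae_deriv_eq_of_eq_primitive hD.time
    ⟨(matL K).integrable_comp hi.1, (matL K).integrable_comp hi.2⟩ hprim
  filter_upwards [hder, hD.dist] with s hs1 hs2 hst
  rw [uIoc_of_le hD.time] at hs1
  rw [hs1 hst]
  have hbs := hA.delay_bd s hst.1.le
  have e1 := hm s ⟨by linarith [hst.1], hst.2⟩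
  have e2 := hm (s - h s) ⟨by linarith [hst.1], by linarith [hst.2, hA.hm_pos]⟩
  have e3 : Real.exp (κ * s) * ‖outputL e (X (s - h s))‖ ≤ Real.exp (κ * hM) * m := by
    calc Real.exp (κ * s) * ‖outputL e (X (s - h s))‖
        = Real.exp (κ * h s) * (Real.exp (κ * (s - h s)) * ‖outputL e (X (s - h s))‖) := by
          rw [← mul_assoc, ← Real.exp_add]; congr 2; ring
      _ ≤ Real.exp (κ * hM) * m := by
          gcongr
          exact hbs.2
  calc Real.exp (κ * s) * ‖matL K (outputRate P k e K h p (fun s => outputL e (X s)) s)‖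
      ≤ Real.exp (κ * s) * (‖K‖ * (‖closedLoop P k e K‖ * ‖outputL e (X s)‖ +
        (|P.c| * ‖outputL e (X (s - h s))‖ + ‖outputL e‖ * ‖p s‖))) := by
        gcongr
        refine (norm_matL_apply_le K _).trans ?_
        gcongr
        refine (norm_add_le _ _).trans (add_le_add ((closedLoop P k e K).le_opNorm _) ?_)
        refine (norm_add_le _ _).trans (add_le_add ?_ ((outputL e).le_opNorm _))
        rw [norm_smul, Real.norm_eq_abs]
    _ = ‖K‖ * (‖closedLoop P k e K‖ * (Real.exp (κ * s) * ‖outputL e (X s)‖) +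
        (|P.c| * (Real.exp (κ * s) * ‖outputL e (X (s - h s))‖) +
          ‖outputL e‖ * (Real.exp (κ * s) * ‖p s‖))) := by ring
    _ ≤ ‖K‖ * (‖closedLoop P k e K‖ * m + (|P.c| * (Real.exp (κ * hM) * m) + ‖outputL e‖ * D)) := by
        gcongr
        exact hs2 hst
    _ = _ := by ring

/-- The projection commutes with the delayed term and contracts the semigroup at rate `α`, so
`delay_decay` applies in `L²` at once. Only the norms of `L_k` and `𝒜 L_k` enter, and no factor
`λ_n`. -/
theorem tail_bound (hB : IsEigenbasis P b ev σ) {ℓ : ℝ} (hα : ℓ - P.c ≤ -α) (hκ0 : 0 ≤ κ)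
    (hq : |P.c| * Real.exp (κ * hM) < α - κ)
    {Φ p : ℝ → L2} {h : ℝ → ℝ} {X : ℝ → L2} {u : ℝ → EuclideanSpace ℝ (Fin 2)} {T F D m m' : ℝ}
    (hA : IsAdmissible hm hM Φ p h) (hX : IsMildSolution P k hM h Φ p u X)
    (hD : DataBound κ hM T Φ p F D) (hm' : 0 ≤ m')
    (hu : ∀ t ∈ Icc 0 T, Real.exp (κ * t) * ‖u t‖ ≤ m)
    (hdu : ∀ᵐ s, s ∈ Ioc 0 T → Real.exp (κ * s) * ‖deriv u s‖ ≤ m') :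
    ∀ t ∈ Icc (-hM) T, Real.exp (κ * t) * ‖tailProj b ev ℓ (X t)‖ ≤
      (F + 2 * ‖liftL P k‖ * m + (‖opLiftL P P.b k‖ * m + ‖liftL P k‖ * m' + D) / (α - κ)) /
        (1 - |P.c| * Real.exp (κ * hM) / (α - κ)) := by
  have hM0 := hA.hM_pos.le
  have hακ : 0 < α - κ := lt_of_le_of_lt (by positivity) hq
  have hXc := IsMildSolution.continuousOn hA hX
  have hF0 := hD.hist_nonneg hM0
  have hD0 := hD.nonneg
  have hu0 : ‖u 0‖ ≤ m := by simpa using hu 0 ⟨le_rfl, hD.time⟩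
  have hm0 : 0 ≤ m := (norm_nonneg _).trans hu0
  refine delay_decay (z := fun t => tailProj b ev ℓ (X t)) hA.hm_pos hM0 hκ0 hq hA.delay_bd hD.time
    (((tailProj b ev ℓ).continuous.comp_continuousOn hXc).mono Icc_subset_Ici_self)
    (by positivity) ?_ ?_
  · intro t ht
    have h1 : Real.exp (κ * t) ≤ 1 := Real.exp_le_one_iff.2 (mul_nonpos_of_nonneg_of_nonpos hκ0 ht.2)
    have h2 : ‖tailProj b ev ℓ (X t)‖ ≤ F := by
      rw [hX.2.1 ht]; exact (norm_tailProj_le ℓ _).trans (hD.hist t ht)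
    calc Real.exp (κ * t) * ‖tailProj b ev ℓ (X t)‖ ≤ 1 * F := by gcongr
      _ ≤ F + 2 * ‖liftL P k‖ * m := by rw [one_mul]; exact le_add_of_nonneg_right (by positivity)
  · intro t ht
    have hFi := intervalIntegrable_forcing (P := P) (k := k) hA hXc hX.2.2.1 ht.1
    have hconv := intervalIntegrable_convolution hB.continuous_heat hFi t
    refine ⟨tailProj b ev ℓ (heat P b ev t (Φ 0 - lift P k (u 0))) + tailProj b ev ℓ (lift P k (u t)),
      fun s => tailProj b ev ℓ (heat P b ev (t - s) (forcing P k h p u X s)), ?_, ?_, ?_⟩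
    · simp only
      rw [(tailProj b ev ℓ).intervalIntegral_comp_comm hconv, ← map_add, ← map_add, ← hX.eq_heat hB ht.1]
    · have h1 : Real.exp (κ * t) * ‖tailProj b ev ℓ (heat P b ev t (Φ 0 - lift P k (u 0)))‖ ≤
          F + ‖liftL P k‖ * m := by
        have h2 : ‖Φ 0 - lift P k (u 0)‖ ≤ F + ‖liftL P k‖ * m := by
          refine (norm_sub_le _ _).trans (add_le_add (hD.hist 0 ⟨by linarith, le_rfl⟩) ?_)
          exact ((liftL P k).le_opNorm (u 0)).trans (by gcongr)
        calc Real.exp (κ * t) * ‖tailProj b ev ℓ (heat P b ev t (Φ 0 - lift P k (u 0)))‖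
            ≤ Real.exp (κ * t) * (Real.exp (-α * t) * (F + ‖liftL P k‖ * m)) := by
              gcongr
              refine (hB.norm_tailProj_heat_le hα ht.1 _).trans ?_
              gcongr
              exact (norm_tailProj_le ℓ _).trans h2
          _ = Real.exp (-((α - κ) * t)) * (F + ‖liftL P k‖ * m) := by
              rw [← mul_assoc, ← Real.exp_add]; congr 2; ring
          _ ≤ 1 * (F + ‖liftL P k‖ * m) := by
              gcongr
              exact Real.exp_le_one_iff.2 (neg_nonpos.2 (mul_nonneg hακ.le ht.1))
          _ = _ := one_mul _
      have h3 : Real.exp (κ * t) * ‖tailProj b ev ℓ (lift P k (u t))‖ ≤ ‖liftL P k‖ * m := by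
        calc Real.exp (κ * t) * ‖tailProj b ev ℓ (lift P k (u t))‖
            ≤ Real.exp (κ * t) * (‖liftL P k‖ * ‖u t‖) := by
              gcongr
              exact (norm_tailProj_le ℓ _).trans ((liftL P k).le_opNorm (u t))
          _ = ‖liftL P k‖ * (Real.exp (κ * t) * ‖u t‖) := by ring
          _ ≤ _ := by gcongr; exact hu t ht
      calc _ ≤ Real.exp (κ * t) * (‖tailProj b ev ℓ (heat P b ev t (Φ 0 - lift P k (u 0)))‖ +
            ‖tailProj b ev ℓ (lift P k (u t))‖) := by gcongr; exact norm_add_le _ _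
        _ ≤ _ := by rw [mul_add]; linarith
    · filter_upwards [hD.dist, hdu] with s hs1 hs2 hst
      have hst' : s ∈ Ioc 0 T := ⟨hst.1, hst.2.trans ht.2⟩
      refine (hB.norm_tailProj_heat_le hα (sub_nonneg.2 hst.2) _).trans ?_
      gcongr
      have e1 := norm_le_exp_mul (hs1 hst')
      have e2 := norm_le_exp_mul (hs2 hst')
      have e3 := norm_le_exp_mul (hu s ⟨hst.1.le, hst'.2⟩)
      simp only [forcing, map_add, map_sub, map_smul]
      have n1 : ‖tailProj b ev ℓ (opLift P P.b k (u s))‖ ≤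
          ‖opLiftL P P.b k‖ * (m * Real.exp (-κ * s)) :=
        (norm_tailProj_le ℓ _).trans (((opLiftL P P.b k).le_opNorm (u s)).trans (by gcongr))
      have n2 : ‖tailProj b ev ℓ (lift P k (deriv u s))‖ ≤
          ‖liftL P k‖ * (m' * Real.exp (-κ * s)) :=
        (norm_tailProj_le ℓ _).trans (((liftL P k).le_opNorm (deriv u s)).trans (by gcongr))
      have n3 : ‖tailProj b ev ℓ (p s)‖ ≤ D * Real.exp (-κ * s) := (norm_tailProj_le ℓ _).trans e1
      have n4 : ‖P.c • tailProj b ev ℓ (X (s - h s))‖ = |P.c| * ‖tailProj b ev ℓ (X (s - h s))‖ := by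
        rw [norm_smul, Real.norm_eq_abs]
      refine (norm_add_le _ _).trans ?_
      refine (add_le_add (norm_add_le _ _) n3).trans ?_
      rw [n4]
      have := norm_sub_le (tailProj b ev ℓ (opLift P P.b k (u s)))
        (tailProj b ev ℓ (lift P k (deriv u s)))
      linarith

/-- The a priori estimate for the closed loop. -/
theorem exists_state_bound (hB : IsEigenbasis P b ev σ)
    (he : ∀ i : Fin N₀, IsUnitEigenvector P (lam P i) (e i))
    (hsimple : ((matA P N₀ + matB P k e * K).map (algebraMap ℝ ℂ)).charpoly.roots.Nodup)
    (hstable : ∀ μ ∈ ((matA P N₀ + matB P k e * K).map (algebraMap ℝ ℂ)).charpoly.roots,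
      μ.re ≤ P.c - α)
    (hα : lam P N₀ ≤ P.c - α) (hκ0 : 0 ≤ κ) (hq : |P.c| * Real.exp (κ * hM) < α - κ) :
    ∃ C, 0 < C ∧ ∀ {Φ p : ℝ → L2} {h : ℝ → ℝ} {X : ℝ → L2} {T F D : ℝ},
      IsAdmissible hm hM Φ p h → IsMildSolution P k hM h Φ p (feedback e K X) X →
      DataBound κ hM T Φ p F D → ∀ t ∈ Icc (-hM) T,
        Real.exp (κ * t) * ‖X t‖ ≤ C * (F + D) ∧
        Real.exp (κ * t) * ‖outputL e (X t)‖ ≤ C * (F + D) := by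
  obtain ⟨C, hC0, hC⟩ := exists_output_bound (hm := hm) hB he hsimple hstable hκ0 hq
  have hακ : 0 < α - κ := lt_of_le_of_lt (by positivity) hq
  have h1q : 0 < 1 - |P.c| * Real.exp (κ * hM) / (α - κ) := by
    rw [sub_pos]; exact (div_lt_one hακ).2 hq
  -- Per unit of `F + D`, `M₁` bounds the weighted input, `M₂` its derivative, and `M₃` the
  -- resulting tail.
  set M₁ := ‖K‖ * C with hM₁
  set M₂ := ‖K‖ * ((‖closedLoop P k e K‖ + |P.c| * Real.exp (κ * hM)) * C + ‖outputL e‖) with hM₂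
  have hM₁0 : 0 ≤ M₁ := by positivity
  have hM₂0 : 0 ≤ M₂ := by positivity
  set M₃ := (1 + 2 * ‖liftL P k‖ * M₁ +
      (‖opLiftL P P.b k‖ * M₁ + ‖liftL P k‖ * M₂ + 1) / (α - κ)) /
        (1 - |P.c| * Real.exp (κ * hM) / (α - κ)) with hM₃
  have hM₃0 : 0 < M₃ := by positivity
  refine ⟨M₃ + C, by positivity, ?_⟩
  intro Φ p h X T F D hA hX hD
  have hF0 := hD.hist_nonneg hA.hM_pos.le
  have hD0 := hD.nonneg
  have hout := hC hA hX hD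
  have hu : ∀ t ∈ Icc 0 T, Real.exp (κ * t) * ‖feedback e K X t‖ ≤ M₁ * (F + D) := by
    intro t ht
    rw [feedback_eq]
    calc Real.exp (κ * t) * ‖matL K (outputL e (X t))‖
        ≤ Real.exp (κ * t) * (‖K‖ * ‖outputL e (X t)‖) := by gcongr; exact norm_matL_apply_le K _
      _ = ‖K‖ * (Real.exp (κ * t) * ‖outputL e (X t)‖) := by ring
      _ ≤ ‖K‖ * (C * (F + D)) := by
        exact mul_le_mul_of_nonneg_left (hout t ⟨by linarith [ht.1, hA.hM_pos], ht.2⟩) (norm_nonneg K)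
      _ = _ := by rw [hM₁]; ring
  have hdu : ∀ᵐ s, s ∈ Ioc 0 T →
      Real.exp (κ * s) * ‖deriv (feedback e K X) s‖ ≤ M₂ * (F + D) := by
    filter_upwards [ae_norm_deriv_feedback_le hB he hκ0 hA hX hD hout] with s hs hst
    refine (hs hst).trans ?_
    rw [hM₂, mul_assoc ‖K‖, add_mul _ _ (F + D), mul_assoc _ C]
    gcongr
    linarith
  have htail := tail_bound hB (ℓ := lam P N₀) (by linarith) hκ0 hq hA hX hD (by positivity) hu hdu
  intro t ht
  refine ⟨?_, (hout t ht).trans (by gcongr; linarith)⟩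
  have h1 : Real.exp (κ * t) * ‖tailProj b ev (lam P N₀) (X t)‖ ≤ M₃ * (F + D) := by
    refine (htail t ht).trans ?_
    calc _ ≤ (F + D + 2 * ‖liftL P k‖ * (M₁ * (F + D)) + (‖opLiftL P P.b k‖ * (M₁ * (F + D)) +
          ‖liftL P k‖ * (M₂ * (F + D)) + (F + D)) / (α - κ)) /
            (1 - |P.c| * Real.exp (κ * hM) / (α - κ)) := by
          gcongr <;> linarith
      _ = M₃ * (F + D) := by rw [hM₃]; ring
  have h2 : ‖X t‖ ≤ ‖tailProj b ev (lam P N₀) (X t)‖ + ‖outputL e (X t)‖ := by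
    calc ‖X t‖ = ‖tailProj b ev (lam P N₀) (X t) + (X t - tailProj b ev (lam P N₀) (X t))‖ := by
          rw [add_sub_cancel]
      _ ≤ _ := (norm_add_le _ _).trans (by gcongr; exact hB.norm_sub_tailProj_le he _)
  calc Real.exp (κ * t) * ‖X t‖
      ≤ Real.exp (κ * t) * (‖tailProj b ev (lam P N₀) (X t)‖ + ‖outputL e (X t)‖) := by gcongr
    _ ≤ _ := by rw [mul_add, add_mul]; exact add_le_add h1 (hout t ht)

end

end

end DelayRD

namespace DelayRD

noncomputable section

/-! ### Well-posedness of the closed loop -/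

/-- Solutions of `Y' = N Y + c Y(t - h(t)) + w`, in integrated form. -/
theorem exists_delay_ode {E : Type*} [NormedAddCommGroup E] [NormedSpace ℝ E] [CompleteSpace E]
    (N : E →L[ℝ] E) (c : ℝ) {Ψ w : ℝ → E} {h : ℝ → ℝ} {hm hM : ℝ} (hm_pos : 0 < hm)
    (hΨ : ContinuousOn Ψ (Icc (-hM) 0)) (hw : ∀ T, 0 ≤ T → IntervalIntegrable w volume 0 T)
    (hh : ContinuousOn h (Ici 0)) (hb : ∀ t, 0 ≤ t → hm ≤ h t ∧ h t ≤ hM) :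
    ∃ Y : ℝ → E, ContinuousOn Y (Ici (-hM)) ∧ EqOn Y Ψ (Icc (-hM) 0) ∧
      ∀ t, 0 ≤ t → Y t = Ψ 0 + ∫ s in (0 : ℝ)..t, (N (Y s) + (c • Y (s - h s) + w s)) := by
  set U : ℝ → E →L[ℝ] E := fun t => NormedSpace.exp (t • N) with hUdef
  have hU' : ∀ t, HasDerivAt U (N * U t) t := fun t => hasDerivAt_exp_smul_const' N t
  have hUc : Continuous U := continuous_iff_continuousAt.2 fun t => (hU' t).continuousAt
  have hU : ∀ x, Continuous fun t => U t x := fun x => hUc.clm_apply continuous_const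
  have hU0 : U 0 = 1 := by simp [hUdef, NormedSpace.exp_zero]
  have hadd : ∀ s t, U (s + t) = U s * U t := by
    intro s t
    let _ : NormedAlgebra ℚ (E →L[ℝ] E) := NormedAlgebra.restrictScalars ℚ ℝ (E →L[ℝ] E)
    simp only [hUdef, add_smul]
    exact NormedSpace.exp_add_of_commute (((Commute.refl N).smul_left s).smul_right t)
  obtain ⟨Y, hYc, hYΨ, hY⟩ := exists_delay_volterra hU
    (g := fun t => U t (Ψ 0) + ∫ s in (0 : ℝ)..t, U (t - s) (w s)) c hm_pos
    ((hU _).continuousOn.add (continuousOn_convolution hU hw)) hΨ (by simp [hU0]) hh hb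
  refine ⟨Y, hYc, hYΨ, ?_⟩
  have hdi : ∀ T, 0 ≤ T → IntervalIntegrable (fun s => c • Y (s - h s)) volume 0 T := fun T hT =>
    intervalIntegrable_of_continuousOn_Ici ((continuousOn_delay hYc hh hb).const_smul c) hT
  have hfi : ∀ T, 0 ≤ T → IntervalIntegrable (fun s => c • Y (s - h s) + w s) volume 0 T :=
    fun T hT => (hdi T hT).add (hw T hT)
  have hφi : ∀ T, 0 ≤ T →
      IntervalIntegrable (fun s => U (0 - s) (c • Y (s - h s) + w s)) volume 0 T := fun T hT =>
    intervalIntegrable_convolution hU (hfi T hT) 0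
  -- Since `U` is a group, `U(t - s) = U(t) U(-s)` writes `Y` as a `C¹` family of operators acting
  -- on a primitive, to which the product rule applies.
  have hYU : ∀ t, 0 ≤ t →
      Y t = U t (Ψ 0 + ∫ s in (0 : ℝ)..t, U (0 - s) (c • Y (s - h s) + w s)) := by
    intro t ht
    rw [hY t ht, map_add, ← (U t).intervalIntegral_comp_comm (hφi t ht), add_assoc,
      ← intervalIntegral.integral_add (intervalIntegrable_convolution hU (hw t ht) t)
        (intervalIntegrable_convolution hU (hdi t ht) t)]
    congr 1
    refine intervalIntegral.integral_congr fun s _ => ?_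
    have : U (t - s) = U t * U (0 - s) := by rw [← hadd]; congr 1; ring
    simp only [this, map_add, mul_apply_eq_comp]
    rw [add_comm]
  intro t ht
  rw [hYU t ht, clm_apply_primitive hU' (continuous_const.mul hUc) ht (hφi t ht), hU0]
  congr 1
  refine intervalIntegral.integral_congr fun s hs => ?_
  rw [uIcc_of_le ht] at hs
  have h1 : U s (U (0 - s) (c • Y (s - h s) + w s)) = c • Y (s - h s) + w s := by
    rw [← mul_apply_eq_comp, ← hadd, add_sub_cancel, hU0]; rfl
  simp only [h1, mul_apply_eq_comp, ← hYU s hs.1]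

section
variable {P : Coeffs} {ι : Type} {b : HilbertBasis ι ℝ L2} {ev : ι → ℝ} {σ : ℝ}
  {k N₀ : ℕ} {e : Fin N₀ → L2} {K : Matrix (Fin 2) (Fin N₀) ℝ} {hm hM : ℝ}
  {Φ p : ℝ → L2} {h : ℝ → ℝ}

/-- The open-loop problem with a prescribed input. -/
theorem exists_open_loop (hB : IsEigenbasis P b ev σ) (hA : IsAdmissible hm hM Φ p h)
    {u : ℝ → EuclideanSpace ℝ (Fin 2)} (hu : ∀ T, 0 ≤ T → AbsolutelyContinuousOnInterval u 0 T) :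
    ∃ X : ℝ → L2, ContinuousOn X (Ici (-hM)) ∧ EqOn X Φ (Icc (-hM) 0) ∧ ∀ t, 0 ≤ t →
      X t = heat P b ev t (Φ 0 - lift P k (u 0)) + lift P k (u t) +
        ∫ s in (0 : ℝ)..t, heat P b ev (t - s) (forcing P k h p u X s) := by
  have hwi : ∀ T, 0 ≤ T → IntervalIntegrable
      (fun s => opLift P P.b k (u s) - lift P k (deriv u s) + p s) volume 0 T := by
    intro T hT
    have h1 : IntervalIntegrable (fun s => opLift P P.b k (u s)) volume 0 T :=
      ((opLiftL P P.b k).continuous.comp_continuousOn (hu T hT).continuousOn).intervalIntegrable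
    have hd := (absolutelyContinuousOnInterval_euclidean hT (hu T hT)).1
    have h2 : IntervalIntegrable (fun s => lift P k (deriv u s)) volume 0 T :=
      ⟨(liftL P k).integrable_comp hd.1, (liftL P k).integrable_comp hd.2⟩
    exact (h1.sub h2).add (hA.intervalIntegrable hT)
  have huc : ContinuousOn u (Ici 0) := by
    intro t ht
    have h1 : ContinuousOn u (Icc 0 (t + 1)) := by
      have ht0 : 0 ≤ t := ht
      have := (hu (t + 1) (by linarith)).continuousOn
      rwa [uIcc_of_le (by linarith)] at this
    refine (h1 t ⟨ht, by linarith⟩).mono_of_mem_nhdsWithin ?_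
    filter_upwards [self_mem_nhdsWithin, mem_nhdsWithin_of_mem_nhds (Iio_mem_nhds (lt_add_one t))]
      with s hs1 hs2
    exact ⟨hs1, (mem_Iio.1 hs2).le⟩
  have hheat0 : heat P b ev 0 = ContinuousLinearMap.id ℝ L2 := hB.isGeneratedBy.1.zero
  obtain ⟨X, hXc, hXΦ, hX⟩ := exists_delay_volterra hB.continuous_heat
    (g := fun t => heat P b ev t (Φ 0 - lift P k (u 0)) + lift P k (u t) +
      ∫ s in (0 : ℝ)..t, heat P b ev (t - s) (opLift P P.b k (u s) - lift P k (deriv u s) + p s))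
    P.c hA.hm_pos
    (((hB.continuous_heat _).continuousOn.add ((liftL P k).continuous.comp_continuousOn huc)).add
      (continuousOn_convolution hB.continuous_heat hwi)) hA.history (by simp [hheat0])
    hA.delay hA.delay_bd
  refine ⟨X, hXc, hXΦ, fun t ht => ?_⟩
  have hdi : IntervalIntegrable (fun s => P.c • X (s - h s)) volume 0 t :=
    intervalIntegrable_of_continuousOn_Ici
      ((continuousOn_delay hXc hA.delay hA.delay_bd).const_smul P.c) ht
  rw [hX t ht, add_assoc, ← intervalIntegral.integral_add
    (intervalIntegrable_convolution hB.continuous_heat (hwi t ht) t)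
    (intervalIntegrable_convolution hB.continuous_heat hdi t)]
  congr 1
  refine intervalIntegral.integral_congr fun s _ => ?_
  simp only [← map_add, forcing]
  congr 1
  abel

/-- The feedback involves only finitely many modes, so `Y` can be found before the state. The
fixed-point problem for the input then reduces to checking that the open-loop state driven by `K Y`
has output `Y`. -/
theorem exists_closed_loop (hB : IsEigenbasis P b ev σ) (hA : IsAdmissible hm hM Φ p h)
    (he : ∀ i : Fin N₀, IsUnitEigenvector P (lam P i) (e i)) :
    ∃ X, IsMildSolution P k hM h Φ p (feedback e K X) X := by
  have hM0 := hA.hM_pos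
  obtain ⟨Y, hYc, hYΦ, hY⟩ := exists_delay_ode (closedLoop P k e K) P.c
    (Ψ := fun t => outputL e (Φ t)) (w := fun s => outputL e (p s)) hA.hm_pos
    ((outputL e).continuous.comp_continuousOn hA.history)
    (fun T hT => ⟨(outputL e).integrable_comp (hA.intervalIntegrable hT).1,
      (outputL e).integrable_comp (hA.intervalIntegrable hT).2⟩) hA.delay hA.delay_bd
  have hY0 : Y 0 = outputL e (Φ 0) := hYΦ ⟨by linarith, le_rfl⟩
  have hYr : ∀ t, 0 ≤ t → Y t = Y 0 + ∫ s in (0 : ℝ)..t, outputRate P k e K h p Y s := by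
    rw [hY0]; exact hY
  have hri : ∀ T, 0 ≤ T → IntervalIntegrable (outputRate P k e K h p Y) volume 0 T := fun T hT =>
    intervalIntegrable_outputRate hA hYc hT
  set u : ℝ → EuclideanSpace ℝ (Fin 2) := fun t => matL K (Y t) with hu
  have huac : ∀ v : ℝ → EuclideanSpace ℝ (Fin 2), EqOn v u (Ici 0) →
      ∀ T, 0 ≤ T → AbsolutelyContinuousOnInterval v 0 T := by
    intro v hv T hT
    refine absolutelyContinuousOnInterval_of_eq_primitive hT
      (φ := fun s => matL K (outputRate P k e K h p Y s))
      ⟨(matL K).integrable_comp (hri T hT).1, (matL K).integrable_comp (hri T hT).2⟩ fun t ht => ?_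
    rw [hv ht.1, hv (le_refl (0 : ℝ)), (matL K).intervalIntegral_comp_comm (hri t ht.1), hu]
    simp only
    rw [hYr t ht.1, map_add]
  obtain ⟨X, hXc, hXΦ, hX⟩ := exists_open_loop (k := k) hB hA (huac u fun _ _ => rfl)
  have hXY : ∀ t, -hM ≤ t → outputL e (X t) = Y t := by
    intro t ht
    ext i
    rw [outputL_apply]
    set ν := lam P i - P.c with hν
    have hyc : ContinuousOn (fun s => Y s i) (Ici (-hM)) :=
      (EuclideanSpace.proj i : EuclideanSpace ℝ (Fin N₀) →L[ℝ] ℝ).continuous.comp_continuousOn hYc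
    have hxc : ContinuousOn (fun s => inner ℝ (X s) (e i)) (Ici (-hM)) := hXc.inner continuousOn_const
    have hYi : ∀ t, 0 ≤ t → Y t i = Y 0 i + ∫ s in (0 : ℝ)..t,
        (ν * Y s i + modalForcing P k h p (lam P i) (e i) u (fun s => Y s i) s) := by
      intro t ht
      have h1 : ∫ s in (0 : ℝ)..t, outputRate P k e K h p Y s i =
          (∫ s in (0 : ℝ)..t, outputRate P k e K h p Y s) i :=
        (EuclideanSpace.proj i : EuclideanSpace ℝ (Fin N₀) →L[ℝ] ℝ).intervalIntegral_comp_comm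
          (hri t ht)
      simp only [outputRate_apply] at h1
      conv_lhs => rw [hYr t ht, PiLp.add_apply, ← h1]
    have hdY : ∀ t, 0 ≤ t → Real.exp (-ν * t) * Y t i = Y 0 i + ∫ s in (0 : ℝ)..t,
        Real.exp (-ν * s) * modalForcing P k h p (lam P i) (e i) u (fun s => Y s i) s := fun t ht =>
      duhamel_of_integral (𝕜 := ℝ) (δ := fun t => Real.exp (-ν * t)) (hasDerivAt_exp_const_mul (-ν))
        (by simp) (hyc.mono (Ici_subset_Ici.2 (by linarith)))
        (fun T hT => intervalIntegrable_modalForcing hA hyc (huac u fun _ _ => rfl) _ _ hT) hYi ht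
    have hdX := fun t (ht : 0 ≤ t) =>
      modal_duhamel hB hA hXc (huac u fun _ _ => rfl) ht (hX t ht) (he i).2
    -- Both the mode of `X` and the coordinate of `Y` are driven by the same prescribed `u`. Input
    -- and disturbance cancel in the difference, leaving a homogeneous delay equation.
    have hz := eq_zero_of_delay_volterra (d := fun t => inner ℝ (X t) (e i) - Y t i)
      (U := fun t => Real.exp (ν * t) • ContinuousLinearMap.id ℝ ℝ) P.c hA.hm_pos hA.delay_bd
      (fun t ht => by
        simp only [hXΦ ht, hYΦ ht, outputL_apply, sub_self])
      (fun t ht => by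
        have hix := intervalIntegrable_modalForcing (P := P) (k := k) hA hxc
          (huac u fun _ _ => rfl) (lam P i) (e i) ht
        have hiy := intervalIntegrable_modalForcing (P := P) (k := k) hA hyc
          (huac u fun _ _ => rfl) (lam P i) (e i) ht
        have hE : ContinuousOn (fun s => Real.exp (-ν * s)) (uIcc 0 t) := by fun_prop
        have h1 : Real.exp (-ν * t) * (inner ℝ (X t) (e i) - Y t i) = ∫ s in (0 : ℝ)..t,
            Real.exp (-ν * s) * (P.c * (inner ℝ (X (s - h s)) (e i) - Y (s - h s) i)) := by
          rw [mul_sub, hdX t ht, hdY t ht, hY0, outputL_apply, add_sub_add_left_eq_sub,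
            ← intervalIntegral.integral_sub (hix.continuousOn_mul hE) (hiy.continuousOn_mul hE)]
          refine intervalIntegral.integral_congr fun s _ => ?_
          simp only [modalForcing]
          ring
        have h2 : inner ℝ (X t) (e i) - Y t i =
            Real.exp (ν * t) * (Real.exp (-ν * t) * (inner ℝ (X t) (e i) - Y t i)) := by
          rw [← mul_assoc, ← Real.exp_add]; simp
        rw [h2, h1, ← intervalIntegral.integral_const_mul]
        refine intervalIntegral.integral_congr fun s _ => ?_
        simp only [smul_apply, ContinuousLinearMap.id_apply, smul_eq_mul]
        rw [← mul_assoc, ← Real.exp_add]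
        congr 2
        ring) t ht
    exact sub_eq_zero.1 hz
  have hfu : ∀ t, -hM ≤ t → feedback e K X t = u t := fun t ht => by rw [feedback_eq, hXY t ht]
  refine ⟨X, hXc.mono (Ici_subset_Ici.2 (by linarith)), hXΦ,
    huac _ fun t ht => hfu t (by have : (0 : ℝ) ≤ t := ht; linarith), heat P b ev, hB.isGeneratedBy, ?_⟩
  intro t ht
  rw [hX t ht, hfu 0 (by linarith), hfu t (by linarith)]
  congr 1
  refine intervalIntegral.integral_congr fun s hs => ?_
  rw [uIcc_of_le ht] at hs
  -- The two inputs agree from `-hM < 0` on, hence in a neighbourhood of every `s ≥ 0`, including `s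
  -- = 0`.
  have hder : deriv (feedback e K X) s = deriv u s := by
    refine Filter.EventuallyEq.deriv_eq ?_
    filter_upwards [Ioi_mem_nhds (show -hM < s by linarith [hs.1])] with r hr
    exact hfu r (le_of_lt hr)
  simp only [forcing, hder, hfu s (by linarith [hs.1])]

/-- The difference of two mild solutions solves the homogeneous problem. -/
theorem IsMildSolution.sub_feedback (hB : IsEigenbasis P b ev σ) (hA : IsAdmissible hm hM Φ p h)
    {X X' : ℝ → L2} (hX : IsMildSolution P k hM h Φ p (feedback e K X) X)
    (hX' : IsMildSolution P k hM h Φ p (feedback e K X') X') :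
    IsMildSolution P k hM h (fun _ => 0) (fun _ => 0) (feedback e K fun t => X t - X' t)
      fun t => X t - X' t := by
  have hXc := IsMildSolution.continuousOn hA hX
  have hXc' := IsMildSolution.continuousOn hA hX'
  have hf : (feedback e K fun t => X t - X' t) = feedback e K X - feedback e K X' := by
    funext t
    simp only [feedback_eq, Pi.sub_apply, map_sub]
  refine ⟨hX.1.sub hX'.1, fun t ht => ?_, fun T hT => ?_, heat P b ev, hB.isGeneratedBy, ?_⟩
  · simp only [hX.2.1 ht, hX'.2.1 ht, sub_self]
  · rw [hf]; exact (hX.2.2.1 T hT).sub (hX'.2.2.1 T hT)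
  · intro t ht
    have hi := intervalIntegrable_convolution hB.continuous_heat
      (intervalIntegrable_forcing (P := P) (k := k) hA hXc hX.2.2.1 ht) t
    have hi' := intervalIntegrable_convolution hB.continuous_heat
      (intervalIntegrable_forcing (P := P) (k := k) hA hXc' hX'.2.2.1 ht) t
    have hl : ∀ v w, lift P k (v - w) = lift P k v - lift P k w := fun v w => (liftL P k).map_sub v w
    have hol : ∀ v w, opLift P P.b k (v - w) = opLift P P.b k v - opLift P P.b k w := fun v w =>
      (opLiftL P P.b k).map_sub v w
    have hInt : ∫ s in (0 : ℝ)..t, heat P b ev (t - s)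
          (opLift P P.b k ((feedback e K fun t => X t - X' t) s) -
            lift P k (deriv (feedback e K fun t => X t - X' t) s) +
            P.c • (X (s - h s) - X' (s - h s)) + 0) =
        (∫ s in (0 : ℝ)..t, heat P b ev (t - s) (forcing P k h p (feedback e K X) X s)) -
          ∫ s in (0 : ℝ)..t, heat P b ev (t - s) (forcing P k h p (feedback e K X') X' s) := by
      rw [← intervalIntegral.integral_sub hi hi']
      refine intervalIntegral.integral_congr_ae ?_
      filter_upwards [(absolutelyContinuousOnInterval_euclidean ht (hX.2.2.1 t ht)).2.1,
        (absolutelyContinuousOnInterval_euclidean ht (hX'.2.2.1 t ht)).2.1] with s h1 h2 hs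
      have hs' := uIoc_subset_uIcc hs
      rw [hf, deriv_sub (h1 hs') (h2 hs'), Pi.sub_apply, hl, hol, ← map_sub, forcing, forcing, smul_sub]
      congr 1
      abel
    rw [hInt, hf]
    simp only
    rw [Pi.sub_apply, Pi.sub_apply, hl, hl, hX.eq_heat hB ht, hX'.eq_heat hB ht]
    simp only [map_sub, map_zero]
    abel

end

end

end DelayRD

namespace DelayRD

noncomputable section

/-! ### The stability estimate -/

/-- Finitely many strict inequalities leave a uniform gap, so a single rate serves all controlled
modes and the tail. -/
theorem exists_common_margin (s : Finset ℝ) {m : ℝ} (hs : ∀ x ∈ s, x < m) :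
    ∃ m' < m, ∀ x ∈ s, x ≤ m' := by
  rcases s.eq_empty_or_nonempty with rfl | hne
  · exact ⟨m - 1, by linarith, by simp⟩
  · exact ⟨s.max' hne, hs _ (s.max'_mem hne), fun x hx => s.le_max' x hx⟩

theorem norm_le_supHistory {hM : ℝ} {Φ : ℝ → L2} (hΦ : ContinuousOn Φ (Icc (-hM) 0)) {τ : ℝ}
    (hτ : τ ∈ Icc (-hM) 0) : ‖Φ τ‖ ≤ supHistory hM Φ :=
  le_csSup (isCompact_Icc.bddAbove_image hΦ.norm) ⟨τ, hτ, rfl⟩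

theorem ae_norm_le_fadingEssSup {κ t : ℝ} (hκ : 0 ≤ κ) {p : ℝ → L2}
    (hp : MemLp p ⊤ (volume.restrict (Icc 0 t))) :
    ∀ᵐ s, s ∈ Ioc 0 t → Real.exp (κ * s) * ‖p s‖ ≤ Real.exp (κ * t) * fadingEssSup κ p t := by
  -- Finiteness of the essential supremum is needed for the passage to a real number in
  -- `fadingEssSup` to lose nothing.
  have hf : MemLp (fun τ => Real.exp (-κ * (t - τ)) • p τ) ⊤ (volume.restrict (Icc 0 t)) := by
    refine hp.of_le ((by fun_prop : Continuous fun τ => Real.exp (-κ * (t - τ))).aestronglyMeasurable.smul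
      hp.1) ?_
    filter_upwards [ae_restrict_mem measurableSet_Icc] with s hs
    rw [norm_smul, Real.norm_eq_abs, Real.abs_exp]
    refine mul_le_of_le_one_left (norm_nonneg _) (Real.exp_le_one_iff.2 ?_)
    nlinarith [hs.2]
  have h1 := ae_le_eLpNormEssSup (f := fun τ => Real.exp (-κ * (t - τ)) • p τ)
    (μ := volume.restrict (Icc 0 t))
  rw [← eLpNorm_exponent_top, ae_restrict_iff' measurableSet_Icc] at h1
  filter_upwards [h1] with s hs hst
  have h2 := ENNReal.toReal_mono hf.2.ne (hs (Ioc_subset_Icc_self hst))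
  rw [toReal_enorm, norm_smul, Real.norm_eq_abs, Real.abs_exp] at h2
  calc Real.exp (κ * s) * ‖p s‖ = Real.exp (κ * t) * (Real.exp (-κ * (t - s)) * ‖p s‖) := by
        rw [← mul_assoc, ← Real.exp_add]; congr 2; ring
    _ ≤ _ := by gcongr; exact h2

end

end DelayRD

/-! ### The stability theorem -/

theorem theorem1 (P : DelayRD.Coeffs) (k : ℕ) (hk : DelayRD.IsLiftExponent P k)
    (hm hM : ℝ) (hm_pos : 0 < hm) (hmM : hm < hM)
    (N₀ : ℕ) (hN₀ : 1 ≤ N₀) (hlam : DelayRD.lam P N₀ < -2 * √5 * |P.c|)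
    (e : Fin N₀ → DelayRD.L2)
    (he : ∀ i : Fin N₀, DelayRD.IsUnitEigenvector P (DelayRD.lam P i) (e i))
    (K : Matrix (Fin 2) (Fin N₀) ℝ)
    (hsimple : ((DelayRD.matA P N₀ + DelayRD.matB P k e * K).map
      (algebraMap ℝ ℂ)).charpoly.roots.Nodup)
    (hstable : ∀ μ ∈ ((DelayRD.matA P N₀ + DelayRD.matB P k e * K).map
      (algebraMap ℝ ℂ)).charpoly.roots, μ.re < -3 * |P.c|) :
    ∃ κ C₀ C₁ : ℝ, 0 < κ ∧ 0 < C₀ ∧ 0 < C₁ ∧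
      ∀ Φ : ℝ → DelayRD.L2, ContinuousOn Φ (Icc (-hM) 0) →
      ∀ p : ℝ → DelayRD.L2, (∀ T : ℝ, 0 ≤ T → MemLp p ⊤ (volume.restrict (Icc 0 T))) →
      ∀ h : ℝ → ℝ, ContinuousOn h (Ici 0) → (∀ t, 0 ≤ t → hm ≤ h t ∧ h t ≤ hM) →
      ∃ X : ℝ → DelayRD.L2,
        DelayRD.IsMildSolution P k hM h Φ p (DelayRD.feedback e K X) X ∧
        (∀ X' : ℝ → DelayRD.L2,
          DelayRD.IsMildSolution P k hM h Φ p (DelayRD.feedback e K X') X' →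
          EqOn X' X (Ici (-hM))) ∧
        ∀ t, 0 ≤ t →
          ‖X t‖ ≤ C₀ * Real.exp (-κ * t) * DelayRD.supHistory hM Φ +
            C₁ * DelayRD.fadingEssSup κ p t ∧
          ‖DelayRD.feedback e K X t‖ ≤
            C₀ * ‖K‖ * Real.exp (-κ * t) * DelayRD.supHistory hM Φ +
              C₁ * ‖K‖ * DelayRD.fadingEssSup κ p t := by
  classical
  obtain ⟨ι, b, ev, σ, hB₁, hB₂, hB₃⟩ := DelayRD.exists_eigenbasis P (P.b + P.c)
  have hB : DelayRD.IsEigenbasis P b ev σ := ⟨hB₁, hB₂, hB₃⟩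
  have hc := neg_abs_le P.c
  have hc0 := abs_nonneg P.c
  -- The threshold `c - |c|` is what the small-gain argument needs: `m < c - |c|` says that `α = c -
  -- m` exceeds `|c|`. Both spectral hypotheses lie below it because `c - |c| ≥ -2|c|`.
  obtain ⟨m, hm', hmle⟩ := DelayRD.exists_common_margin (m := P.c - |P.c|)
    (insert (DelayRD.lam P N₀) (((DelayRD.matA P N₀ + DelayRD.matB P k e * K).map
      (algebraMap ℝ ℂ)).charpoly.roots.toFinset.image Complex.re)) (by
    intro x hx
    rcases Finset.mem_insert.1 hx with rfl | hx
    · have h5 : (1 : ℝ) ≤ √5 := Real.one_le_sqrt.2 (by norm_num)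
      nlinarith
    · obtain ⟨μ, hμ, rfl⟩ := Finset.mem_image.1 hx
      have := hstable μ (Multiset.mem_toFinset.1 hμ)
      linarith)
  obtain ⟨κ, hκ0, hκ⟩ := DelayRD.exists_rate (α := P.c - m) (c := P.c) (hM := hM) (by linarith)
  obtain ⟨C, hC0, hC⟩ := DelayRD.exists_state_bound (hm := hm) hB he hsimple
    (fun μ hμ => by
      have := hmle μ.re (Finset.mem_insert_of_mem
        (Finset.mem_image_of_mem _ (Multiset.mem_toFinset.2 hμ)))
      linarith)
    (by linarith [hmle _ (Finset.mem_insert_self _ _)]) hκ0.le hκ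
  refine ⟨κ, C, C, hκ0, hC0, hC0, fun Φ hΦ p hp h hh hb => ?_⟩
  have hA : DelayRD.IsAdmissible hm hM Φ p h := ⟨hm_pos, hmM, hΦ, hp, hh, hb⟩
  obtain ⟨X, hX⟩ := DelayRD.exists_closed_loop (k := k) (K := K) hB hA he
  refine ⟨X, hX, fun X' hX' t ht => ?_, fun t ht => ?_⟩
  · have hA0 : DelayRD.IsAdmissible hm hM (fun _ => 0) (fun _ => 0) h :=
      ⟨hm_pos, hmM, continuousOn_const, fun _ _ => MemLp.zero, hh, hb⟩
    -- Uniqueness also covers `t < 0`, while the horizon of the data bound must be nonnegative.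
    have hD : DelayRD.DataBound κ hM (max t 0) (fun _ => 0) (fun _ => 0) 0 0 :=
      ⟨le_max_right _ _, le_rfl, by simp, by simp⟩
    have h1 := (hC hA0 (DelayRD.IsMildSolution.sub_feedback hB hA hX' hX) hD t
      ⟨ht, le_max_left _ _⟩).1
    rw [add_zero, mul_zero] at h1
    have h2 := nonpos_of_mul_nonpos_right h1 (Real.exp_pos _)
    exact sub_eq_zero.1 (norm_le_zero_iff.1 h2)
  -- The horizon is the evaluation time itself; dividing the weighted estimate by `e^{κ t}` then
  -- leaves exactly the fading essential supremum.
  · have hD : DelayRD.DataBound κ hM t Φ p (DelayRD.supHistory hM Φ)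
        (Real.exp (κ * t) * DelayRD.fadingEssSup κ p t) :=
      ⟨ht, mul_nonneg (Real.exp_nonneg _) ENNReal.toReal_nonneg,
        fun τ hτ => DelayRD.norm_le_supHistory hΦ hτ, DelayRD.ae_norm_le_fadingEssSup hκ0.le (hp t ht)⟩
    obtain ⟨h1, h2⟩ := hC hA hX hD t ⟨by linarith, le_rfl⟩
    have h3 : C * (DelayRD.supHistory hM Φ + Real.exp (κ * t) * DelayRD.fadingEssSup κ p t) *
        Real.exp (-κ * t) = C * Real.exp (-κ * t) * DelayRD.supHistory hM Φ +
          C * DelayRD.fadingEssSup κ p t := by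
      have h4 : Real.exp (κ * t) * Real.exp (-κ * t) = 1 := by rw [← Real.exp_add]; simp
      linear_combination C * DelayRD.fadingEssSup κ p t * h4
    have h5 := DelayRD.norm_le_exp_mul h1
    have h6 := DelayRD.norm_le_exp_mul h2
    rw [h3] at h5 h6
    refine ⟨h5, ?_⟩
    rw [DelayRD.feedback_eq]
    calc ‖DelayRD.matL K (DelayRD.outputL e (X t))‖
        ≤ ‖K‖ * ‖DelayRD.outputL e (X t)‖ := DelayRD.norm_matL_apply_le K _
      _ ≤ ‖K‖ * (C * Real.exp (-κ * t) * DelayRD.supHistory hM Φ +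
          C * DelayRD.fadingEssSup κ p t) := by gcongr
      _ = _ := by ring
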